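/- Let $\mathbb K$ be a perfect field and $F\in\mathbb K[[x]][y]$ monic in $y$ of degree $d\ge 1$, where the characteristic of $\mathbb K$ is $0$ or greater than $d$. **Polygons.** The Newton polygon $\mathcal N(A)$ of $A=\sum_i a_i y^i\neq 0$ is the lower convex hull of the points $(i,\mathrm{val}(a_i))$ with $a_i\ne0$, where $\mathrm{val}$ is the $x$-valuation. Its *lower edge* is the edge ending at its rightmost point (the point itself if the polygon is a point). The *boundary polynomial* $\bar A$ is the sum of the terms $a_{ij}x^jy^i$ of $A$ with $(i,j)\in\mathcal N(A)$. A polynomial $A$ monic in $y$ over $\mathbb L[[x]]$ is *degenerated* over the field $\mathbb L$, with edge data $(q,m,P,N)$, if $\mathcal N(A)$ is a segment of positive length of slope $-m/q$, with $q>0$ and $m\ge0$ coprime, and $\bar A=c\,\big(P(y^q/x^m)\,x^{m\deg P}\big)^N$ with $c\in\mathbb L^\times$ and $P\in\mathbb L[Z]$ monic irreducible. **The polynomials $H_k$.** The Abhyankar shift of a polynomial $G=\sum_{i\le N}g_iy^i$, monic of degree $N$, is $\tau(x,y)=(x,y+c(x))$ with $c=-g_{N-1}/N$. Let $\mathbb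 K_0=\mathbb K$, $N_0=d$, $\pi_0=\tau_0$ the shift of $F$ and $H_0=\tau_0^*F$. If $N_{k-1}>1$ and $H_{k-1}$ is degenerated over $\mathbb K_{k-1}$, with edge data $(q_k,m_k,P_k,N_k)$, put $\ell_k=\deg P_k$, $\mathbb K_k=\mathbb K_{k-1}[Z]/(P_k)$, $z_k$ the class of $Z$, $q_ks_k-m_kt_k=1$ with $0\le t_k<q_k$, and $\sigma_k(x,y)=(z_k^{t_k}x^{q_k},x^{m_k}(y+z_k^{s_k}))$. Let $G_k$ be the Weierstrass polynomial of $\sigma_k^*H_{k-1}/x^{q_km_k\ell_kN_k}$, let $\tau_k$ be its Abhyankar shift, and put $H_k=\tau_k^*G_k$ and $\pi_k=\pi_{k-1}\circ\sigma_k\circ\tau_k$. Let $g$ be the first index for which $N_g=1$ or $H_g$ is not degenerated over $\mathbb K_g$. **Valuations, minimal polynomials and approximate roots.** For $0\le k\le g$ and $G\in\mathbb K[[x]][y]$ let $v_k(G)$ be the $x$-valuation of $\pi_k^*G\in\mathbb K_k[[x]][y]$, and $\lambda_k(G)\in\mathbb K_k$ the trailing coefficient in $y$ of $(\pi_k^*G/x^{v_k(G)})|_{x=0}$.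 Let $\phi_{-1}=x$ and let $\phi_k\in\mathbb K[[x]][y]$ be the monic irreducible polynomial of degree $q_1\cdots q_k\,\ell_1\cdots\ell_k$ with $(\pi_k^*\phi_k)(x,0)=0$. Let $\psi_{-1}=x$ and let $\psi_k$ be the $N_k$-th approximate root of $F$, that is, the monic polynomial of degree $d/N_k$ with $\deg(F-\psi_k^{N_k})<d-d/N_k$. **The boundary formula along $\Psi$.** Fix $0\le k\le g$. Let $\mathcal B$ be the set of $B=(b_{-1},\dots,b_k)\in\mathbb N^{k+2}$ with $b_{i-1}<q_i\ell_i$ for $1\le i\le k$, let $V=(v_k(\phi_i))_{-1\le i\le k}$, $\Lambda=(\lambda_k(\phi_i))_{-1\le i\le k}$ and $B_0=(0,\dots,0,N_k)$. Expand $F=\sum_{B\in\mathcal B}f'_B\prod_{i=-1}^k\psi_i^{b_i}$ with $f'_B\in\mathbb K$. Let $$w'_i=\min\{\langle B,V\rangle : b_k=i,\ f'_B\ne0\}-v_k(F)$$ ($\infty$ if the set is empty), let $\mathcal N'_k$ be the lower convex hull of the points $(i,w'_i)$, $0\le i\le N_k$, $w'_i\neq\infty$, and $$\bar H'_k=\sum_{(i,w'_i)\in\mathcal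 N'_k}\Big(\sum_{B\in\mathcal B,\ b_k=i,\ \langle B,V\rangle=w'_i+v_k(F)}f'_B\,\Lambda^{B-B_0}\Big)x^{w'_i}y^i .$$ **Theorem.** For $0\le k<g$ one has $\mathcal N(H_k)=\mathcal N'_k$ and $\bar H_k=\bar H'_k$. For $k=g$, the polygons $\mathcal N(H_g)$ and $\mathcal N'_g$ have the same lower edge, and $\bar H_g$ and $\bar H'_g$ have the same restriction to it. -/

import Mathlib

open scoped PowerSeries Polynomial

universe u

namespace ApproxRoots

/-! Throughout, `L⟦X⟧[X]` is the ring `L[[x]][y]`: the variable `y` is `Polynomial.X` and `x` is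
`PowerSeries.X` (a constant polynomial `Polynomial.C PowerSeries.X`). -/

section Polygons

/-- Lower convex hull of a set of points of the plane: the lower boundary of its convex hull. -/
def lowerHull (S : Set (ℝ × ℝ)) : Set (ℝ × ℝ) :=
  {p | p ∈ convexHull ℝ S ∧ ∀ p' ∈ convexHull ℝ S, p'.1 = p.1 → p.2 ≤ p'.2}

/-- The lower edge of a Newton polygon `C`: the edge that ends at the point of `C` of largest
abscissa, that is, all points of `C` joined to that point by a segment contained in `C`. If `C` is
a single point, this is that point. -/
def lowerEdge (C : Set (ℝ × ℝ)) : Set (ℝ × ℝ) :=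
  {p | ∃ r ∈ C, (∀ p' ∈ C, p'.1 ≤ r.1) ∧ p ∈ C ∧ segment ℝ p r ⊆ C}

variable {L : Type u} [Field L]

/-- The Newton polygon of `A = ∑ aᵢ yⁱ`: the lower convex hull of the points `(i, val aᵢ)`,
where `aᵢ ≠ 0`. -/
def newtonPolygon (A : L⟦X⟧[X]) : Set (ℝ × ℝ) :=
  lowerHull {p | ∃ i j : ℕ, (A.coeff i).order = (j : ℕ∞) ∧ p = ((i : ℝ), (j : ℝ))}

open Classical in
/-- The sum of those terms `a_{ij} x^j y^i` of `A` with `(i, j) ∈ E`. -/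
noncomputable def restrictTo (E : Set (ℝ × ℝ)) (A : L⟦X⟧[X]) : L⟦X⟧[X] :=
  ∑ i ∈ Finset.range (A.natDegree + 1), Polynomial.monomial i
    (PowerSeries.mk fun j =>
      if ((i : ℝ), (j : ℝ)) ∈ E then PowerSeries.coeff j (A.coeff i) else 0)

/-- The boundary polynomial of `A` (with respect to its Newton polygon). -/
noncomputable def boundary (A : L⟦X⟧[X]) : L⟦X⟧[X] :=
  restrictTo (newtonPolygon A) A

/-- The quasi-homogeneous polynomial `P(y^q / x^m) x^{m deg P}`. -/
noncomputable def quasiHom (q m : ℕ) (P : L[X]) : L⟦X⟧[X] :=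
  ∑ j ∈ Finset.range (P.natDegree + 1), Polynomial.monomial (q * j)
    (PowerSeries.C (P.coeff j) * PowerSeries.X ^ (m * (P.natDegree - j)))

/-- Edge data `(q, m, P, N)` of a degenerated monic polynomial `A`, together with the Bézout
cofactors `(s, t)`. The polynomial `A` is degenerated over `L` if and only if such data exist.
Since `A` is monic in `y` its slopes `-m/q` are nonpositive, so that `m` is a natural number. -/
structure EdgeData (A : L⟦X⟧[X]) where
  q : ℕ
  m : ℕ
  P : L[X]
  N : ℕ
  s : ℕ
  t : ℕ
  q_pos : 0 < q
  coprime : Nat.Coprime q m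
  /-- the Newton polygon is straight of slope `-m/q` -/
  straight : ∃ a b : ℝ × ℝ, a.1 < b.1 ∧ b.2 - a.2 = -((m : ℝ) / q) * (b.1 - a.1) ∧
    newtonPolygon A = segment ℝ a b
  monic : P.Monic
  irreducible : Irreducible P
  boundary_eq : ∃ c : L, c ≠ 0 ∧
    boundary A = Polynomial.C (PowerSeries.C c) * quasiHom q m P ^ N
  bezout : q * s = m * t + 1
  t_lt : t < q

end Polygons

section Transforms

variable {L : Type u} [Field L]

/-- `c(x) = - g_{N-1}(x) / N`, where `G = ∑ gᵢ yⁱ` has degree `N`. -/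
noncomputable def shiftSeries (G : L⟦X⟧[X]) : L⟦X⟧ :=
  -(PowerSeries.C ((G.natDegree : L)⁻¹) * G.coeff (G.natDegree - 1))

/-- The pull-back `τ*` by the Abhyankar shift `τ(x, y) = (x, y + c(x))` attached to `G`. -/
noncomputable def tauPull (G : L⟦X⟧[X]) : L⟦X⟧[X] →+* L⟦X⟧[X] :=
  Polynomial.compRingHom (Polynomial.X + Polynomial.C (shiftSeries G))

/-- The ring homomorphism `a(x) ↦ a(z^t x^q)` on power series, for `q > 0`. -/
noncomputable def scaleX (z : L) (t q : ℕ) (hq : 0 < q) : L⟦X⟧ →+* L⟦X⟧ :=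
  (PowerSeries.expand q hq.ne' : L⟦X⟧ →ₐ[L] L⟦X⟧).toRingHom.comp (PowerSeries.rescale (z ^ t))

/-- The pull-back `σ*` by the rational Newton-Puiseux transform
`σ(x, y) = (z^t x^q, x^m (y + z^s))`. -/
noncomputable def sigmaPull (z : L) (q m s t : ℕ) (hq : 0 < q) : L⟦X⟧[X] →+* L⟦X⟧[X] :=
  Polynomial.eval₂RingHom (Polynomial.C.comp (scaleX z t q hq))
    (Polynomial.C (PowerSeries.X ^ m) *
      (Polynomial.X + Polynomial.C (PowerSeries.C (z ^ s))))

/-- `A / x^M`, for `A` divisible by `x^M`. -/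
noncomputable def divXPow (M : ℕ) (A : L⟦X⟧[X]) : L⟦X⟧[X] :=
  A.sum fun i a => Polynomial.monomial i (PowerSeries.mk fun n => PowerSeries.coeff (n + M) a)

open Classical in
/-- The Weierstrass polynomial `G` of `A`, in `A = G U` with `U` a unit of `L[[x, y]]`. -/
noncomputable def weierstrassPoly (A : L⟦X⟧[X]) : L⟦X⟧[X] :=
  if h : ∃ G : L⟦X⟧[X], ∃ U : L⟦X⟧⟦X⟧,
      (A : L⟦X⟧⟦X⟧).IsWeierstrassFactorization G U then h.choose else 0

end Transforms

section Run

/-- What the Newton-Puiseux algorithm with Abhyankar shifts has computed when it reaches `H_k`. -/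
structure Stage (K : Type u) [Field K] where
  /-- the residue field `K_k` -/
  L : Type u
  [field : Field L]
  /-- the inclusion of `K` into `K_k` -/
  emb : K →+* L
  /-- `N_k` -/
  N : ℕ
  /-- `H_k` -/
  H : L⟦X⟧[X]
  /-- the pull-back `π_k* : K[[x]][y] → K_k[[x]][y]` -/
  pull : K⟦X⟧[X] →+* L⟦X⟧[X]
  /-- `q_k` (by convention `1` if `k = 0`) -/
  q : ℕ
  /-- `ℓ_k = deg P_k` (by convention `1` if `k = 0`) -/
  l : ℕ

attribute [instance] Stage.field

variable {K : Type u} [Field K]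

/-- The initial stage: `K_0 = K`, `H_0 = τ_0* F`, `π_0 = τ_0`. -/
noncomputable def Stage.init (F : K⟦X⟧[X]) : Stage K where
  L := K
  emb := RingHom.id K
  N := F.natDegree
  H := tauPull F F
  pull := tauPull F
  q := 1
  l := 1

/-- One iteration: from `H_{k-1}` with edge data `D = (q, m, P, N)` to `H_k`. Here
`K_k = K_{k-1}[Z]/(P)`, `z` is the class of `Z`, `G` is the Weierstrass polynomial of
`σ* H_{k-1} / x^{q m ℓ N}`, and `H_k = τ* G`, `π_k = π_{k-1} ∘ σ ∘ τ`. -/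
noncomputable def Stage.next (S : Stage K) (D : EdgeData S.H) : Stage K :=
  haveI : Fact (Irreducible D.P) := ⟨D.irreducible⟩
  let z : AdjoinRoot D.P := AdjoinRoot.root D.P
  let base : S.L⟦X⟧[X] →+* (AdjoinRoot D.P)⟦X⟧[X] :=
    Polynomial.mapRingHom (PowerSeries.map (AdjoinRoot.of D.P))
  let sigma := sigmaPull z D.q D.m D.s D.t D.q_pos
  let G := weierstrassPoly (divXPow (D.q * D.m * D.P.natDegree * D.N) (sigma (base S.H)))
  { L := AdjoinRoot D.P
    emb := (AdjoinRoot.of D.P).comp S.emb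
    N := D.N
    H := tauPull G G
    pull := (tauPull G).comp (sigma.comp (base.comp S.pull))
    q := D.q
    l := D.P.natDegree }

/-- The algorithm goes on after this stage: `N_k > 1` and `H_k` is degenerated over `K_k`. -/
def Stage.Continues (S : Stage K) : Prop :=
  1 < S.N ∧ Nonempty (EdgeData S.H)

open Classical in
/-- The successive stages of the algorithm run on `F` (constant once it has stopped). -/
noncomputable def stage (F : K⟦X⟧[X]) : ℕ → Stage K
  | 0 => Stage.init F
  | k + 1 => if h : (stage F k).Continues then (stage F k).next h.2.some else stage F k

/-- The integer `g`: the first `k` such that `N_k = 1` or `H_k` is not degenerated. -/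
noncomputable def length (F : K⟦X⟧[X]) : ℕ :=
  sInf {k | ¬ (stage F k).Continues}

/-- `q_k ℓ_k`. -/
noncomputable def ql (F : K⟦X⟧[X]) (k : ℕ) : ℕ := (stage F k).q * (stage F k).l

/-- `d_k = e_k f_k`, with `e_k = q_1 ⋯ q_k` and `f_k = ℓ_1 ⋯ ℓ_k`. -/
noncomputable def dk (F : K⟦X⟧[X]) (k : ℕ) : ℕ :=
  (∏ i ∈ Finset.Icc 1 k, (stage F i).q) * ∏ i ∈ Finset.Icc 1 k, (stage F i).l

open Classical in
/-- The `k`-th minimal polynomial `φ_k` of `F`: the monic irreducible polynomial of degree `d_k`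
that vanishes at `π_k(x, 0) = (μ_k x^{e_k}, S_k(x))`. -/
noncomputable def phi (F : K⟦X⟧[X]) (k : ℕ) : K⟦X⟧[X] :=
  if h : ∃ p : K⟦X⟧[X], p.Monic ∧ Irreducible p ∧ p.natDegree = dk F k ∧
      ((stage F k).pull p).eval 0 = 0 then h.choose else 0

open Classical in
/-- The `N`-th approximate root of a monic polynomial `F` of degree `d`: the monic polynomial `p` of
degree `d / N` such that `deg (F - p ^ N) < d - d / N`. -/
noncomputable def approxRoot (N : ℕ) (F : K⟦X⟧[X]) : K⟦X⟧[X] :=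
  if h : ∃ p : K⟦X⟧[X], p.Monic ∧ p.natDegree = F.natDegree / N ∧
      (F - p ^ N).degree < ((F.natDegree - F.natDegree / N : ℕ) : WithBot ℕ)
    then h.choose else 0

/-- `ψ_k`, the `N_k`-th approximate root of `F`. -/
noncomputable def psi (F : K⟦X⟧[X]) (k : ℕ) : K⟦X⟧[X] := approxRoot (stage F k).N F

end Run

section Valuation

variable {L : Type u} [Field L]

/-- The `x`-valuation on `L[[x]][y]`. -/
noncomputable def xVal (A : L⟦X⟧[X]) : ℕ∞ := ⨅ i, (A.coeff i).order

/-- The polynomial `(A / x^v)|_{x = 0}` in `L[y]`, where `v` is the `x`-valuation of `A`. -/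
noncomputable def initialPart (A : L⟦X⟧[X]) : L[X] :=
  A.sum fun i a => Polynomial.monomial i (PowerSeries.coeff (xVal A).toNat a)

variable {K : Type u} [Field K]

/-- `v_k(G) = val (π_k* G)`. -/
noncomputable def vk (F : K⟦X⟧[X]) (k : ℕ) (G : K⟦X⟧[X]) : ℕ∞ := xVal ((stage F k).pull G)

/-- `λ_k(G)`, the trailing coefficient in `y` of `(π_k* G / x^{v_k(G)})|_{x = 0}`. -/
noncomputable def lam (F : K⟦X⟧[X]) (k : ℕ) (G : K⟦X⟧[X]) : (stage F k).L :=
  (initialPart ((stage F k).pull G)).trailingCoeff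

end Valuation

section Expansion

variable {K : Type u} [Field K]

/-- The constraints `b_{i-1} < q_i ℓ_i` (`1 ≤ i ≤ k`) on the exponents `(b_0, …, b_k)`. An element
`B = (b_{-1}, b_0, …, b_k)` of the exponent set is encoded as a pair `(n, b)` with `n = b_{-1}` an
arbitrary natural number and `b = (b_0, …, b_k)` admissible. -/
def Admissible (F : K⟦X⟧[X]) (k : ℕ) (b : Fin (k + 1) → ℕ) : Prop :=
  ∀ i : Fin (k + 1), (i : ℕ) < k → b i < ql F (i + 1)

/-- `a` is the expansion of `F` with respect to `(x, θ_0, …, θ_k)`: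
`F = ∑_b a_b(x) θ_0^{b_0} ⋯ θ_k^{b_k}` over admissible `b`. Hence the coefficient `f_B` of
`x^n θ_0^{b_0} ⋯ θ_k^{b_k}` is the coefficient of `x^n` in `a_b`. -/
def IsExpansion (F : K⟦X⟧[X]) (k : ℕ) (θ : ℕ → K⟦X⟧[X]) (a : (Fin (k + 1) → ℕ) →₀ K⟦X⟧) : Prop :=
  (∀ b ∈ a.support, Admissible F k b) ∧
    F = a.sum fun b c => Polynomial.C c * ∏ i : Fin (k + 1), θ i ^ b i

open Classical in
/-- The expansion of `F` with respect to `(x, θ_0, …, θ_k)`. -/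
noncomputable def expansion (F : K⟦X⟧[X]) (k : ℕ) (θ : ℕ → K⟦X⟧[X]) :
    (Fin (k + 1) → ℕ) →₀ K⟦X⟧ :=
  if h : ∃ a, IsExpansion F k θ a then h.choose else 0

/-- The coefficient `f_B`, `B = (n, b)`, of the expansion of `F` along `(x, θ_0, …, θ_k)`. -/
noncomputable def coeffB (F : K⟦X⟧[X]) (k : ℕ) (θ : ℕ → K⟦X⟧[X])
    (B : ℕ × (Fin (k + 1) → ℕ)) : K :=
  PowerSeries.coeff B.1 (expansion F k θ B.2)

/-- `⟨B, V⟩` with `V = (v_k(x), v_k(φ_0), …, v_k(φ_k))`. -/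
noncomputable def pairV (F : K⟦X⟧[X]) (k : ℕ) (B : ℕ × (Fin (k + 1) → ℕ)) : ℕ∞ :=
  (B.1 : ℕ∞) * vk F k (Polynomial.C PowerSeries.X) +
    ∑ i : Fin (k + 1), (B.2 i : ℕ∞) * vk F k (phi F i)

/-- `Λ^{B - B₀}` with `Λ = (λ_k(x), λ_k(φ_0), …, λ_k(φ_k))` and `B₀ = (0, …, 0, N_k)`. -/
noncomputable def lamPow (F : K⟦X⟧[X]) (k : ℕ) (B : ℕ × (Fin (k + 1) → ℕ)) : (stage F k).L :=
  lam F k (Polynomial.C PowerSeries.X) ^ B.1 * (∏ i : Fin (k + 1), lam F k (phi F i) ^ B.2 i) /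
    lam F k (phi F k) ^ (stage F k).N

/-- `w_i + v_k(F) = min {⟨B, V⟩ : b_k = i, f_B ≠ 0}` (`∞` if there is no such `B`), for the
expansion of `F` along `(x, θ_0, …, θ_k)`. -/
noncomputable def minPair (F : K⟦X⟧[X]) (k : ℕ) (θ : ℕ → K⟦X⟧[X]) (i : ℕ) : ℕ∞ :=
  sInf {w | ∃ B : ℕ × (Fin (k + 1) → ℕ), Admissible F k B.2 ∧ B.2 (Fin.last k) = i ∧
    coeffB F k θ B ≠ 0 ∧ w = pairV F k B}

/-- The point `(i, w_i)`, for `w_i` finite. -/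
noncomputable def wPoint (F : K⟦X⟧[X]) (k : ℕ) (θ : ℕ → K⟦X⟧[X]) (i : ℕ) : ℝ × ℝ :=
  ((i : ℝ), ((minPair F k θ i).toNat : ℝ) - ((vk F k F).toNat : ℝ))

/-- The lower convex hull of the points `(i, w_i)`, `0 ≤ i ≤ N_k`, `w_i ≠ ∞`. -/
noncomputable def expansionPolygon (F : K⟦X⟧[X]) (k : ℕ) (θ : ℕ → K⟦X⟧[X]) : Set (ℝ × ℝ) :=
  lowerHull {p | ∃ i : ℕ, i ≤ (stage F k).N ∧ minPair F k θ i ≠ ⊤ ∧ p = wPoint F k θ i}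

open Classical in
/-- The polynomial
`∑_{(i, w_i) ∈ 𝒩} (∑_{B ∈ 𝓑(i, w_i + v_k(F))} f_B Λ^{B - B₀}) x^{w_i} y^i`,
where `f_B` and `w_i` come from the expansion of `F` along `(x, θ_0, …, θ_k)`, `𝒩` is the lower
convex hull of the `(i, w_i)`, and `𝓑(i, w)` is the set of `B` with `b_k = i`, `⟨B, V⟩ = w`. -/
noncomputable def expansionBoundary (F : K⟦X⟧[X]) (k : ℕ) (θ : ℕ → K⟦X⟧[X]) :
    (stage F k).L⟦X⟧[X] :=
  ∑ i ∈ Finset.range ((stage F k).N + 1),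
    if minPair F k θ i ≠ ⊤ ∧ wPoint F k θ i ∈ expansionPolygon F k θ then
      Polynomial.monomial i
        (PowerSeries.C
          (∑ᶠ B ∈ {B : ℕ × (Fin (k + 1) → ℕ) | Admissible F k B.2 ∧ B.2 (Fin.last k) = i ∧
              pairV F k B = minPair F k θ i},
            (stage F k).emb (coeffB F k θ B) * lamPow F k B) *
          PowerSeries.X ^ ((minPair F k θ i).toNat - (vk F k F).toNat))
    else 0

end Expansion

end ApproxRoots

/-! Everything is read off leading terms. At stage `k` the pull-back of `F` is `x^v H_k U` with
`U(0,0) ≠ 0`, and for `i < k` the pull-backs of `φ_i` and of `ψ_i` are `x^{V_i}` times units with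
the same constant term `Λ_i`. Moreover `φ_k` pulls back to `y x^{V_k}` times a unit with constant
term `Λ_k`. Monomials of equal weight in `x, φ_0, …, φ_{k-1}`, with bounded exponents, have initial
coefficients that are linearly independent over `K` (`indepMonomials_succ`). So nothing cancels in
the lowest weight of an expansion, and every nonzero polynomial of degree less than `d_k` pulls back
to a power of `x` times a unit (`IsFrame.exists_isMono`).

Give `x` and `y` weights for which `H_k` lies on or above a line through `(N_k, 0)`. The approximate
root `ψ_k` arises from `φ_k` by Tschirnhausen transformations. Since the Abhyankar shift has killed
the coefficient of `y^{N_k - 1}` in `H_k`, each correction has weight larger than that of `x^{V_k}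
y`, so `ψ_k` keeps the leading term of `φ_k` (`exists_approxRoot_yLike`). Now write `F = ∑ g_i
ψ_k^i`. The leading term of the `i`-th summand is a monomial in `x` and `y` whose `y`-exponent is
`i`, so distinct summands cannot cancel. Comparison with the leading form of `x^v H_k U` gives the
coefficients of `H_k` on the line (`leading_terms_eq`, `Invariant.line_spec`). For `k < g` the whole
polygon lies on one such line. For `k = g` one takes the line that carries the lower edge.

The description of stage `k` is propagated by `Invariant.next`. The transform `σ` is a weighted
substitution followed by `y ↦ y + z^s`, so leading terms at the next stage are values of
quasi-homogeneous forms at `(z^t, z^s)`. A polynomial of degree `d_{k+1}` vanishing at the new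
centre exists by Cayley-Hamilton, and it is irreducible because polynomials of smaller degree do not
vanish there (`exists_irreducible`). Its leading form has `y`-degree at most `qℓ`, hence only a
simple zero at `(z^t, z^s)`, because `P` is separable (`sum_mul_ne_zero_of_root`). This gives the
shape `y x^V · unit` again.

At stage 0 the polygon may have slope 0, and then evaluation at the origin is not enough. The index
`b` in `IsMono` distinguishes units that are constant on the whole line `x = 0` (`b = 0`, stage 0)
from those with a prescribed value at the origin (`b = 1`, later stages). -/

namespace ApproxRoots

/-! ### Leading terms with possibly vanishing leading coefficient. -/

section Lead

variable {R S R' S' : Type*} [CommRing R] [CommRing S] [CommRing R'] [CommRing S']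

/-- `f = t ^ n * f'` where `f'` reduces to `g`; the leading coefficient `g` may vanish. -/
def Lead (t : R) (ρ : R →+* S) (f : R) (n : ℕ) (g : S) : Prop :=
  ∃ f', f = t ^ n * f' ∧ ρ f' = g

variable {t : R} {ρ : R →+* S} {f f₁ f₂ : R} {n m n₁ n₂ : ℕ} {g g₁ g₂ : S}

lemma Lead.zero (n : ℕ) : Lead t ρ 0 n 0 := ⟨0, by simp, by simp⟩

lemma Lead.of_map (f : R) : Lead t ρ f 0 (ρ f) := ⟨f, by simp, rfl⟩

lemma Lead.one : Lead t ρ 1 0 1 := ⟨1, by simp, by simp⟩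

lemma Lead.mul (h₁ : Lead t ρ f₁ n₁ g₁) (h₂ : Lead t ρ f₂ n₂ g₂) :
    Lead t ρ (f₁ * f₂) (n₁ + n₂) (g₁ * g₂) := by
  obtain ⟨a, rfl, rfl⟩ := h₁
  obtain ⟨b, rfl, rfl⟩ := h₂
  exact ⟨a * b, by ring, by simp⟩

lemma Lead.pow (h : Lead t ρ f n g) (k : ℕ) : Lead t ρ (f ^ k) (k * n) (g ^ k) := by
  obtain ⟨a, rfl, rfl⟩ := h
  exact ⟨a ^ k, by rw [mul_pow, ← pow_mul, mul_comm n], by simp⟩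

lemma Lead.prod {ι : Type*} (s : Finset ι) {F : ι → R} {N : ι → ℕ} {G : ι → S}
    (h : ∀ i ∈ s, Lead t ρ (F i) (N i) (G i)) :
    Lead t ρ (∏ i ∈ s, F i) (∑ i ∈ s, N i) (∏ i ∈ s, G i) := by
  classical
  induction s using Finset.induction_on with
  | empty => simpa using Lead.one
  | insert a s ha ih =>
    rw [Finset.prod_insert ha, Finset.sum_insert ha, Finset.prod_insert ha]
    exact (h a (by simp)).mul (ih fun i hi => h i (by simp [hi]))

lemma Lead.add (h₁ : Lead t ρ f₁ n g₁) (h₂ : Lead t ρ f₂ n g₂) :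
    Lead t ρ (f₁ + f₂) n (g₁ + g₂) := by
  obtain ⟨a, rfl, rfl⟩ := h₁
  obtain ⟨b, rfl, rfl⟩ := h₂
  exact ⟨a + b, by ring, by simp⟩

/-- The exponent may be lowered at the price of a zero leading coefficient. This is what allows
terms of different orders to be added at a common exponent. -/
lemma Lead.mono (ht : ρ t = 0) (h : Lead t ρ f n g) (hm : m < n) : Lead t ρ f m 0 := by
  obtain ⟨a, rfl, rfl⟩ := h
  refine ⟨t ^ (n - m) * a, by rw [← mul_assoc, ← pow_add]; congr 2; omega, ?_⟩
  rw [map_mul, map_pow, ht, zero_pow (by omega), zero_mul]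

lemma Lead.mono_ite (ht : ρ t = 0) (h : Lead t ρ f n g) (hm : m ≤ n) :
    Lead t ρ f m (if n = m then g else 0) := by
  split_ifs with e
  · exact e ▸ h
  · exact h.mono ht (by omega)

lemma Lead.sum {ι : Type*} (s : Finset ι) {F : ι → R} {G : ι → S}
    (h : ∀ i ∈ s, Lead t ρ (F i) n (G i)) :
    Lead t ρ (∑ i ∈ s, F i) n (∑ i ∈ s, G i) := by
  classical
  induction s using Finset.induction_on with
  | empty => simpa using Lead.zero n
  | insert a s ha ih =>
    rw [Finset.sum_insert ha, Finset.sum_insert ha]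
    exact (h a (by simp)).add (ih fun i hi => h i (by simp [hi]))

lemma Lead.sum_ite {ι : Type*} (ht : ρ t = 0) (s : Finset ι) {F : ι → R} {N : ι → ℕ} {G : ι → S}
    (h : ∀ i ∈ s, Lead t ρ (F i) (N i) (G i)) (hn : ∀ i ∈ s, n ≤ N i) :
    Lead t ρ (∑ i ∈ s, F i) n (∑ i ∈ s, if N i = n then G i else 0) :=
  Lead.sum s fun i hi => (h i hi).mono_ite ht (hn i hi)

/-- Each factor `t` contributes the reduction of `e` once. Through this the constants `z^t` enter
the leading coefficients. -/
lemma Lead.map {t' : R'} {ρ' : R' →+* S'} (Φ : R →+* R') (θ : S →+* S') (a : ℕ) (e : R')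
    (ht : Φ t = t' ^ a * e) (hρ : ∀ x, ρ' (Φ x) = θ (ρ x)) (h : Lead t ρ f n g) :
    Lead t' ρ' (Φ f) (a * n) (ρ' e ^ n * θ g) := by
  obtain ⟨b, rfl, rfl⟩ := h
  exact ⟨e ^ n * Φ b, by rw [map_mul, map_pow, ht, mul_pow, ← pow_mul, mul_assoc],
    by rw [map_mul, map_pow, hρ]⟩

lemma Lead.change {ρ' : R →+* S'} (θ : S →+* S') (hρ : ∀ x, ρ' x = θ (ρ x))
    (h : Lead t ρ f n g) : Lead t ρ' f n (θ g) := by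
  obtain ⟨b, rfl, rfl⟩ := h
  exact ⟨b, rfl, hρ b⟩

/-- If the exponents differed, lowering the larger one to the smaller would make a nonzero leading
coefficient equal to 0. -/
lemma Lead.unique [IsDomain R] (ht : ρ t = 0) (ht0 : t ≠ 0) (h₁ : Lead t ρ f n₁ g₁)
    (h₂ : Lead t ρ f n₂ g₂) (hg₁ : g₁ ≠ 0) (hg₂ : g₂ ≠ 0) : n₁ = n₂ ∧ g₁ = g₂ := by
  have key : ∀ {n : ℕ} {g₁ g₂ : S}, Lead t ρ f n g₁ → Lead t ρ f n g₂ → g₁ = g₂ := by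
    rintro n _ _ ⟨a, ha, rfl⟩ ⟨b, hb, rfl⟩
    rw [mul_left_cancel₀ (pow_ne_zero n ht0) (ha.symm.trans hb)]
  rcases lt_trichotomy n₁ n₂ with h | h | h
  · exact absurd (key h₁ (h₂.mono ht h)) hg₁
  · subst h
    exact ⟨rfl, key h₁ h₂⟩
  · exact absurd (key h₂ (h₁.mono ht h)) hg₂

end Lead

/-! ### The substitution of `x^α` for `x` in power series. -/

section Expand

variable {R : Type*} [CommRing R]

/-- The substitution `x ↦ x^α` as a ring homomorphism. -/
noncomputable def expandHom (α : ℕ) (hα : 0 < α) : R⟦X⟧ →+* R⟦X⟧ :=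
  (PowerSeries.expand α hα.ne' : R⟦X⟧ →ₐ[R] R⟦X⟧).toRingHom

lemma coeff_expandHom {α : ℕ} (hα : 0 < α) (f : R⟦X⟧) (n : ℕ) :
    PowerSeries.coeff n (expandHom α hα f) =
      if α ∣ n then PowerSeries.coeff (n / α) f else 0 :=
  PowerSeries.coeff_expand α hα.ne' f

@[simp]
lemma expandHom_X {α : ℕ} (hα : 0 < α) :
    expandHom α hα (PowerSeries.X : R⟦X⟧) = PowerSeries.X ^ α :=
  PowerSeries.expand_X α hα.ne'

@[simp]
lemma expandHom_C {α : ℕ} (hα : 0 < α) (r : R) :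
    expandHom α hα (PowerSeries.C r) = PowerSeries.C r :=
  PowerSeries.expand_C α hα.ne' r

@[simp]
lemma constantCoeff_expandHom {α : ℕ} (hα : 0 < α) (f : R⟦X⟧) :
    PowerSeries.constantCoeff (expandHom α hα f) = PowerSeries.constantCoeff f :=
  PowerSeries.constantCoeff_expand α hα.ne' f

lemma constantCoeff_map {S : Type*} [CommRing S] (f : R →+* S) (a : R⟦X⟧) :
    PowerSeries.constantCoeff (PowerSeries.map f a) = f (PowerSeries.constantCoeff a) := by
  rw [← PowerSeries.coeff_zero_eq_constantCoeff_apply, PowerSeries.coeff_map,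
    PowerSeries.coeff_zero_eq_constantCoeff_apply]

lemma constantCoeff_rescale (u : R) (a : R⟦X⟧) :
    PowerSeries.constantCoeff (PowerSeries.rescale u a) = PowerSeries.constantCoeff a := by
  rw [← PowerSeries.coeff_zero_eq_constantCoeff_apply, PowerSeries.coeff_rescale,
    PowerSeries.coeff_zero_eq_constantCoeff_apply]
  simp

end Expand

/-! ### Weighted substitutions and weighted leading forms. -/

section Weights

variable {L L' : Type u} [Field L] [Field L']

/-- `A(0, y)`. -/
noncomputable def red : L⟦X⟧[X] →+* L[X] := Polynomial.mapRingHom PowerSeries.constantCoeff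

/-- `A(0, 0 ^ b y)`. -/
noncomputable def redAt (b : ℕ) : L⟦X⟧[X] →+* L[X] :=
  Polynomial.eval₂RingHom (Polynomial.C.comp PowerSeries.constantCoeff)
    (Polynomial.C (0 ^ b) * Polynomial.X)

/-- The substitution `x ↦ u x^α`, `y ↦ y x^β`. -/
noncomputable def wt (u : L) (α β : ℕ) (hα : 0 < α) : L⟦X⟧[X] →+* L[X]⟦X⟧ :=
  Polynomial.eval₂RingHom
    ((expandHom α hα).comp
      ((PowerSeries.map Polynomial.C).comp (PowerSeries.rescale u)))
    (PowerSeries.C Polynomial.X * PowerSeries.X ^ β)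

/-- Extension of scalars on `L[[x]][y]`. -/
noncomputable def baseChange (f : L →+* L') : L⟦X⟧[X] →+* L'⟦X⟧[X] :=
  Polynomial.mapRingHom (PowerSeries.map f)

lemma redAt_CX (b : ℕ) : redAt b (Polynomial.C (PowerSeries.X : L⟦X⟧)) = 0 := by simp [redAt]

lemma redAt_C (b : ℕ) (a : L⟦X⟧) :
    redAt b (Polynomial.C a) = Polynomial.C (PowerSeries.constantCoeff a) := by simp [redAt]

lemma redAt_X (b : ℕ) :
    redAt b (Polynomial.X : L⟦X⟧[X]) = Polynomial.C (0 ^ b) * Polynomial.X := by simp [redAt]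

lemma redAt_zero (A : L⟦X⟧[X]) : redAt 0 A = red A := by
  have : redAt (L := L) 0 = red := by
    ext a <;> simp [redAt, red]
  rw [this]

/-- Since `0^β = 0^(β-b) 0^b`, going from `b` to a larger `β` only scales `y` further and leaves
constants alone. Hence information for `b` serves every weight `β ≥ b` of `y`. -/
lemma redAt_of_le {b β : ℕ} (h : b ≤ β) (A : L⟦X⟧[X]) :
    redAt β A = Polynomial.compRingHom (Polynomial.C (0 ^ (β - b)) * Polynomial.X) (redAt b A) := by
  have : redAt (L := L) β =
      (Polynomial.compRingHom (Polynomial.C (0 ^ (β - b)) * Polynomial.X)).comp (redAt b) := by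
    refine Polynomial.ringHom_ext' ?_ ?_
    · ext a : 1
      simp [redAt]
    · simp only [redAt_X, RingHom.comp_apply, map_mul, Polynomial.coe_compRingHom_apply,
        Polynomial.X_comp, Polynomial.C_comp, ← mul_assoc]
      rw [← Polynomial.C_mul, ← pow_add]
      congr 3
      omega
  rw [this]; rfl

lemma coeff_zero_redAt (b : ℕ) (A : L⟦X⟧[X]) : (redAt b A).coeff 0 = (red A).coeff 0 := by
  rw [← redAt_zero, redAt_of_le (Nat.zero_le b)]
  simp [Polynomial.coeff_zero_eq_eval_zero]

/-- At `x = 0` the factor `x^β` attached to `y` becomes `0^β`, which is 1 exactly when `β = 0`. -/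
lemma constantCoeff_wt (u : L) {α β : ℕ} (hα : 0 < α) (A : L⟦X⟧[X]) :
    PowerSeries.constantCoeff (wt u α β hα A) = redAt β A := by
  have : (PowerSeries.constantCoeff (R := L[X])).comp (wt u α β hα) = redAt β := by
    refine Polynomial.ringHom_ext' ?_ ?_
    · ext a : 1
      simp [redAt, wt, constantCoeff_map, constantCoeff_rescale]
    · simp [redAt, wt, mul_comm]
  rw [← this]; rfl

lemma wt_CX (u : L) {α β : ℕ} (hα : 0 < α) :
    wt u α β hα (Polynomial.C PowerSeries.X) =
      PowerSeries.X ^ α * PowerSeries.C (Polynomial.C u) := by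
  simp [wt, mul_comm]

lemma wt_X (u : L) {α β : ℕ} (hα : 0 < α) :
    wt u α β hα Polynomial.X = PowerSeries.C Polynomial.X * PowerSeries.X ^ β := by
  simp [wt]

lemma coeff_wt_monomial (u : L) {α β : ℕ} (hα : 0 < α) (k n i : ℕ) (a : L⟦X⟧) :
    (PowerSeries.coeff n (wt u α β hα (Polynomial.monomial k a))).coeff i =
      if i = k ∧ β * k ≤ n ∧ α ∣ n - β * k then
        u ^ ((n - β * k) / α) * PowerSeries.coeff ((n - β * k) / α) a else 0 := by
  have : wt u α β hα (Polynomial.monomial k a) =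
      (expandHom α hα (PowerSeries.map Polynomial.C (PowerSeries.rescale u a)) *
        PowerSeries.C (Polynomial.X ^ k)) * PowerSeries.X ^ (β * k) := by
    simp [wt, mul_pow, ← pow_mul, mul_assoc]
  rw [this, PowerSeries.coeff_mul_X_pow']
  by_cases h1 : β * k ≤ n
  · rw [if_pos h1, PowerSeries.coeff_mul_C, coeff_expandHom]
    by_cases h2 : α ∣ n - β * k
    · rw [if_pos h2, PowerSeries.coeff_map, PowerSeries.coeff_rescale, Polynomial.coeff_C_mul,
        Polynomial.coeff_X_pow]
      simp [h1, h2]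
    · simp [h2]
  · simp [h1]

/-- The coefficients of `A(u x^α, y x^β)`. -/
lemma coeff_wt (u : L) {α β : ℕ} (hα : 0 < α) (n i : ℕ) (A : L⟦X⟧[X]) :
    (PowerSeries.coeff n (wt u α β hα A)).coeff i =
      if β * i ≤ n ∧ α ∣ n - β * i then
        u ^ ((n - β * i) / α) * PowerSeries.coeff ((n - β * i) / α) (A.coeff i) else 0 := by
  induction A using Polynomial.induction_on' with
  | add p q hp hq =>
    rw [map_add, map_add, Polynomial.coeff_add, hp, hq]
    split_ifs <;> simp [mul_add]
  | monomial k a =>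
    rw [coeff_wt_monomial, Polynomial.coeff_monomial]
    by_cases h : k = i
    · subst h; simp
    · simp [h, Ne.symm h]

lemma coeff_wt_add (u : L) {α β : ℕ} (hα : 0 < α) (i j : ℕ) (A : L⟦X⟧[X]) :
    (PowerSeries.coeff (α * j + β * i) (wt u α β hα A)).coeff i =
      u ^ j * PowerSeries.coeff j (A.coeff i) := by
  rw [coeff_wt, if_pos ⟨Nat.le_add_left _ _, by simp⟩]
  simp [hα]

lemma exists_of_coeff_wt_ne_zero {u : L} {α β : ℕ} {hα : 0 < α} {n i : ℕ} {A : L⟦X⟧[X]}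
    (h : (PowerSeries.coeff n (wt u α β hα A)).coeff i ≠ 0) :
    ∃ j, α * j + β * i = n ∧ PowerSeries.coeff j (A.coeff i) ≠ 0 := by
  rw [coeff_wt] at h
  split_ifs at h with h'
  · obtain ⟨j, hj⟩ := h'.2
    rw [hj, Nat.mul_div_cancel_left _ hα] at h
    exact ⟨j, by omega, right_ne_zero_of_mul h⟩
  · exact absurd rfl h

/-- Leading coefficients of power series over `L[y]`. -/
abbrev LeadS (f : L[X]⟦X⟧) (n : ℕ) (g : L[X]) : Prop :=
  Lead PowerSeries.X (PowerSeries.constantCoeff (R := L[X])) f n g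

/-- Leading coefficients with respect to `x`. -/
abbrev LeadX (A : L⟦X⟧[X]) (n : ℕ) (g : L[X]) : Prop :=
  Lead (Polynomial.C PowerSeries.X) red A n g

lemma leadS_iff {f : L[X]⟦X⟧} {n : ℕ} {g : L[X]} :
    LeadS f n g ↔ (∀ m < n, PowerSeries.coeff m f = 0) ∧ PowerSeries.coeff n f = g := by
  rw [← PowerSeries.X_pow_dvd_iff]
  constructor
  · rintro ⟨a, rfl, rfl⟩
    exact ⟨⟨a, rfl⟩, by simpa using PowerSeries.coeff_X_pow_mul a n 0⟩
  · rintro ⟨⟨a, rfl⟩, rfl⟩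
    exact ⟨a, rfl, by simpa using (PowerSeries.coeff_X_pow_mul a n 0).symm⟩

lemma LeadS.unique {f : L[X]⟦X⟧} {n₁ n₂ : ℕ} {g₁ g₂ : L[X]} (h₁ : LeadS f n₁ g₁)
    (h₂ : LeadS f n₂ g₂) (hg₁ : g₁ ≠ 0) (hg₂ : g₂ ≠ 0) : n₁ = n₂ ∧ g₁ = g₂ :=
  Lead.unique (by simp) PowerSeries.X_ne_zero h₁ h₂ hg₁ hg₂

lemma leadS_wt_of_coeff {u : L} {α β : ℕ} (hα : 0 < α) {A : L⟦X⟧[X]} {M : ℕ}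
    (h : ∀ i j, α * j + β * i < M → PowerSeries.coeff j (A.coeff i) = 0) :
    LeadS (wt u α β hα A) M (PowerSeries.coeff M (wt u α β hα A)) := by
  refine leadS_iff.2 ⟨fun m hm => ?_, rfl⟩
  ext i
  by_contra hne
  obtain ⟨j, hj, hne⟩ := exists_of_coeff_wt_ne_zero hne
  exact hne (h i j (by omega))

/-- With weights 1 and 0 the substitution merely regards an element of `L[[x]][y]` as a power series
in `x` over `L[y]`. -/
lemma leadS_wt_iff_leadX {A : L⟦X⟧[X]} {n : ℕ} {g : L[X]} :
    LeadS (wt 1 1 0 one_pos A) n g ↔ LeadX A n g := by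
  constructor
  · rintro ⟨f, hf, rfl⟩
    have hdvd : Polynomial.C (PowerSeries.X ^ n) ∣ A := by
      rw [Polynomial.C_dvd_iff_dvd_coeff]
      intro i
      rw [PowerSeries.X_pow_dvd_iff]
      intro m hm
      have := coeff_wt_add (1 : L) (α := 1) (β := 0) one_pos i m A
      rw [hf] at this
      simp only [one_pow, one_mul, zero_mul, add_zero] at this
      rw [← this, (PowerSeries.X_pow_dvd_iff.1 (Dvd.intro f rfl)) m hm]
      simp
    obtain ⟨W, rfl⟩ := hdvd
    refine ⟨W, by simp, ?_⟩
    rw [map_mul, Polynomial.C_pow, map_pow, wt_CX] at hf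
    simp only [pow_one, map_one, mul_one] at hf
    rw [← mul_left_cancel₀ (pow_ne_zero n PowerSeries.X_ne_zero) hf, constantCoeff_wt, redAt_zero]
  · rintro ⟨W, rfl, rfl⟩
    refine ⟨wt 1 1 0 one_pos W, ?_, by rw [constantCoeff_wt, redAt_zero]⟩
    rw [map_mul, map_pow, wt_CX]
    simp

end Weights

/-! ### Monomials in `x` times units, and elements that look like `x^v y`. -/

section Mono

variable {L L' : Type u} [Field L] [Field L']

/-- `A = x^v W` with `W(0, 0^b y) = c`: for `b > 0`, `W(0, 0) = c`. -/
def IsMono (b : ℕ) (A : L⟦X⟧[X]) (v : ℕ) (c : L) : Prop :=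
  Lead (Polynomial.C PowerSeries.X) (redAt b) A v (Polynomial.C c)

variable {b α β v v₁ v₂ : ℕ} {A A₁ A₂ : L⟦X⟧[X]} {c c₁ c₂ u : L}

lemma IsMono.mul (h₁ : IsMono b A₁ v₁ c₁) (h₂ : IsMono b A₂ v₂ c₂) :
    IsMono b (A₁ * A₂) (v₁ + v₂) (c₁ * c₂) := by
  have := Lead.mul h₁ h₂
  rwa [← Polynomial.C_mul] at this

lemma IsMono.pow (h : IsMono b A v c) (k : ℕ) : IsMono b (A ^ k) (k * v) (c ^ k) := by
  have := Lead.pow h k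
  rwa [← Polynomial.C_pow] at this

lemma IsMono.prod {ι : Type*} (s : Finset ι) {F : ι → L⟦X⟧[X]} {V : ι → ℕ} {G : ι → L}
    (h : ∀ i ∈ s, IsMono b (F i) (V i) (G i)) :
    IsMono b (∏ i ∈ s, F i) (∑ i ∈ s, V i) (∏ i ∈ s, G i) := by
  have := Lead.prod s h
  rwa [← map_prod] at this

lemma IsMono.zero (v : ℕ) : IsMono b (0 : L⟦X⟧[X]) v 0 := by
  have := Lead.zero (t := Polynomial.C (PowerSeries.X : L⟦X⟧)) (ρ := redAt b) v
  simpa [IsMono] using this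

lemma IsMono.one : IsMono b (1 : L⟦X⟧[X]) 0 1 := by
  have := Lead.one (t := Polynomial.C (PowerSeries.X : L⟦X⟧)) (ρ := redAt b)
  simpa [IsMono] using this

lemma IsMono.mono_ite {w : ℕ} (h : IsMono b A v c) (hw : w ≤ v) :
    IsMono b A w (if v = w then c else 0) := by
  have := Lead.mono_ite (redAt_CX b) h hw
  rw [← Polynomial.C_0, ← apply_ite] at this
  exact this

lemma IsMono.add (h₁ : IsMono b A₁ v c₁) (h₂ : IsMono b A₂ v c₂) :
    IsMono b (A₁ + A₂) v (c₁ + c₂) := by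
  have := Lead.add h₁ h₂
  rwa [← Polynomial.C_add] at this

lemma IsMono.sum_ite {ι : Type*} (s : Finset ι) {F : ι → L⟦X⟧[X]} {V : ι → ℕ} {G : ι → L} {w : ℕ}
    (h : ∀ i ∈ s, IsMono b (F i) (V i) (G i)) (hw : ∀ i ∈ s, w ≤ V i) :
    IsMono b (∑ i ∈ s, F i) w (∑ i ∈ s, if V i = w then G i else 0) := by
  have := Lead.sum s fun i hi => (h i hi).mono_ite (hw i hi)
  rwa [← map_sum] at this

lemma IsMono.C_constant (a : L) :
    IsMono b (Polynomial.C (PowerSeries.C a)) 0 a := by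
  have := Lead.of_map (t := Polynomial.C (PowerSeries.X : L⟦X⟧)) (ρ := redAt b)
    (Polynomial.C (PowerSeries.C a))
  simpa [IsMono, redAt_C] using this

lemma IsMono.baseChange (f : L →+* L') (h : IsMono b A v c) :
    IsMono b (baseChange f A) v (f c) := by
  have hr : ∀ x, redAt b (ApproxRoots.baseChange f x) = Polynomial.mapRingHom f (redAt b x) := by
    intro x
    have : (redAt b).comp (ApproxRoots.baseChange f) =
        (Polynomial.mapRingHom f).comp (redAt b) := by
      refine Polynomial.ringHom_ext' ?_ ?_
      · ext a : 1
        simp [redAt, ApproxRoots.baseChange, constantCoeff_map]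
      · simp [redAt, ApproxRoots.baseChange]
    exact congr($this x)
  have := Lead.map (t' := Polynomial.C PowerSeries.X) (ρ' := redAt b)
    (ApproxRoots.baseChange f) (Polynomial.mapRingHom f) 1 1
    (by simp [ApproxRoots.baseChange]) hr h
  simpa [IsMono] using this

/-- For `b ≤ β` the cofactor of `x^v` reduces to its constant `c`, so the leading form does not
involve `y`. -/
lemma IsMono.wt (hα : 0 < α) (hb : b ≤ β) (u : L) (h : IsMono b A v c) :
    LeadS (wt u α β hα A) (α * v) (Polynomial.C (c * u ^ v)) := by
  have h' : Lead (Polynomial.C PowerSeries.X) (redAt β) A v (Polynomial.C c) := by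
    have := Lead.change _ (redAt_of_le hb) h
    simpa using this
  have := Lead.map (t' := PowerSeries.X) (ρ' := PowerSeries.constantCoeff)
    (ApproxRoots.wt u α β hα) (RingHom.id _) α _ (wt_CX u hα) (constantCoeff_wt u hα) h'
  simpa [mul_comm] using this

/-- `D = x^v y W + (terms of larger weight)` with `W(0, 0) = c`, for the weights `α` of `x` and
`β` of `y`. -/
def YLike (b α β : ℕ) (D : L⟦X⟧[X]) (v : ℕ) (c : L) : Prop :=
  ∃ A A' v' c', D = Polynomial.X * A + A' ∧ IsMono b A v c ∧ α * v + β < α * v' ∧ IsMono b A' v' c'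

lemma YLike.of_X_mul (hα : 0 < α) (h : IsMono b A v c) : YLike b α β (Polynomial.X * A) v c :=
  -- The remainder is 0, so any exponent of large enough weight will do.
  ⟨A, 0, v + β + 1, 0, by simp, h, by nlinarith, IsMono.zero _⟩

lemma YLike.add {D R : L⟦X⟧[X]} {r : ℕ} {c' : L} (h : YLike b α β D v c)
    (hr : α * v + β < α * r) (hR : IsMono b R r c') : YLike b α β (D + R) v c := by
  obtain ⟨A, A', v', d, rfl, hA, hv, hA'⟩ := h
  refine ⟨A, A' + R, min v' r, _, by ring, hA, ?_, (hA'.mono_ite (min_le_left _ _)).add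
    (hR.mono_ite (min_le_right _ _))⟩
  rcases min_choice v' r with h | h <;> rw [h] <;> assumption

lemma YLike.baseChange (f : L →+* L') {D : L⟦X⟧[X]} (h : YLike b α β D v c) :
    YLike b α β (baseChange f D) v (f c) := by
  obtain ⟨A, A', v', c', rfl, hA, hv, hA'⟩ := h
  exact ⟨_, _, v', f c', by simp [ApproxRoots.baseChange], hA.baseChange f, hv, hA'.baseChange f⟩

lemma YLike.wt (hα : 0 < α) (hb : b ≤ β) (u : L) {D : L⟦X⟧[X]} (h : YLike b α β D v c) :
    LeadS (wt u α β hα D) (α * v + β) (Polynomial.C (c * u ^ v) * Polynomial.X) := by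
  obtain ⟨A, A', v', c', rfl, hA, hv, hA'⟩ := h
  have h1 := hA.wt hα hb u
  have h2 := Lead.mono (by simp) (hA'.wt hα hb u) hv
  have h3 : LeadS (ApproxRoots.wt u α β hα Polynomial.X) β Polynomial.X :=
    ⟨PowerSeries.C Polynomial.X, by rw [wt_X, mul_comm], by simp⟩
  rw [map_add, map_mul, mul_comm (ApproxRoots.wt u α β hα Polynomial.X)]
  simpa using (h1.mul h3).add h2

lemma IsMono.leadX (h : IsMono b A v c) : ∃ g, LeadX A v g ∧ g.coeff 0 = c := by
  obtain ⟨W, rfl, hW⟩ := h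
  refine ⟨red W, ⟨W, rfl, rfl⟩, ?_⟩
  rw [← coeff_zero_redAt b, hW, Polynomial.coeff_C_zero]

/-- For `b = 1` only the value at the origin counts, so the leading polynomial in `y` need not be
constant. -/
lemma isMono_one_of_leadX {g : L[X]} (h : LeadX A v g) : IsMono 1 A v (g.coeff 0) := by
  obtain ⟨W, rfl, rfl⟩ := h
  refine ⟨W, rfl, ?_⟩
  rw [redAt_of_le (Nat.zero_le 1), redAt_zero]
  simp [Polynomial.coeff_zero_eq_eval_zero]

end Mono

/-! ### The `x`-valuation and the trailing coefficient computed from leading terms. -/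

section XVal

variable {L : Type u} [Field L] {A : L⟦X⟧[X]} {v : ℕ} {g : L[X]}

lemma coeff_coeff_X_pow_mul (W : L⟦X⟧[X]) (i n : ℕ) :
    PowerSeries.coeff n (((Polynomial.C PowerSeries.X) ^ v * W).coeff i) =
      if v ≤ n then PowerSeries.coeff (n - v) (W.coeff i) else 0 := by
  rw [← Polynomial.C_pow, Polynomial.coeff_C_mul, PowerSeries.coeff_X_pow_mul']

lemma xVal_eq (h : LeadX A v g) (hg : g ≠ 0) : xVal A = v := by
  obtain ⟨W, rfl, rfl⟩ := h
  refine le_antisymm ?_ ?_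
  · obtain ⟨i, hi⟩ : ∃ i, (red W).coeff i ≠ 0 := by
      by_contra! hn
      exact hg (Polynomial.ext hn)
    refine (iInf_le _ i).trans (PowerSeries.order_le _ ?_)
    rw [coeff_coeff_X_pow_mul]
    simpa [red] using hi
  · refine le_iInf fun i => PowerSeries.le_order _ _ fun n hn => ?_
    rw [coeff_coeff_X_pow_mul, if_neg]
    exact not_le.2 (by exact_mod_cast hn)

lemma initialPart_eq (h : LeadX A v g) (hg : g ≠ 0) : initialPart A = g := by
  have hv := xVal_eq h hg
  obtain ⟨W, rfl, rfl⟩ := h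
  rw [initialPart, hv]
  ext i
  rw [Polynomial.sum_over_range _ (by simp), Polynomial.finsetSum_coeff]
  simp only [Polynomial.coeff_monomial, ENat.toNat_natCast]
  rw [Finset.sum_ite_eq']
  have : PowerSeries.coeff v (((Polynomial.C PowerSeries.X) ^ v * W).coeff i) = (red W).coeff i := by
    rw [coeff_coeff_X_pow_mul]
    simp [red]
  split_ifs with hi
  · exact this
  · rw [← this, Polynomial.coeff_eq_zero_of_natDegree_lt (by simpa using hi)]
    simp

lemma trailingCoeff_of_coeff_zero_ne {p : L[X]} (h : p.coeff 0 ≠ 0) :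
    p.trailingCoeff = p.coeff 0 := by
  rw [Polynomial.trailingCoeff, Polynomial.natTrailingDegree_eq_zero_of_constantCoeff_ne_zero h]

lemma trailingCoeff_X_mul {p : L[X]} (h : p.coeff 0 ≠ 0) :
    (Polynomial.X * p).trailingCoeff = p.coeff 0 := by
  have h1 : (Polynomial.X * p).natTrailingDegree = 1 := by
    refine le_antisymm (Polynomial.natTrailingDegree_le_of_ne_zero (by simpa using h)) ?_
    refine Polynomial.le_natTrailingDegree (fun h0 => h ?_) fun m hm => ?_
    · simpa using congr(Polynomial.coeff $h0 1)
    · obtain rfl : m = 0 := by omega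
      simp
  rw [Polynomial.trailingCoeff, h1]
  simp

end XVal

/-! ### Lower hulls, supporting lines and lower edges in the plane. -/

section Geometry

variable {S T : Set (ℝ × ℝ)} {θ κ : ℝ} {p l r : ℝ × ℝ}

lemma le_of_mem_convexHull (h : ∀ p ∈ S, κ ≤ p.2 + θ * p.1) (hp : p ∈ convexHull ℝ S) :
    κ ≤ p.2 + θ * p.1 := by
  refine convexHull_min (t := {p : ℝ × ℝ | κ ≤ p.2 + θ * p.1}) h ?_ hp
  intro x hx y hy a b ha hb hab
  simp only [Set.mem_ofPred_eq, Prod.snd_add, Prod.smul_snd, Prod.fst_add, Prod.smul_fst,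
    smul_eq_mul] at *
  have h1 := mul_le_mul_of_nonneg_left hx ha
  have h2 := mul_le_mul_of_nonneg_left hy hb
  have h3 : κ = a * κ + b * κ := by rw [← add_mul, hab, one_mul]
  linarith

lemma eq_of_mem_convexHull (h : ∀ p ∈ S, p.2 + θ * p.1 = κ) (hp : p ∈ convexHull ℝ S) :
    p.2 + θ * p.1 = κ := by
  have h1 := le_of_mem_convexHull (κ := κ) (fun q hq => (h q hq).ge) hp
  refine le_antisymm ?_ h1
  refine convexHull_min (t := {p : ℝ × ℝ | p.2 + θ * p.1 ≤ κ}) (fun q hq => (h q hq).le) ?_ hp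
  intro x hx y hy a b ha hb hab
  simp only [Set.mem_ofPred_eq, Prod.snd_add, Prod.smul_snd, Prod.fst_add, Prod.smul_fst,
    smul_eq_mul] at *
  have h1 := mul_le_mul_of_nonneg_left hx ha
  have h2 := mul_le_mul_of_nonneg_left hy hb
  have h3 : κ = a * κ + b * κ := by rw [← add_mul, hab, one_mul]
  linarith

/-- A supporting line cuts out a face of the convex hull. -/
lemma mem_convexHull_line (h : ∀ p ∈ S, κ ≤ p.2 + θ * p.1) (hp : p ∈ convexHull ℝ S)
    (hl : p.2 + θ * p.1 = κ) : p ∈ convexHull ℝ {p ∈ S | p.2 + θ * p.1 = κ} := by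
  set T := {p ∈ S | p.2 + θ * p.1 = κ}
  have hT : ∀ q ∈ convexHull ℝ T, q.2 + θ * q.1 = κ := fun q hq =>
    eq_of_mem_convexHull (fun q hq => hq.2) hq
  have key : p ∈ {p : ℝ × ℝ | κ < p.2 + θ * p.1 ∨ p ∈ convexHull ℝ T} := by
    refine convexHull_min ?_ ?_ hp
    · intro q hq
      rcases (h q hq).lt_or_eq with h' | h'
      · exact Or.inl h'
      · exact Or.inr (subset_convexHull ℝ T ⟨hq, h'.symm⟩)
    · intro x hx y hy a b ha hb hab
      rcases ha.eq_or_lt with rfl | ha'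
      · obtain rfl : b = 1 := by linarith
        simpa using hy
      rcases hb.eq_or_lt with rfl | hb'
      · obtain rfl : a = 1 := by linarith
        simpa using hx
      have h3 : κ = a * κ + b * κ := by rw [← add_mul, hab, one_mul]
      have hf : (a • x + b • y).2 + θ * (a • x + b • y).1 =
          a * (x.2 + θ * x.1) + b * (y.2 + θ * y.1) := by
        simp only [Prod.snd_add, Prod.smul_snd, Prod.fst_add, Prod.smul_fst, smul_eq_mul]
        ring
      rcases hx with hx | hx
      · left
        have hy' : κ ≤ y.2 + θ * y.1 := by
          rcases hy with hy | hy
          · exact hy.le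
          · exact (hT y hy).ge
        rw [hf]
        have h1 := mul_lt_mul_of_pos_left hx ha'
        have h2 := mul_le_mul_of_nonneg_left hy' hb
        linarith
      rcases hy with hy | hy
      · left
        have hx' : κ ≤ x.2 + θ * x.1 := (hT x hx).ge
        rw [hf]
        have h1 := mul_le_mul_of_nonneg_left hx' ha
        have h2 := mul_lt_mul_of_pos_left hy hb'
        linarith
      · right
        exact convex_convexHull ℝ T hx hy ha hb hab
  rcases key with h' | h'
  · exact absurd hl h'.ne'
  · exact h'

lemma mem_lowerHull_of_line (h : ∀ p ∈ S, κ ≤ p.2 + θ * p.1) (hp : p ∈ convexHull ℝ S)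
    (hl : p.2 + θ * p.1 = κ) : p ∈ lowerHull S := by
  refine ⟨hp, fun q hq hqp => ?_⟩
  have := le_of_mem_convexHull h hq
  rw [hqp] at this
  linarith

lemma convexHull_line_subset_lowerHull (h : ∀ p ∈ S, κ ≤ p.2 + θ * p.1) :
    convexHull ℝ {p ∈ S | p.2 + θ * p.1 = κ} ⊆ lowerHull S := fun _ hp =>
  mem_lowerHull_of_line h (convexHull_mono (Set.sep_subset _ _) hp)
    (eq_of_mem_convexHull (fun _ hq => hq.2) hp)

/-- The vertical projection onto a segment of a supporting line. -/
lemma exists_mem_segment_fst (hlr : l.1 < r.1) (h1 : l.1 ≤ p.1) (h2 : p.1 ≤ r.1) :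
    ∃ p' ∈ segment ℝ l r, p'.1 = p.1 := by
  have h0 : 0 < r.1 - l.1 := by linarith
  refine ⟨((r.1 - p.1) / (r.1 - l.1)) • l + ((p.1 - l.1) / (r.1 - l.1)) • r,
    ⟨_, _, div_nonneg (by linarith) h0.le, div_nonneg (by linarith) h0.le, ?_, rfl⟩, ?_⟩
  · rw [← add_div, div_eq_one_iff_eq h0.ne']; ring
  · simp only [Prod.fst_add, Prod.smul_fst, smul_eq_mul]
    field_simp
    ring

lemma fst_le_of_mem_convexHull {x : ℝ} (h : ∀ p ∈ S, p.1 ≤ x) (hp : p ∈ convexHull ℝ S) :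
    p.1 ≤ x := by
  refine convexHull_min (t := {p : ℝ × ℝ | p.1 ≤ x}) h ?_ hp
  exact convex_halfSpace_le (f := Prod.fst) (LinearMap.fst ℝ ℝ ℝ).isLinear x

lemma le_fst_of_mem_convexHull {x : ℝ} (h : ∀ p ∈ S, x ≤ p.1) (hp : p ∈ convexHull ℝ S) :
    x ≤ p.1 := by
  refine convexHull_min (t := {p : ℝ × ℝ | x ≤ p.1}) h ?_ hp
  exact convex_halfSpace_ge (f := Prod.fst) (LinearMap.fst ℝ ℝ ℝ).isLinear x

/-- An open left half-plane together with one point of its boundary line is convex. -/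
lemma fst_lt_or_eq_of_mem_convexHull (h : ∀ p ∈ S, p.1 < r.1 ∨ p = r)
    (hp : p ∈ convexHull ℝ S) : p.1 < r.1 ∨ p = r := by
  refine convexHull_min (t := {p : ℝ × ℝ | p.1 < r.1 ∨ p = r}) h ?_ hp
  intro x hx y hy a b ha hb hab
  rcases ha.eq_or_lt with rfl | ha'
  · obtain rfl : b = 1 := by linarith
    simpa using hy
  rcases hb.eq_or_lt with rfl | hb'
  · obtain rfl : a = 1 := by linarith
    simpa using hx
  have hle : ∀ {z : ℝ × ℝ}, (z.1 < r.1 ∨ z = r) → z.1 ≤ r.1 := by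
    rintro z (h | rfl)
    exacts [h.le, le_rfl]
  have h3 : r.1 = a * r.1 + b * r.1 := by rw [← add_mul, hab, one_mul]
  have hf : (a • x + b • y).1 = a * x.1 + b * y.1 := by simp
  rcases hx with hx' | rfl
  · left
    have h1 := mul_lt_mul_of_pos_left hx' ha'
    have h2 := mul_le_mul_of_nonneg_left (hle hy) hb
    rw [hf]; linarith
  rcases hy with hy' | rfl
  · left
    have h1 := mul_lt_mul_of_pos_left hy' hb'
    rw [hf]; linarith
  · right
    rw [← add_smul, hab, one_smul]

lemma mem_lowerHull_of_rightmost (h : ∀ p ∈ S, p.1 < r.1 ∨ p = r) (hr : r ∈ S) :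
    r ∈ lowerHull S := by
  refine ⟨subset_convexHull ℝ S hr, fun q hq hqr => ?_⟩
  rcases fst_lt_or_eq_of_mem_convexHull h hq with h' | rfl
  · exact absurd hqr h'.ne
  · exact le_rfl

/-- If a supporting line meets `S` in points of smallest and of largest abscissa, then the lower
hull is the corresponding face. -/
lemma lowerHull_eq_convexHull_line (h : ∀ p ∈ S, κ ≤ p.2 + θ * p.1) (hl : l ∈ S)
    (hl' : l.2 + θ * l.1 = κ) (hl1 : ∀ p ∈ S, l.1 ≤ p.1) (hr : r ∈ S)
    (hr' : r.2 + θ * r.1 = κ) (hr1 : ∀ p ∈ S, p.1 ≤ r.1) :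
    lowerHull S = convexHull ℝ {p ∈ S | p.2 + θ * p.1 = κ} := by
  refine Set.Subset.antisymm (fun p hp => ?_) (convexHull_line_subset_lowerHull h)
  refine mem_convexHull_line h hp.1 (le_antisymm ?_ (le_of_mem_convexHull h hp.1))
  have h1 := le_fst_of_mem_convexHull hl1 hp.1
  have h2 := fst_le_of_mem_convexHull hr1 hp.1
  have hseg : segment ℝ l r ⊆ convexHull ℝ S := segment_subset_convexHull hl hr
  -- The point of the supporting line above or below `p` lies between `l` and `r`, hence in the
  -- hull, and a point of the lower hull cannot be above it.
  obtain ⟨p', hp', hfst, hline⟩ : ∃ p' ∈ convexHull ℝ S, p'.1 = p.1 ∧ p'.2 + θ * p'.1 = κ := by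
    rcases (h1.trans h2).eq_or_lt with e | e
    · exact ⟨l, subset_convexHull ℝ S hl, by linarith, hl'⟩
    · obtain ⟨p', hp', he⟩ := exists_mem_segment_fst e h1 h2
      refine ⟨p', hseg hp', he, eq_of_mem_convexHull (S := {l, r}) ?_ (by rwa [convexHull_pair])⟩
      rintro q (rfl | rfl) <;> assumption
  have := hp.2 p' hp' hfst
  rw [← hfst]
  linarith

/-- The lower edge of the lower hull of `S` is the face cut out by the supporting line through the
rightmost point which passes through another point. -/
lemma lowerEdge_lowerHull (h : ∀ p ∈ S, κ ≤ p.2 + θ * p.1) (hr : r ∈ S)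
    (hr' : r.2 + θ * r.1 = κ) (hr1 : ∀ p ∈ S, p.1 < r.1 ∨ p = r)
    (hex : S = {r} ∨ ∃ l ∈ S, l ≠ r ∧ l.2 + θ * l.1 = κ) :
    lowerEdge (lowerHull S) = convexHull ℝ {p ∈ S | p.2 + θ * p.1 = κ} := by
  set T := {p ∈ S | p.2 + θ * p.1 = κ} with hT
  have hrC : r ∈ lowerHull S := mem_lowerHull_of_rightmost hr1 hr
  have hrT : r ∈ convexHull ℝ T := subset_convexHull ℝ T ⟨hr, hr'⟩
  have hC : ∀ p ∈ lowerHull S, p.1 < r.1 ∨ p = r := fun p hp =>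
    fst_lt_or_eq_of_mem_convexHull hr1 hp.1
  have hle : ∀ {z : ℝ × ℝ}, (z.1 < r.1 ∨ z = r) → z.1 ≤ r.1 := by
    rintro z (h | rfl)
    exacts [h.le, le_rfl]
  refine Set.Subset.antisymm ?_ ?_
  · rintro p ⟨r₀, hr₀, hmax, hpC, hseg⟩
    obtain rfl : r₀ = r := by
      rcases hC r₀ hr₀ with h' | h'
      · exact absurd (hmax r hrC) (not_le.2 h')
      · exact h'
    rcases hC p hpC with hp1 | rfl
    swap
    · exact hrT
    rcases hex with rfl | ⟨l, hl, hlr, hlκ⟩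
    · have : p ∈ ({r₀} : Set (ℝ × ℝ)) := by simpa using hpC.1
      exact absurd hp1 (by rw [Set.mem_singleton_iff.1 this]; exact lt_irrefl _)
    have hl1 : l.1 < r₀.1 := (hr1 l hl).resolve_right hlr
    have hsub : segment ℝ l r₀ ⊆ convexHull ℝ S := segment_subset_convexHull hl hr
    refine mem_convexHull_line h hpC.1 (le_antisymm ?_ (le_of_mem_convexHull h hpC.1))
    rcases le_or_gt l.1 p.1 with hlp | hlp
    · obtain ⟨p', hp', he⟩ := exists_mem_segment_fst hl1 hlp hp1.le
      have hline : p'.2 + θ * p'.1 = κ :=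
        eq_of_mem_convexHull (S := {l, r₀}) (by rintro q (rfl | rfl) <;> assumption)
          (by rwa [convexHull_pair])
      have := hpC.2 p' (hsub hp') he
      rw [← he]; linarith
    -- Here `p` lies to the left of `l`. The segment from `p` to the right end stays in the lower
    -- hull, so its point at the abscissa of `l` is not above `l`. Since the right end is on the
    -- line, `p` cannot be above it.
    · obtain ⟨l', hl', he⟩ := exists_mem_segment_fst hp1 hlp.le hl1.le
      have hlow := (hseg hl').2 l (subset_convexHull ℝ S hl) he.symm
      obtain ⟨a, b, ha, hb, hab, rfl⟩ := hl'
      simp only [Prod.fst_add, Prod.smul_fst, Prod.snd_add, Prod.smul_snd, smul_eq_mul] at he hlow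
      have hb1 : 0 < a := by
        rcases ha.eq_or_lt with rfl | h'
        · obtain rfl : b = 1 := by linarith
          simp at he; linarith
        · exact h'
      have hκ : κ = a * κ + b * κ := by rw [← add_mul, hab, one_mul]
      have e1 : a * (p.2 + θ * p.1) ≤ a * κ := by
        have : b * (r₀.2 + θ * r₀.1) = b * κ := by rw [hr']
        have h5 : θ * (a * p.1 + b * r₀.1) = θ * l.1 := by rw [he]
        nlinarith
      exact le_of_mul_le_mul_left e1 hb1
  · intro p hp
    have hsubC := convexHull_line_subset_lowerHull h
    exact ⟨r, hrC, fun p' hp' => hle (hC p' hp'), hsubC hp,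
      ((convex_convexHull ℝ T).segment_subset hp hrT).trans hsubC⟩

/-- A lower hull which is a segment of slope `-θ` lies on a supporting line. -/
lemma exists_line_of_lowerHull_eq_segment {a b : ℝ × ℝ} (hab : a.1 < b.1)
    (hs : b.2 - a.2 = -θ * (b.1 - a.1)) (hS : lowerHull S = segment ℝ a b)
    (hlow : ∀ p ∈ S, ∃ p' ∈ lowerHull S, p'.1 = p.1 ∧ p'.2 ≤ p.2) :
    ∃ κ : ℝ, (∀ p ∈ S, κ ≤ p.2 + θ * p.1) ∧ ∀ p ∈ lowerHull S, p.2 + θ * p.1 = κ := by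
  have hline : ∀ p ∈ lowerHull S, p.2 + θ * p.1 = a.2 + θ * a.1 := by
    intro p hp
    rw [hS, ← convexHull_pair] at hp
    refine eq_of_mem_convexHull (S := {a, b}) ?_ hp
    rintro q (rfl | rfl)
    · rfl
    · linarith
  refine ⟨a.2 + θ * a.1, fun p hp => ?_, hline⟩
  obtain ⟨p', hp', h1, h2⟩ := hlow p hp
  rw [← hline p' hp', h1]
  linarith

/-- Below every point of a finite set there is a point of its lower hull. -/
lemma exists_mem_lowerHull_le (hS : S.Finite) (hp : p ∈ S) :
    ∃ p' ∈ lowerHull S, p'.1 = p.1 ∧ p'.2 ≤ p.2 := by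
  have hc : IsCompact (convexHull ℝ S ∩ {q | q.1 = p.1}) :=
    (hS.isCompact_convexHull (𝕜 := ℝ)).inter_right (isClosed_eq continuous_fst continuous_const)
  obtain ⟨p', hp', hmin⟩ := hc.exists_isMinOn ⟨p, subset_convexHull ℝ S hp, rfl⟩
    continuous_snd.continuousOn
  refine ⟨p', ⟨hp'.1, fun q hq hqp => hmin ⟨hq, hqp.trans hp'.2⟩⟩, hp'.2,
    hmin ⟨subset_convexHull ℝ S hp, rfl⟩⟩

end Geometry

/-! ### Pull-back by a Newton-Puiseux transform followed by a shift. -/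

section Pullback

variable {L L' : Type u} [Field L] [Field L']

lemma map_CC_eq (z : L) {q : ℕ} (t : ℕ) (hq : 0 < q) (f : L[X] →+* L[X])
    (hf : ∀ c, f (Polynomial.C c) = Polynomial.C c) (a : L⟦X⟧) :
    PowerSeries.map f (expandHom q hq (PowerSeries.map Polynomial.C
      (PowerSeries.rescale (z ^ t) a))) = PowerSeries.map Polynomial.C (scaleX z t q hq a) := by
  ext1 n
  have h1 : PowerSeries.coeff n (scaleX z t q hq a) =
      if q ∣ n then PowerSeries.coeff (n / q) (PowerSeries.rescale (z ^ t) a) else 0 :=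
    PowerSeries.coeff_expand q hq.ne' _
  rw [PowerSeries.coeff_map, PowerSeries.coeff_map, coeff_expandHom, h1]
  split_ifs
  · rw [PowerSeries.coeff_map, hf]
  · simp

/-- This is why weighted leading forms control the transform: up to the translation `y ↦ y + z^s`,
`σ` is the weighted substitution for the slope of the edge. -/
lemma wt_sigmaPull (z : L) {q m s t : ℕ} (hq : 0 < q) (A : L⟦X⟧[X]) :
    wt 1 1 0 one_pos (sigmaPull z q m s t hq A) =
      PowerSeries.map (Polynomial.compRingHom (Polynomial.X + Polynomial.C (z ^ s)))
        (wt (z ^ t) q m hq A) := by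
  have : (wt 1 1 0 one_pos).comp (sigmaPull z q m s t hq) =
      (PowerSeries.map (Polynomial.compRingHom (Polynomial.X + Polynomial.C (z ^ s)))).comp
        (wt (z ^ t) q m hq) := by
    refine Polynomial.ringHom_ext' ?_ ?_
    · refine RingHom.ext fun a => ?_
      simp only [RingHom.comp_apply, wt, sigmaPull, Polynomial.coe_eval₂RingHom,
        Polynomial.eval₂_C]
      rw [map_CC_eq _ _ _ _ (by simp)]
      ext1 n
      rw [coeff_expandHom]
      simp
    · simp only [RingHom.comp_apply, wt_X, sigmaPull, Polynomial.coe_eval₂RingHom,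
        Polynomial.eval₂_X, map_mul, map_add, map_pow, wt_CX, PowerSeries.map_C,
        PowerSeries.map_X, Polynomial.coe_compRingHom_apply, Polynomial.X_comp]
      have : wt (1 : L) 1 0 one_pos (Polynomial.C (PowerSeries.C z)) =
          PowerSeries.C (Polynomial.C z) := by simp [wt]
      rw [this]
      simp
      ring
  exact congr($this A)

lemma LeadS.sigmaPull {z : L} {q m s t : ℕ} {hq : 0 < q} {A : L⟦X⟧[X]} {w : ℕ} {g : L[X]}
    (h : LeadS (wt (z ^ t) q m hq A) w g) :
    LeadX (sigmaPull z q m s t hq A) w (g.comp (Polynomial.X + Polynomial.C (z ^ s))) := by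
  rw [← leadS_wt_iff_leadX, wt_sigmaPull]
  have := Lead.map (t' := PowerSeries.X) (ρ' := PowerSeries.constantCoeff)
    (PowerSeries.map (Polynomial.compRingHom (Polynomial.X + Polynomial.C (z ^ s))))
    (Polynomial.compRingHom (Polynomial.X + Polynomial.C (z ^ s))) 1 1
    (by simp) (constantCoeff_map _) h
  simpa using this

lemma red_comp_shift {c : L⟦X⟧} (hc : PowerSeries.constantCoeff c = 0) (A : L⟦X⟧[X]) :
    red (A.comp (Polynomial.X + Polynomial.C c)) = red A := by
  simp [red, Polynomial.map_comp, hc]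

lemma red_tauPull {G : L⟦X⟧[X]} (hG : PowerSeries.constantCoeff (shiftSeries G) = 0)
    (A : L⟦X⟧[X]) : red (tauPull G A) = red A := red_comp_shift hG A

lemma LeadX.tauPull {G A : L⟦X⟧[X]} (hG : PowerSeries.constantCoeff (shiftSeries G) = 0)
    {w : ℕ} {g : L[X]} (h : LeadX A w g) : LeadX (tauPull G A) w g := by
  obtain ⟨W, rfl, rfl⟩ := h
  refine ⟨ApproxRoots.tauPull G W, ?_, red_tauPull hG W⟩
  simp [ApproxRoots.tauPull]

/-- The pull-back by one Newton-Puiseux transform followed by a shift. -/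
noncomputable def stepPull (f : L →+* L') (z : L') (q m s t : ℕ) (hq : 0 < q) (G : L'⟦X⟧[X]) :
    L⟦X⟧[X] →+* L'⟦X⟧[X] :=
  (tauPull G).comp ((sigmaPull z q m s t hq).comp (baseChange f))

variable {f : L →+* L'} {z : L'} {q m s t : ℕ} {hq : 0 < q} {G : L'⟦X⟧[X]} {A : L⟦X⟧[X]}

lemma leadX_stepPull (hG : PowerSeries.constantCoeff (shiftSeries G) = 0) {w : ℕ} {g : L'[X]}
    (h : LeadS (wt (z ^ t) q m hq (baseChange f A)) w g) :
    LeadX (stepPull f z q m s t hq G A) w (g.comp (Polynomial.X + Polynomial.C (z ^ s))) :=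
  LeadX.tauPull hG h.sigmaPull

lemma IsMono.stepPull (hG : PowerSeries.constantCoeff (shiftSeries G) = 0) {b v : ℕ} {c : L}
    (hb : b ≤ m) (h : IsMono b A v c) :
    IsMono 1 (stepPull f z q m s t hq G A) (q * v) (f c * z ^ (t * v)) := by
  have := isMono_one_of_leadX (leadX_stepPull (s := s) hG ((h.baseChange f).wt hq hb (z ^ t)))
  simpa [← pow_mul, Polynomial.coeff_zero_eq_eval_zero] using this

/-- The factor `y` of the leading term takes the nonzero value `z^s` at the new origin. So what was
a coordinate at one stage becomes a monomial at the next. -/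
lemma YLike.stepPull (hG : PowerSeries.constantCoeff (shiftSeries G) = 0) {b v : ℕ} {c : L}
    (hb : b ≤ m) (h : YLike b q m A v c) :
    IsMono 1 (stepPull f z q m s t hq G A) (q * v + m) (f c * z ^ (t * v + s)) := by
  have := isMono_one_of_leadX (leadX_stepPull (s := s) hG ((h.baseChange f).wt hq hb (z ^ t)))
  simpa [← pow_mul, pow_add, mul_assoc, Polynomial.coeff_zero_eq_eval_zero] using this

lemma stepPull_C (a : L⟦X⟧) : stepPull f z q m s t hq G (Polynomial.C a) =
    Polynomial.C (scaleX z t q hq (PowerSeries.map f a)) := by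
  simp [ApproxRoots.stepPull, tauPull, sigmaPull, baseChange]

lemma scaleX_X (z : L) (t q : ℕ) (hq : 0 < q) :
    scaleX z t q hq PowerSeries.X = PowerSeries.C (z ^ t) * PowerSeries.X ^ q := by
  have h : ∀ a, scaleX z t q hq a = expandHom q hq (PowerSeries.rescale (z ^ t) a) := fun _ => rfl
  rw [h, PowerSeries.rescale_X, map_mul, expandHom_X, expandHom_C]

lemma rescale_C (u c : L) : PowerSeries.rescale u (PowerSeries.C c) = PowerSeries.C c := by
  ext n
  rw [PowerSeries.coeff_rescale, PowerSeries.coeff_C]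
  split_ifs with h <;> simp [h]

lemma scaleX_C (z : L) (t q : ℕ) (hq : 0 < q) (c : L) :
    scaleX z t q hq (PowerSeries.C c) = PowerSeries.C c := by
  have h : ∀ a, scaleX z t q hq a = expandHom q hq (PowerSeries.rescale (z ^ t) a) := fun _ => rfl
  rw [h, rescale_C, expandHom_C]

end Pullback

/-! ### Linear independence of initial coefficients of equal weight. -/

section Independence

variable {K L : Type u} [Field K] [Field L]

/-- The monomials `μ^n ∏ Λ_i^{b_i}` of a given weight `e n + ∑ b_i V_i`, with `b_i` less than
`N i`, are linearly independent over `K`. -/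
def IndepMonomials (ε : K →+* L) (e : ℕ) (μ : L) (k : ℕ) (V : ℕ → ℕ) (Λ : ℕ → L) (N : ℕ → ℕ) :
    Prop :=
  ∀ (w : ℕ) (T : Finset (ℕ × (Fin k → ℕ))) (f : ℕ × (Fin k → ℕ) → K),
    (∀ B ∈ T, (∀ i, B.2 i < N i) ∧ e * B.1 + ∑ i : Fin k, B.2 i * V i = w) →
    ∑ B ∈ T, ε (f B) * (μ ^ B.1 * ∏ i : Fin k, Λ i ^ B.2 i) = 0 → ∀ B ∈ T, f B = 0

lemma indepMonomials_zero (ε : K →+* L) {e : ℕ} {μ : L} (he : 0 < e) (hμ : μ ≠ 0) (V : ℕ → ℕ)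
    (Λ : ℕ → L) (N : ℕ → ℕ) : IndepMonomials ε e μ 0 V Λ N := by
  intro w T f hT hsum B hB
  have hu : ∀ B' ∈ T, B' ≠ B → ε (f B') * (μ ^ B'.1 * ∏ i : Fin 0, Λ i ^ B'.2 i) = 0 := by
    intro B' hB' hne
    exfalso
    apply hne
    have h1 := (hT B hB).2
    have h2 := (hT B' hB').2
    simp only [Finset.univ_eq_empty, Finset.sum_empty, add_zero] at h1 h2
    exact Prod.ext (Nat.eq_of_mul_eq_mul_left he (h2.trans h1.symm)) (Subsingleton.elim _ _)
  rw [Finset.sum_eq_single_of_mem B hB hu] at hsum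
  simpa [hμ] using hsum

lemma indepMonomials_congr {ε : K →+* L} {e : ℕ} {μ : L} {k : ℕ} {V V' : ℕ → ℕ} {Λ Λ' : ℕ → L}
    {N N' : ℕ → ℕ} (hV : ∀ i < k, V i = V' i) (hΛ : ∀ i < k, Λ i = Λ' i)
    (hN : ∀ i < k, N i = N' i) (h : IndepMonomials ε e μ k V Λ N) :
    IndepMonomials ε e μ k V' Λ' N' := by
  intro w T f hT hsum
  refine h w T f (fun B hB => ⟨fun i => by rw [hN i i.2]; exact (hT B hB).1 i, ?_⟩) ?_
  · rw [← (hT B hB).2]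
    exact congrArg _ (Finset.sum_congr rfl fun i _ => by rw [hV i i.2])
  · rw [← hsum]
    exact Finset.sum_congr rfl fun B _ => by
      congr 2
      exact Finset.prod_congr rfl fun i _ => by rw [hΛ i i.2]

open Classical in
-- Among exponents of fixed weight, `b_k` has a fixed residue modulo `q`, and the power of `z`
-- carried by a monomial is `b_k / q` up to a common shift, by the Bézout relation. As `b_k < qℓ`,
-- only `1, z, …, z^{ℓ-1}` occur, and these are independent over the previous field. Fixing the
-- power of `z` fixes `b_k`, and the previous stage applies.
lemma indepMonomials_succ {P : L[X]} [Fact (Irreducible P)] (hP : P.Monic)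
    (hz : AdjoinRoot.root P ≠ 0) {ε : K →+* L} {e : ℕ} {μ : L} {k : ℕ} {V : ℕ → ℕ} {Λ : ℕ → L}
    {N : ℕ → ℕ} {q m s t v : ℕ} {lam : L} (hq : 0 < q) (hqm : Nat.Coprime q m)
    (hst : q * s = m * t + 1) (hlam : lam ≠ 0) (h : IndepMonomials ε e μ k V Λ N)
    {V' : ℕ → ℕ} {Λ' : ℕ → AdjoinRoot P} {μ' : AdjoinRoot P} (hV : ∀ i < k, V' i = q * V i)
    (hVk : V' k = q * v + m)
    (hΛ : ∀ i < k, Λ' i = AdjoinRoot.of P (Λ i) * AdjoinRoot.root P ^ (t * V i))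
    (hΛk : Λ' k = AdjoinRoot.of P lam * AdjoinRoot.root P ^ (t * v + s))
    (hμ : μ' = AdjoinRoot.of P μ * AdjoinRoot.root P ^ (t * e)) (hN : N k = q * P.natDegree) :
    IndepMonomials ((AdjoinRoot.of P).comp ε) (q * e) μ' (k + 1) V' Λ' N := by
  intro w T f hT hsum B₀ hB₀
  set z := AdjoinRoot.root P
  -- The part of the new weight that is multiplied by `q`: the old weight, the last variable
  -- included.
  set J : ℕ × (Fin (k + 1) → ℕ) → ℕ := fun B =>
    e * B.1 + ∑ i : Fin k, B.2 i.castSucc * V i + B.2 (Fin.last k) * v with hJ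
  have hw : ∀ B ∈ T, q * J B + m * B.2 (Fin.last k) = w := by
    intro B hB
    rw [← (hT B hB).2, Fin.sum_univ_castSucc]
    simp only [Fin.val_castSucc, Fin.val_last, hVk, hJ]
    have : ∑ i : Fin k, B.2 i.castSucc * V' i = q * ∑ i : Fin k, B.2 i.castSucc * V i := by
      rw [Finset.mul_sum]
      exact Finset.sum_congr rfl fun i _ => by rw [hV i i.2]; ring
    rw [this]; ring
  set i₀ := B₀.2 (Fin.last k) % q with hi₀
  have hmod : ∀ B ∈ T, B.2 (Fin.last k) % q = i₀ := by
    intro B hB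
    have h1 : m * B.2 (Fin.last k) ≡ m * B₀.2 (Fin.last k) [MOD q] := by
      have h2 := (hw B hB).trans (hw B₀ hB₀).symm
      have h3 := congrArg (· % q) h2
      simpa [Nat.ModEq, Nat.mul_add_mod] using h3
    exact Nat.ModEq.cancel_left_of_coprime hqm h1
  have hdiv : ∀ B ∈ T, B.2 (Fin.last k) = i₀ + q * (B.2 (Fin.last k) / q) := by
    intro B hB
    rw [← hmod B hB]
    exact (Nat.mod_add_div _ _).symm
  set c₀ := t * (J B₀ + m * (B₀.2 (Fin.last k) / q)) + s * i₀ with hc₀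
  -- Increasing `b_k` by `q` at constant weight lowers `J` by `m`, so the exponent of `z` changes by
  -- `qs - tm = 1`.
  have hexp : ∀ B ∈ T, t * J B + s * B.2 (Fin.last k) = c₀ + B.2 (Fin.last k) / q := by
    intro B hB
    have h1 := hw B hB
    have h2 := hw B₀ hB₀
    have h3 := hdiv B hB
    have h4 := hdiv B₀ hB₀
    set l := B.2 (Fin.last k) / q
    set l₀ := B₀.2 (Fin.last k) / q
    rw [h3] at h1
    rw [h4] at h2
    have h5 : J B + m * l = J B₀ + m * l₀ := by
      apply Nat.eq_of_mul_eq_mul_left hq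
      nlinarith
    rw [h3, hc₀, ← h5]
    calc t * J B + s * (i₀ + q * l) = t * J B + s * i₀ + (q * s) * l := by ring
      _ = _ := by rw [hst]; ring
  set a : ℕ × (Fin (k + 1) → ℕ) → L := fun B =>
    ε (f B) * (μ ^ B.1 * ∏ i : Fin k, Λ i ^ B.2 i.castSucc) * lam ^ B.2 (Fin.last k) with ha
  have hterm : ∀ B ∈ T, (AdjoinRoot.of P).comp ε (f B) *
      (μ' ^ B.1 * ∏ i : Fin (k + 1), Λ' i ^ B.2 i) =
      z ^ c₀ * (AdjoinRoot.of P (a B) * z ^ (B.2 (Fin.last k) / q)) := by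
    intro B hB
    have h1 : ∏ i : Fin k, Λ' i ^ B.2 i.castSucc =
        AdjoinRoot.of P (∏ i : Fin k, Λ i ^ B.2 i.castSucc) *
          z ^ (t * ∑ i : Fin k, B.2 i.castSucc * V i) := by
      rw [map_prod, Finset.mul_sum, ← Finset.prod_pow_eq_pow_sum, ← Finset.prod_mul_distrib]
      refine Finset.prod_congr rfl fun i _ => ?_
      rw [hΛ i i.2, mul_pow, map_pow, ← pow_mul]
      congr 2
      ring
    rw [Fin.prod_univ_castSucc]
    simp only [Fin.val_castSucc, Fin.val_last]
    rw [h1, hΛk, hμ, mul_left_comm (z ^ c₀), ← pow_add, ← hexp B hB]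
    simp only [ha, hJ, map_mul, map_pow, mul_pow, RingHom.comp_apply, ← pow_mul, pow_add, mul_add,
      mul_comm s]
    ring
  set p : L[X] := ∑ B ∈ T, Polynomial.monomial (B.2 (Fin.last k) / q) (a B) with hp
  -- `p` vanishes at `z` and has degree less than that of the minimal polynomial `P`.
  have hp0 : p = 0 := by
    have hroot : AdjoinRoot.mk P p = 0 := by
      rw [Finset.sum_congr rfl hterm, ← Finset.mul_sum] at hsum
      have := (mul_eq_zero.1 hsum).resolve_left (pow_ne_zero _ hz)
      rw [hp, map_sum, ← this]
      refine Finset.sum_congr rfl fun B _ => ?_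
      rw [← Polynomial.C_mul_X_pow_eq_monomial]
      simp [z]
    rw [AdjoinRoot.mk_eq_zero] at hroot
    refine Polynomial.eq_zero_of_dvd_of_degree_lt hroot ?_
    rw [Polynomial.degree_eq_natDegree hP.ne_zero, hp]
    refine (Polynomial.degree_sum_le _ _).trans_lt ?_
    rw [Finset.sup_lt_iff (WithBot.bot_lt_coe _)]
    intro B hB
    refine (Polynomial.degree_monomial_le _ _).trans_lt ?_
    have := (hT B hB).1 (Fin.last k)
    rw [Fin.val_last, hN] at this
    exact_mod_cast Nat.div_lt_of_lt_mul this
  set l := B₀.2 (Fin.last k) / q with hl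
  set T' := T.filter fun B => B.2 (Fin.last k) / q = l with hT'
  have hlast : ∀ B ∈ T', B.2 (Fin.last k) = i₀ + q * l := by
    intro B hB
    rw [hT', Finset.mem_filter] at hB
    rw [hdiv B hB.1, hB.2]
  have hsum' : ∑ B ∈ T', ε (f B) * (μ ^ B.1 * ∏ i : Fin k, Λ i ^ B.2 i.castSucc) = 0 := by
    have h1 := congr(Polynomial.coeff $hp0 l)
    rw [hp, Polynomial.finsetSum_coeff] at h1
    simp only [Polynomial.coeff_monomial, Polynomial.coeff_zero] at h1
    rw [← Finset.sum_filter] at h1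
    have h2 : ∑ B ∈ T', ε (f B) * (μ ^ B.1 * ∏ i : Fin k, Λ i ^ B.2 i.castSucc) *
        lam ^ (i₀ + q * l) = 0 := by
      rw [← h1]
      exact Finset.sum_congr rfl fun B hB => by rw [ha, ← hlast B hB]
    rw [← Finset.sum_mul] at h2
    exact (mul_eq_zero.1 h2).resolve_right (pow_ne_zero _ hlam)
  set φ : ℕ × (Fin (k + 1) → ℕ) → ℕ × (Fin k → ℕ) := fun B => (B.1, fun i => B.2 i.castSucc)
  set φ' : ℕ × (Fin k → ℕ) → ℕ × (Fin (k + 1) → ℕ) := fun B => (B.1, Fin.snoc B.2 (i₀ + q * l))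
  have hinv : ∀ B ∈ T', φ' (φ B) = B := by
    intro B hB
    refine Prod.ext rfl ?_
    funext i
    refine Fin.lastCases ?_ (fun j => ?_) i
    · simp [φ, φ', hlast B hB]
    · simp [φ, φ']
  have hinj : Set.InjOn φ T' := fun B hB B' hB' he => by
    rw [← hinv B hB, ← hinv B' hB', he]
  have hB₀' : B₀ ∈ T' := by simp [hT', hB₀, hl]
  -- On `T'` the last exponent is constant, and removing its contribution from `J` leaves the weight
  -- in the remaining variables.
  have := h (J B₀ - B₀.2 (Fin.last k) * v) (T'.image φ) (fun B => f (φ' B)) ?_ ?_ (φ B₀)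
    (Finset.mem_image_of_mem _ hB₀')
  · rwa [hinv B₀ hB₀'] at this
  · intro B hB
    obtain ⟨B, hBT', rfl⟩ := Finset.mem_image.1 hB
    have hBT : B ∈ T := Finset.mem_of_mem_filter B hBT'
    refine ⟨fun i => (hT B hBT).1 i.castSucc, ?_⟩
    have h1 := hw B hBT
    have h2 := hw B₀ hB₀
    rw [hlast B hBT'] at h1
    rw [hlast B₀ hB₀'] at h2
    have h3 : J B = J B₀ := Nat.eq_of_mul_eq_mul_left hq (by omega)
    rw [← h3, hlast B₀ hB₀', ← hlast B hBT']
    simp [φ, hJ]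
  · rw [Finset.sum_image hinj, ← hsum']
    exact Finset.sum_congr rfl fun B hB => by rw [hinv B hB]

end Independence

/-! ### Finite generation and Cayley-Hamilton. -/

section Spans

variable {R S T : Type*} [CommRing R] [CommRing S] [CommRing T]

/-- `S` is generated by `n` elements as a module over `R`, via `f`. -/
def Spans (f : R →+* S) (n : ℕ) : Prop :=
  ∃ (ι : Type) (_ : Fintype ι) (β : ι → S), Fintype.card ι = n ∧
    ∀ s, ∃ c : ι → R, s = ∑ i, f (c i) * β i

lemma Spans.id : Spans (RingHom.id R) 1 :=
  ⟨Unit, inferInstance, fun _ => 1, rfl, fun s => ⟨fun _ => s, by simp⟩⟩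

lemma Spans.comp {f : R →+* S} {g : S →+* T} {n m : ℕ} (hf : Spans f n) (hg : Spans g m) :
    Spans (g.comp f) (n * m) := by
  obtain ⟨ι, _, β, rfl, hβ⟩ := hf
  obtain ⟨κ, _, γ, rfl, hγ⟩ := hg
  refine ⟨ι × κ, inferInstance, fun i => g (β i.1) * γ i.2, Fintype.card_prod _ _, fun s => ?_⟩
  obtain ⟨c, rfl⟩ := hγ s
  choose d hd using fun j => hβ (c j)
  refine ⟨fun i => d i.2 i.1, ?_⟩
  rw [Fintype.sum_prod_type_right]
  refine Finset.sum_congr rfl fun j _ => ?_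
  conv_lhs => rw [hd j, map_sum, Finset.sum_mul]
  refine Finset.sum_congr rfl fun i _ => ?_
  simp [mul_assoc]

/-- Cayley-Hamilton. -/
lemma Spans.exists_monic [Nontrivial R] {f : R →+* S} {n : ℕ} (hf : Spans f n)
    (y : S) : ∃ p : R[X], p.Monic ∧ p.natDegree = n ∧ p.eval₂ f y = 0 := by
  classical
  obtain ⟨ι, _, β, rfl, hβ⟩ := hf
  choose M hM using fun i => hβ (y * β i)
  let A : Matrix ι ι R := Matrix.of M
  refine ⟨A.charpoly, A.charpoly_monic, A.charpoly_natDegree_eq_dim, ?_⟩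
  rw [Polynomial.eval₂_eq_eval_map, ← Matrix.charpoly_map, Matrix.eval_charpoly]
  set D : Matrix ι ι S := Matrix.scalar ι y - f.mapMatrix A
  have h1 : D.mulVec β = 0 := by
    rw [Matrix.sub_mulVec]
    funext i
    have : (f.mapMatrix A).mulVec β i = y * β i := by
      rw [hM i]
      rfl
    rw [Pi.sub_apply, this]
    simp
  have h2 : ∀ i, D.det * β i = 0 := by
    intro i
    have h3 : (D.adjugate * D).mulVec β = 0 := by
      rw [← Matrix.mulVec_mulVec, h1, Matrix.mulVec_zero]
    rw [Matrix.adjugate_mul, Matrix.smul_mulVec, Matrix.one_mulVec] at h3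
    exact congrFun h3 i
  -- The determinant kills every generator, and 1 is a combination of generators, so the determinant
  -- itself is 0.
  obtain ⟨c, hc⟩ := hβ 1
  change D.det = 0
  rw [← mul_one D.det, hc, Finset.mul_sum]
  refine Finset.sum_eq_zero fun i _ => ?_
  rw [mul_left_comm, h2, mul_zero]

end Spans

/-! ### Generators of the power series ring after one transform. -/

section SpansStep

variable {L : Type u} [Field L] {P : L[X]} [Fact (Irreducible P)]

lemma AdjoinRoot.exists_repr (hP : P.Monic) (x : AdjoinRoot P) :
    ∃ a : Fin P.natDegree → L, x = ∑ i, AdjoinRoot.of P (a i) * AdjoinRoot.root P ^ (i : ℕ) := by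
  let pb := AdjoinRoot.powerBasis' hP
  have hdim : pb.dim = P.natDegree := AdjoinRoot.powerBasis'_dim hP
  refine ⟨fun i => pb.basis.repr x (Fin.cast hdim.symm i), ?_⟩
  conv_lhs => rw [← pb.basis.sum_repr x]
  refine Fintype.sum_equiv (finCongr hdim) _ _ fun i => ?_
  rw [pb.basis_eq_pow, AdjoinRoot.powerBasis'_gen hP, Algebra.smul_def]
  rfl

/-- The elements `x^i z^j` with `i < q` and `j < ℓ` generate: `x^i` takes care of exponents modulo
`q`, and `z^j` of the residue field extension. -/
lemma spans_step (hP : P.Monic) (hz : AdjoinRoot.root P ≠ 0) {t q : ℕ} (hq : 0 < q) :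
    Spans ((scaleX (AdjoinRoot.root P) t q hq).comp (PowerSeries.map (AdjoinRoot.of P)))
      (q * P.natDegree) := by
  set z := AdjoinRoot.root P
  choose a ha using AdjoinRoot.exists_repr hP
  refine ⟨Fin q × Fin P.natDegree, inferInstance,
    fun i => PowerSeries.X ^ (i.1 : ℕ) * PowerSeries.C (z ^ (i.2 : ℕ)), by simp, fun s => ?_⟩
  -- Dividing by `z^(t l)` undoes the rescaling `x ↦ z^t x^q` before the coefficient is decomposed
  -- in powers of `z`.
  refine ⟨fun i => PowerSeries.mk fun l =>
    a (PowerSeries.coeff (i.1 + q * l) s * (z ^ (t * l))⁻¹) i.2, ?_⟩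
  ext n
  have hco : ∀ i : Fin q × Fin P.natDegree, PowerSeries.coeff n
      ((scaleX z t q hq).comp (PowerSeries.map (AdjoinRoot.of P)) (PowerSeries.mk fun l =>
        a (PowerSeries.coeff (i.1 + q * l) s * (z ^ (t * l))⁻¹) i.2) *
        (PowerSeries.X ^ (i.1 : ℕ) * PowerSeries.C (z ^ (i.2 : ℕ)))) =
      if (i.1 : ℕ) = n % q then z ^ (t * (n / q)) *
        (AdjoinRoot.of P (a (PowerSeries.coeff n s * (z ^ (t * (n / q)))⁻¹) i.2) *
          z ^ (i.2 : ℕ)) else 0 := by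
    intro i
    rw [← mul_assoc, PowerSeries.coeff_mul_C, PowerSeries.coeff_mul_X_pow']
    have hs : ∀ (b : (AdjoinRoot P)⟦X⟧) (k : ℕ), PowerSeries.coeff k (scaleX z t q hq b) =
        if q ∣ k then (z ^ t) ^ (k / q) * PowerSeries.coeff (k / q) b else 0 := by
      intro b k
      have : PowerSeries.coeff k (scaleX z t q hq b) =
        if q ∣ k then PowerSeries.coeff (k / q) (PowerSeries.rescale (z ^ t) b) else 0 :=
        PowerSeries.coeff_expand q hq.ne' _
      rw [this, PowerSeries.coeff_rescale]
    rw [RingHom.comp_apply, hs]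
    by_cases hi : (i.1 : ℕ) = n % q
    · have h1 : n - n % q = q * (n / q) := by
        have := Nat.mod_add_div n q
        omega
      have h2 : n % q + q * (n / q) = n := Nat.mod_add_div n q
      rw [if_pos hi, hi, if_pos (Nat.mod_le n q), h1, if_pos (Dvd.intro _ rfl),
        Nat.mul_div_cancel_left _ hq, PowerSeries.coeff_map, PowerSeries.coeff_mk, h2, ← pow_mul,
        mul_assoc]
    · rw [if_neg hi]
      by_cases h1 : (i.1 : ℕ) ≤ n
      · rw [if_pos h1, if_neg, zero_mul]
        rintro ⟨c, hc⟩
        apply hi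
        have : n = i.1 + q * c := by omega
        rw [this, Nat.add_mul_mod_self_left, Nat.mod_eq_of_lt i.1.2]
      · rw [if_neg h1, zero_mul]
  rw [map_sum, Finset.sum_congr rfl fun i _ => hco i, Fintype.sum_prod_type_right]
  have hsum : ∀ j : Fin P.natDegree, ∑ i : Fin q, (if ((i, j).1 : ℕ) = n % q then
      z ^ (t * (n / q)) * (AdjoinRoot.of P (a (PowerSeries.coeff n s *
        (z ^ (t * (n / q)))⁻¹) (i, j).2) * z ^ ((i, j).2 : ℕ)) else 0) =
      z ^ (t * (n / q)) * (AdjoinRoot.of P (a (PowerSeries.coeff n s *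
        (z ^ (t * (n / q)))⁻¹) j) * z ^ (j : ℕ)) := by
    intro j
    rw [Finset.sum_eq_single (⟨n % q, Nat.mod_lt n hq⟩ : Fin q)]
    · simp
    · intro i _ hi
      rw [if_neg]
      exact fun h => hi (Fin.ext h)
    · simp
  rw [Finset.sum_congr rfl fun j _ => hsum j, ← Finset.mul_sum, ← ha]
  field_simp

end SpansStep

/-! ### Quasi-homogeneous forms at the point `(z^t, z^s)`. -/

section SimpleRoot

/-- Solutions of `qJ + mi = w` differ by multiples of `(-m, q)`, and along this vector `tJ + si`
grows by `qs - mt = 1`. The conclusion is arranged to avoid subtraction. -/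
lemma bezout_exponent {q m s t w J₁ i₁ J₂ i₂ : ℕ} (hq : 0 < q) (hqm : Nat.Coprime q m)
    (hst : q * s = m * t + 1) (h₁ : q * J₁ + m * i₁ = w) (h₂ : q * J₂ + m * i₂ = w) :
    i₁ % q = i₂ % q ∧ t * J₁ + s * i₁ + i₂ / q = t * J₂ + s * i₂ + i₁ / q := by
  have hmod : i₁ % q = i₂ % q := by
    have h1 : m * i₁ ≡ m * i₂ [MOD q] := by
      have h3 := congrArg (· % q) (h₁.trans h₂.symm)
      simpa [Nat.ModEq, Nat.mul_add_mod] using h3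
    exact Nat.ModEq.cancel_left_of_coprime hqm h1
  refine ⟨hmod, ?_⟩
  have e1 := Nat.mod_add_div i₁ q
  have e2 := Nat.mod_add_div i₂ q
  rw [hmod] at e1
  set r := i₂ % q
  set l₁ := i₁ / q
  set l₂ := i₂ / q
  have h5 : J₁ + m * l₁ = J₂ + m * l₂ := by
    apply Nat.eq_of_mul_eq_mul_left hq
    rw [← e1] at h₁
    rw [← e2] at h₂
    nlinarith
  calc t * J₁ + s * i₁ + l₂ = t * J₁ + s * r + (q * s) * l₁ + l₂ := by rw [← e1]; ring
    _ = t * (J₁ + m * l₁) + s * r + l₁ + l₂ := by rw [hst]; ring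
    _ = t * J₂ + s * r + (m * t + 1) * l₂ + l₁ := by rw [h5]; ring
    _ = t * J₂ + s * i₂ + l₁ := by rw [← hst, ← e2]; ring

variable {L : Type u} [Field L] {P : L[X]} [Fact (Irreducible P)]

/-- The quasi-homogeneous polynomial `∑ γ_i x^{J_i} y^i`, of `y`-degree at most `q deg P`, has at
most a simple zero at `(x, y) = (z^t, z^s)`. -/
lemma sum_mul_ne_zero_of_root (hP : P.Monic) (hP' : Polynomial.derivative P ≠ 0)
    (hz : AdjoinRoot.root P ≠ 0) {q m s t w : ℕ} (hq : 0 < q) (hq' : (q : L) ≠ 0)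
    (hqm : Nat.Coprime q m) (hst : q * s = m * t + 1) (I : Finset ℕ) (γ : ℕ → L) (J : ℕ → ℕ)
    (hJ : ∀ i ∈ I, q * J i + m * i = w) (hI : ∀ i ∈ I, i ≤ q * P.natDegree)
    (hne : ∃ i ∈ I, γ i ≠ 0)
    (hroot : ∑ i ∈ I, AdjoinRoot.of P (γ i) * AdjoinRoot.root P ^ (t * J i + s * i) = 0) :
    ∑ i ∈ I, (i : AdjoinRoot P) *
      (AdjoinRoot.of P (γ i) * AdjoinRoot.root P ^ (t * J i + s * i)) ≠ 0 := by
  obtain ⟨i₁, hi₁, hγ⟩ := hne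
  set z := AdjoinRoot.root P
  have hb := fun i hi => bezout_exponent hq hqm hst (hJ i hi) (hJ i₁ hi₁)
  have hdiv : ∀ i ∈ I, i = i₁ % q + q * (i / q) := fun i hi => by
    rw [← (hb i hi).1, Nat.mod_add_div]
  set c := t * J i₁ + s * i₁
  have hexp : ∀ i ∈ I, z ^ (i₁ / q) * z ^ (t * J i + s * i) = z ^ c * z ^ (i / q) := fun i hi => by
    rw [← pow_add, ← pow_add, ← (hb i hi).2, add_comm]
  set p : L[X] := ∑ i ∈ I, Polynomial.monomial (i / q) (γ i) with hp
  have hmk : AdjoinRoot.mk P p = ∑ i ∈ I, AdjoinRoot.of P (γ i) * z ^ (i / q) := by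
    rw [hp, map_sum]
    refine Finset.sum_congr rfl fun i _ => ?_
    rw [← Polynomial.C_mul_X_pow_eq_monomial]
    simp [z]
  have hmk' : z * AdjoinRoot.mk P (Polynomial.derivative p) =
      ∑ i ∈ I, ((i / q : ℕ) : AdjoinRoot P) * (AdjoinRoot.of P (γ i) * z ^ (i / q)) := by
    rw [hp, map_sum, map_sum, Finset.mul_sum]
    refine Finset.sum_congr rfl fun i _ => ?_
    rw [Polynomial.derivative_monomial, ← Polynomial.C_mul_X_pow_eq_monomial]
    rcases Nat.eq_zero_or_pos (i / q) with h | h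
    · simp [h]
    · obtain ⟨n, hn⟩ := Nat.exists_eq_succ_of_ne_zero h.ne'
      rw [hn]
      simp only [Nat.succ_eq_add_one, Nat.add_sub_cancel, map_mul, map_pow, AdjoinRoot.mk_C,
        AdjoinRoot.mk_X, map_natCast, pow_succ]
      ring
  have hroot' : AdjoinRoot.mk P p = 0 := by
    have : z ^ c * AdjoinRoot.mk P p = 0 := by
      rw [hmk, Finset.mul_sum, ← mul_zero (z ^ (i₁ / q)), ← hroot, Finset.mul_sum]
      refine Finset.sum_congr rfl fun i hi => ?_
      rw [mul_left_comm, ← hexp i hi]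
      ring
    exact (mul_eq_zero.1 this).resolve_left (pow_ne_zero _ hz)
  -- All `i` have the same residue modulo `q`, so distinct `i` have distinct quotients and the
  -- monomials of `p` do not collide.
  have hp0 : p ≠ 0 := by
    intro h0
    have := congr(Polynomial.coeff $h0 (i₁ / q))
    rw [hp, Polynomial.finsetSum_coeff, Finset.sum_eq_single i₁] at this
    · simp [hγ] at this
    · intro i hi hne
      rw [Polynomial.coeff_monomial, if_neg]
      intro he
      apply hne
      rw [hdiv i hi, he, ← hdiv i₁ hi₁]
    · exact fun h => absurd hi₁ h
  have hdeg : p.natDegree ≤ P.natDegree := by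
    rw [hp]
    refine Polynomial.natDegree_sum_le_of_forall_le _ _ fun i hi => ?_
    exact (Polynomial.natDegree_monomial_le _).trans (Nat.div_le_of_le_mul (hI i hi))
  -- `p` is divisible by `P` and its degree is at most that of `P`, so it is a nonzero constant
  -- multiple of `P`, which is separable.
  obtain ⟨r, hr⟩ := AdjoinRoot.mk_eq_zero.1 hroot'
  have hr0 : r ≠ 0 := by
    rintro rfl
    exact hp0 (by simpa using hr)
  have hrdeg : r.natDegree = 0 := by
    rw [hr, hP.natDegree_mul' hr0] at hdeg
    omega
  obtain ⟨a, rfl⟩ := Polynomial.natDegree_eq_zero.1 hrdeg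
  have ha : a ≠ 0 := by simpa using hr0
  have hder : AdjoinRoot.mk P (Polynomial.derivative p) ≠ 0 := by
    rw [hr, Polynomial.derivative_mul, Polynomial.derivative_C, mul_zero, add_zero, map_mul]
    refine mul_ne_zero ?_ ?_
    · rw [Ne, AdjoinRoot.mk_eq_zero]
      exact fun hd => hP' (Polynomial.eq_zero_of_dvd_of_degree_lt hd
        (Polynomial.degree_derivative_lt hP.ne_zero))
    · rw [AdjoinRoot.mk_C]
      exact (map_ne_zero _).2 ha
  intro h0
  -- Writing `i = r + q(i / q)` turns the sum weighted by `i` into `r p(z) + q z p'(z)`, up to a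
  -- power of `z`, and `p(z) = 0`.
  have h1 : z ^ c * ((q : AdjoinRoot P) * (z * AdjoinRoot.mk P (Polynomial.derivative p))) = 0 := by
    have h2 : z ^ c * (((i₁ % q : ℕ) : AdjoinRoot P) * AdjoinRoot.mk P p +
        (q : AdjoinRoot P) * (z * AdjoinRoot.mk P (Polynomial.derivative p))) = 0 := by
      rw [hmk, hmk', ← mul_zero (z ^ (i₁ / q)), ← h0, Finset.mul_sum, Finset.mul_sum,
        ← Finset.sum_add_distrib, Finset.mul_sum, Finset.mul_sum]
      refine Finset.sum_congr rfl fun i hi => ?_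
      have h3 : (i : AdjoinRoot P) = ((i₁ % q : ℕ) : AdjoinRoot P) + q * ((i / q : ℕ)) := by
        conv_lhs => rw [hdiv i hi]
        push_cast
        rfl
      rw [h3]
      linear_combination (-(((i₁ % q : ℕ) : AdjoinRoot P) + q * ((i / q : ℕ))) *
        AdjoinRoot.of P (γ i)) * hexp i hi
    rwa [hroot', mul_zero, zero_add] at h2
  have hqz : (q : AdjoinRoot P) ≠ 0 := by
    have := (map_ne_zero (AdjoinRoot.of P)).2 hq'
    simpa using this
  exact mul_ne_zero (pow_ne_zero _ hz) (mul_ne_zero hqz (mul_ne_zero hz hder)) h1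

end SimpleRoot

/-! ### Expansions in powers of one monic polynomial. -/

section Adic

variable {R : Type*} [CommRing R] [Nontrivial R]

lemma exists_adic_expansion {θ : R[X]} (hθ : θ.Monic) (n : ℕ) (G : R[X])
    (hG : G.degree < ((n * θ.natDegree : ℕ) : WithBot ℕ)) :
    ∃ g : ℕ → R[X], (∀ i, (g i).degree < (θ.natDegree : WithBot ℕ)) ∧
      G = ∑ i ∈ Finset.range n, g i * θ ^ i := by
  have hdeg : θ.degree = (θ.natDegree : WithBot ℕ) := Polynomial.degree_eq_natDegree hθ.ne_zero
  induction n generalizing G with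
  | zero =>
    refine ⟨fun _ => 0, fun _ => by simp, ?_⟩
    rw [zero_mul] at hG
    by_contra h0
    refine absurd hG (not_lt.2 (Polynomial.zero_le_degree_iff.2 fun h => h0 ?_))
    simpa using h
  | succ n ih =>
    have hq : (G /ₘ θ).degree < ((n * θ.natDegree : ℕ) : WithBot ℕ) := by
      by_cases h0 : G /ₘ θ = 0
      · rw [h0, Polynomial.degree_zero]; exact WithBot.bot_lt_coe _
      · have hle : θ.degree ≤ G.degree := by
          by_contra hlt
          exact h0 ((Polynomial.divByMonic_eq_zero_iff hθ).2 (not_le.1 hlt))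
        have h1 := Polynomial.degree_add_divByMonic hθ hle
        rw [← h1, hdeg, Polynomial.degree_eq_natDegree h0] at hG
        rw [Polynomial.degree_eq_natDegree h0]
        norm_cast at hG ⊢
        rw [add_mul, one_mul] at hG
        omega
    obtain ⟨g, hg, he⟩ := ih _ hq
    refine ⟨fun i => if i = 0 then G %ₘ θ else g (i - 1), fun i => ?_, ?_⟩
    · dsimp only
      split_ifs
      · rw [← hdeg]; exact Polynomial.degree_modByMonic_lt _ hθ
      · exact hg _
    · rw [Finset.sum_range_succ']
      simp only [Nat.add_sub_cancel, if_true, pow_zero, mul_one, Nat.succ_ne_zero, if_false]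
      conv_lhs => rw [← Polynomial.modByMonic_add_div G θ, he]
      rw [Finset.mul_sum, add_comm]
      congr 1
      refine Finset.sum_congr rfl fun i _ => ?_
      ring

/-- In a `θ`-adic expansion of a polynomial of degree `N deg θ`, the `θ`-degree is `N`, and the
leading coefficient is `1` if the polynomial is monic. -/
lemma adic_leading {θ G : R[X]} (hθ : θ.Monic) {N n : ℕ} (hd : 0 < θ.natDegree)
    (hG : G.Monic) (hGd : G.natDegree = N * θ.natDegree) {g : ℕ → R[X]}
    (hg : ∀ i, (g i).degree < (θ.natDegree : WithBot ℕ))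
    (he : G = ∑ i ∈ Finset.range n, g i * θ ^ i) :
    N < n ∧ (∀ i, N < i → i < n → g i = 0) ∧ g N = 1 := by
  have hdeg : ∀ i, (g i * θ ^ i).degree < (((i + 1) * θ.natDegree : ℕ) : WithBot ℕ) := by
    intro i
    refine lt_of_le_of_lt (Polynomial.degree_mul_le _ _) ?_
    rw [Polynomial.degree_eq_natDegree (hθ.pow i).ne_zero, hθ.natDegree_pow]
    rcases eq_or_ne (g i) 0 with h0 | h0
    · rw [h0, Polynomial.degree_zero, WithBot.bot_add]; exact WithBot.bot_lt_coe _
    · have := hg i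
      rw [Polynomial.degree_eq_natDegree h0] at this ⊢
      norm_cast at this ⊢
      rw [add_mul, one_mul]
      omega
  have hlow : ∀ m, (∑ i ∈ Finset.range m, g i * θ ^ i).degree <
      ((m * θ.natDegree : ℕ) : WithBot ℕ) := by
    intro m
    refine (Polynomial.degree_sum_le _ _).trans_lt ?_
    rw [Finset.sup_lt_iff (WithBot.bot_lt_coe _)]
    intro i hi
    refine (hdeg i).trans_le ?_
    exact_mod_cast Nat.mul_le_mul_right _ (Finset.mem_range.1 hi)
  -- The highest nonzero `g_j` determines the degree of the sum, so `j > N` would make the degree of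
  -- `G` too large.
  have hvan : ∀ m ≤ n, N < m → ∀ i, m ≤ i → i < n → g i = 0 := by
    intro m hm hN
    by_contra! hc
    obtain ⟨i, hmi, hin, hi0⟩ := hc
    obtain ⟨j, hj, hmax⟩ : ∃ j, (m ≤ j ∧ j < n ∧ g j ≠ 0) ∧
        ∀ i, m ≤ i → i < n → g i ≠ 0 → i ≤ j := by
      classical
      let s := (Finset.range n).filter fun i => m ≤ i ∧ g i ≠ 0
      have hs : s.Nonempty := ⟨i, by simp [s, hmi, hin, hi0]⟩
      refine ⟨s.max' hs, ?_, fun i h1 h2 h3 => s.le_max' i (by simp [s, h1, h2, h3])⟩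
      have := s.max'_mem hs
      simp only [s, Finset.mem_filter, Finset.mem_range] at this
      exact ⟨this.2.1, this.1, this.2.2⟩
    have hsum : G = ∑ i ∈ Finset.range j, g i * θ ^ i + g j * θ ^ j := by
      rw [he, ← Finset.sum_range_succ]
      symm
      refine Finset.sum_subset (Finset.range_mono hj.2.1) fun i hi hij => ?_
      rw [Finset.mem_range] at hi hij
      by_cases h0 : g i = 0
      · rw [h0, zero_mul]
      · exact absurd (hmax i (by omega) hi h0) (by omega)
    have h1 : (g j * θ ^ j).degree = (((g j).natDegree + j * θ.natDegree : ℕ) : WithBot ℕ) := by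
      rw [(hθ.pow j).degree_mul, Polynomial.degree_eq_natDegree (hθ.pow j).ne_zero,
        hθ.natDegree_pow, Polynomial.degree_eq_natDegree hj.2.2]
      norm_cast
    have h2 : G.degree = (((g j).natDegree + j * θ.natDegree : ℕ) : WithBot ℕ) := by
      rw [hsum, Polynomial.degree_add_eq_right_of_degree_lt, h1]
      rw [h1]
      refine (hlow j).trans_le ?_
      exact_mod_cast Nat.le_add_left _ _
    rw [Polynomial.degree_eq_natDegree hG.ne_zero, hGd] at h2
    have h3 : N * θ.natDegree = (g j).natDegree + j * θ.natDegree := by exact_mod_cast h2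
    have h4 : (N + 1) * θ.natDegree ≤ j * θ.natDegree := Nat.mul_le_mul_right _ (by omega)
    rw [add_mul] at h4
    omega
  have hNn : N < n := by
    by_contra hle
    have h1 := hlow n
    rw [← he, Polynomial.degree_eq_natDegree hG.ne_zero, hGd] at h1
    have h2 : N * θ.natDegree < n * θ.natDegree := by exact_mod_cast h1
    exact hle (lt_of_mul_lt_mul_right h2 (Nat.zero_le _))
  refine ⟨hNn, fun i h1 h2 => hvan (N + 1) hNn (Nat.lt_succ_self N) i h1 h2, ?_⟩
  have hsum : G = ∑ i ∈ Finset.range N, g i * θ ^ i + g N * θ ^ N := by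
    rw [he, ← Finset.sum_range_succ]
    symm
    refine Finset.sum_subset (Finset.range_mono hNn) fun i hi hij => ?_
    rw [Finset.mem_range] at hi hij
    rw [hvan (N + 1) hNn (Nat.lt_succ_self N) i (by omega) hi, zero_mul]
  have h0 : g N ≠ 0 := by
    intro h0
    have h1 := hlow N
    rw [h0, zero_mul, add_zero] at hsum
    rw [← hsum, Polynomial.degree_eq_natDegree hG.ne_zero, hGd] at h1
    exact lt_irrefl _ h1
  have h1 : (g N * θ ^ N).degree = (((g N).natDegree + N * θ.natDegree : ℕ) : WithBot ℕ) := by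
    rw [(hθ.pow N).degree_mul, Polynomial.degree_eq_natDegree (hθ.pow N).ne_zero,
      hθ.natDegree_pow, Polynomial.degree_eq_natDegree h0]
    norm_cast
  have hlt : (∑ i ∈ Finset.range N, g i * θ ^ i).degree < (g N * θ ^ N).degree := by
    rw [h1]
    refine (hlow N).trans_le ?_
    exact_mod_cast Nat.le_add_left _ _
  have h2 : G.degree = (((g N).natDegree + N * θ.natDegree : ℕ) : WithBot ℕ) := by
    rw [hsum, Polynomial.degree_add_eq_right_of_degree_lt hlt, h1]
  rw [Polynomial.degree_eq_natDegree hG.ne_zero, hGd] at h2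
  have h3 : N * θ.natDegree = (g N).natDegree + N * θ.natDegree := by exact_mod_cast h2
  have h4 : (g N).natDegree = 0 := by omega
  have h5 : (g N).leadingCoeff = 1 := by
    have h6 := hG.leadingCoeff
    rwa [hsum, Polynomial.leadingCoeff_add_of_degree_lt hlt,
      Polynomial.leadingCoeff_mul_monic (hθ.pow N)] at h6
  rw [Polynomial.leadingCoeff, h4] at h5
  rw [Polynomial.eq_C_of_natDegree_eq_zero h4, h5, Polynomial.C_1]

end Adic

/-! ### Expansions along several monic polynomials. -/

section Expansions

variable {K : Type u} [Field K]

/-- An expansion of `G` along `(x, θ_0, …, θ_k)` with `θ_k`-degree less than `n`. -/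
def HasExpansion (F : K⟦X⟧[X]) (k : ℕ) (θ : ℕ → K⟦X⟧[X]) (n : ℕ) (G : K⟦X⟧[X]) : Prop :=
  ∃ a : (Fin (k + 1) → ℕ) →₀ K⟦X⟧,
    (∀ b ∈ a.support, Admissible F k b ∧ b (Fin.last k) < n) ∧
    G = a.sum fun b c => Polynomial.C c * ∏ i : Fin (k + 1), θ i ^ b i

variable {F : K⟦X⟧[X]} {k n : ℕ} {θ : ℕ → K⟦X⟧[X]}

lemma HasExpansion.zero : HasExpansion F k θ n 0 := ⟨0, by simp, by simp⟩

lemma HasExpansion.add {G₁ G₂ : K⟦X⟧[X]} (h₁ : HasExpansion F k θ n G₁)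
    (h₂ : HasExpansion F k θ n G₂) : HasExpansion F k θ n (G₁ + G₂) := by
  classical
  obtain ⟨a, ha, rfl⟩ := h₁
  obtain ⟨a', ha', rfl⟩ := h₂
  refine ⟨a + a', fun b hb => ?_, ?_⟩
  · rcases Finset.mem_union.1 (Finsupp.support_add hb) with h | h
    exacts [ha b h, ha' b h]
  · rw [Finsupp.sum_add_index']
    · intro b; simp
    · intro b c c'; rw [Polynomial.C_add, add_mul]

lemma HasExpansion.sum {ι : Type*} (s : Finset ι) {G : ι → K⟦X⟧[X]}
    (h : ∀ i ∈ s, HasExpansion F k θ n (G i)) : HasExpansion F k θ n (∑ i ∈ s, G i) :=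
  Finset.sum_induction _ _ (fun _ _ => HasExpansion.add) HasExpansion.zero h

lemma HasExpansion.single (b : Fin (k + 1) → ℕ) (c : K⟦X⟧) (hb : Admissible F k b)
    (hn : b (Fin.last k) < n) :
    HasExpansion F k θ n (Polynomial.C c * ∏ i : Fin (k + 1), θ i ^ b i) := by
  classical
  refine ⟨Finsupp.single b c, fun b' hb' => ?_, ?_⟩
  · have := Finsupp.support_single_subset hb'
    rw [Finset.mem_singleton] at this
    exact this ▸ ⟨hb, hn⟩
  · rw [Finsupp.sum_single_index]
    simp

/-- Expand in powers of `θ_k`, then expand the coefficients recursively. These have degree less than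
`d_k = q_k ℓ_k d_{k-1}`, and this bound on the degree is the admissibility bound on the exponent of
`θ_{k-1}`. -/
lemma exists_hasExpansion (hθ : ∀ i ≤ k, (θ i).Monic ∧ (θ i).natDegree = dk F i)
    (hpos : ∀ i ≤ k, 0 < dk F i) (hdk : ∀ i < k, dk F (i + 1) = ql F (i + 1) * dk F i)
    (n : ℕ) (G : K⟦X⟧[X]) (hG : G.degree < ((n * dk F k : ℕ) : WithBot ℕ)) :
    HasExpansion F k θ n G := by
  induction k generalizing n G with
  | zero =>
    obtain ⟨h1, h2⟩ := hθ 0 le_rfl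
    obtain ⟨g, hg, rfl⟩ := exists_adic_expansion h1 n G (h2 ▸ hG)
    refine HasExpansion.sum _ fun i hi => ?_
    have hdk0 : dk F 0 = 1 := by simp [dk]
    have h3 := hg i
    rw [h2, hdk0] at h3
    have h4 : g i = Polynomial.C ((g i).coeff 0) := by
      refine Polynomial.eq_C_of_degree_le_zero (Nat.WithBot.lt_one_iff_le_zero.1 ?_)
      simpa using h3
    rw [h4]
    have := HasExpansion.single (F := F) (k := 0) (θ := θ) (n := n) (fun _ => i) ((g i).coeff 0)
      (fun j hj => absurd hj (Nat.not_lt_zero _)) (Finset.mem_range.1 hi)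
    simpa using this
  | succ k ih =>
    obtain ⟨h1, h2⟩ := hθ (k + 1) le_rfl
    obtain ⟨g, hg, rfl⟩ := exists_adic_expansion h1 n G (h2 ▸ hG)
    refine HasExpansion.sum _ fun i hi => ?_
    have h3 := hg i
    rw [h2, hdk k (Nat.lt_succ_self k)] at h3
    obtain ⟨a, ha, he⟩ := ih (fun i hi => hθ i (by omega)) (fun i hi => hpos i (by omega))
      (fun i hi => hdk i (by omega)) _ _ h3
    rw [he, Finsupp.sum, Finset.sum_mul]
    refine HasExpansion.sum _ fun b hb => ?_
    have := HasExpansion.single (F := F) (k := k + 1) (θ := θ) (n := n)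
      (Fin.snoc (α := fun _ => ℕ) b i) (a b)
      (fun j hj => ?_) (by simpa using hi)
    · rw [Fin.prod_univ_castSucc] at this
      simpa [mul_assoc] using this
    · refine Fin.lastCases (fun hj => ?_) (fun j hj => ?_) j hj
      · exact absurd hj (lt_irrefl _)
      · rw [Fin.snoc_castSucc]
        rcases Nat.lt_succ_iff_lt_or_eq.1 j.2 with h | h
        · exact (ha b hb).1 j h
        · have h5 := (ha b hb).2
          have : j = Fin.last k := Fin.ext h
          rw [this]
          simpa using h5

end Expansions

/-! ### Leading terms of pull-backs of polynomials of small degree. -/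

section Frame

variable {K L : Type u} [Field K] [Field L]

/-- How a pull-back `K[[x]][y] → L[[x]][y]` acts on `K[[x]]`. -/
structure IsFrame (ε : K →+* L) (pull : K⟦X⟧[X] →+* L⟦X⟧[X]) (f : K⟦X⟧ →+* L⟦X⟧) (e : ℕ) (μ : L) :
    Prop where
  pull_C : ∀ a, pull (Polynomial.C a) = Polynomial.C (f a)
  f_C : ∀ c, f (PowerSeries.C c) = PowerSeries.C (ε c)
  f_X : f PowerSeries.X = PowerSeries.C μ * PowerSeries.X ^ e
  e_pos : 0 < e
  μ_ne : μ ≠ 0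

variable {ε : K →+* L} {pull : K⟦X⟧[X] →+* L⟦X⟧[X]} {f : K⟦X⟧ →+* L⟦X⟧} {e : ℕ} {μ : L}

lemma IsFrame.isMono_X (h : IsFrame ε pull f e μ) (b : ℕ) :
    IsMono b (pull (Polynomial.C PowerSeries.X)) e μ := by
  refine ⟨Polynomial.C (PowerSeries.C μ), ?_, by simp [redAt]⟩
  rw [h.pull_C, h.f_X, ← Polynomial.C_pow, ← Polynomial.C_mul, mul_comm]

lemma IsFrame.constantCoeff_f (h : IsFrame ε pull f e μ) (a : K⟦X⟧) :
    PowerSeries.constantCoeff (f a) = ε (PowerSeries.constantCoeff a) := by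
  have : PowerSeries.X ∣ a - PowerSeries.C (PowerSeries.constantCoeff a) := by
    rw [PowerSeries.X_dvd_iff]; simp
  obtain ⟨a', ha'⟩ := this
  rw [sub_eq_iff_eq_add] at ha'
  conv_lhs => rw [ha']
  simp [h.f_C, h.f_X, h.e_pos.ne']

lemma IsFrame.isMono_C (h : IsFrame ε pull f e μ) (b : ℕ) {n : ℕ} {a : K⟦X⟧}
    (ha : PowerSeries.X ^ n ∣ a) :
    IsMono b (pull (Polynomial.C a)) (n * e) (ε (PowerSeries.coeff n a) * μ ^ n) := by
  obtain ⟨a', rfl⟩ := ha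
  have h1 : IsMono b (pull (Polynomial.C a')) 0 (ε (PowerSeries.constantCoeff a')) := by
    have := Lead.of_map (t := Polynomial.C (PowerSeries.X : L⟦X⟧)) (ρ := redAt b)
      (pull (Polynomial.C a'))
    rw [h.pull_C, redAt_C, h.constantCoeff_f] at this
    rwa [h.pull_C]
  have h2 := ((h.isMono_X b).pow n).mul h1
  rw [← map_pow, ← map_mul, ← Polynomial.C_pow, ← Polynomial.C_mul, add_zero, mul_comm (μ ^ n)] at h2
  have h3 : PowerSeries.coeff n (PowerSeries.X ^ n * a') = PowerSeries.constantCoeff a' := by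
    simpa using PowerSeries.coeff_X_pow_mul a' n 0
  rwa [h3]

variable {b k : ℕ} {θ : ℕ → K⟦X⟧[X]} {V : ℕ → ℕ} {Λ : ℕ → L} {N : ℕ → ℕ}

/-- The weight of `x^n ∏ θ_i^{b_i}`. -/
def weight (e : ℕ) (V : ℕ → ℕ) {k : ℕ} (B : ℕ × (Fin k → ℕ)) : ℕ :=
  e * B.1 + ∑ i : Fin k, B.2 i * V i

/-- The exponents of weight `w`. -/
def level (e : ℕ) (V : ℕ → ℕ) {k : ℕ} (T : Finset (Fin k → ℕ)) (w : ℕ) :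
    Finset (ℕ × (Fin k → ℕ)) :=
  (Finset.range (w + 1) ×ˢ T).filter fun B => weight e V B = w

lemma mem_level (he : 0 < e) {T : Finset (Fin k → ℕ)} {w : ℕ} {B : ℕ × (Fin k → ℕ)} :
    B ∈ level e V T w ↔ B.2 ∈ T ∧ weight e V B = w := by
  simp only [level, Finset.mem_filter, Finset.mem_product, Finset.mem_range]
  constructor
  · rintro ⟨⟨_, h⟩, h'⟩; exact ⟨h, h'⟩
  · rintro ⟨h, h'⟩
    refine ⟨⟨?_, h⟩, h'⟩
    have : B.1 ≤ e * B.1 := Nat.le_mul_of_pos_left _ he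
    unfold weight at h'
    omega

/-- For fixed `β` the weight is strictly increasing in the power of `x`, so only the lowest term of
`a` matters. At most one summand has weight `w`; the sum form serves to combine different `β` in
`IsFrame.isMono_sum`. -/
lemma IsFrame.isMono_term (h : IsFrame ε pull f e μ)
    (hθ : ∀ i < k, IsMono b (pull (θ i)) (V i) (Λ i)) (a : K⟦X⟧) (β : Fin k → ℕ) {w : ℕ}
    (hw : ∀ n, PowerSeries.coeff n a ≠ 0 → w ≤ weight e V (n, β)) :
    IsMono b (pull (Polynomial.C a * ∏ i : Fin k, θ i ^ β i)) w
      (∑ n ∈ Finset.range (w + 1), if weight e V (n, β) = w then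
        ε (PowerSeries.coeff n a) * (μ ^ n * ∏ i : Fin k, Λ i ^ β i) else 0) := by
  by_cases ha : a = 0
  · subst ha
    simpa using IsMono.zero w
  set n₀ := a.order.toNat with hn₀
  have hc : PowerSeries.coeff n₀ a ≠ 0 := PowerSeries.coeff_order ha
  have hlt : ∀ n < n₀, PowerSeries.coeff n a = 0 := fun n hn =>
    PowerSeries.coeff_of_lt_order_toNat n hn
  have h1 := (h.isMono_C b (PowerSeries.X_pow_dvd_iff.2 hlt)).mul
    (IsMono.prod Finset.univ fun (i : Fin k) _ => (hθ i i.2).pow (β i))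
  rw [← Finset.prod_congr rfl fun i _ => map_pow pull _ _, ← map_prod, ← map_mul, mul_assoc,
    mul_comm n₀] at h1
  have h2 := h1.mono_ite (hw n₀ hc)
  convert h2 using 1
  split_ifs with heq
  · rw [Finset.sum_eq_single_of_mem n₀]
    · exact if_pos heq
    · rw [Finset.mem_range]
      have := Nat.le_mul_of_pos_left n₀ h.e_pos
      omega
    · intro n _ hne
      rw [if_neg]
      intro hn
      apply hne
      have : e * n = e * n₀ := by
        unfold weight at hn
        simp only at hn
        omega
      exact Nat.eq_of_mul_eq_mul_left h.e_pos this
  · refine Finset.sum_eq_zero fun n _ => ?_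
    split_ifs with hn
    · by_cases hn0 : PowerSeries.coeff n a = 0
      · simp [hn0]
      · exfalso
        have h3 : n₀ < n ∨ n = n₀ ∨ n < n₀ := by omega
        rcases h3 with h3 | h3 | h3
        · have h4 := hw n₀ hc
          have h5 : e * n₀ < e * n := Nat.mul_lt_mul_of_pos_left h3 h.e_pos
          unfold weight at h4 hn
          simp only at h4 hn
          omega
        · subst h3; exact heq hn
        · exact hn0 (hlt n h3)
    · rfl

/-- The leading term of `∑ a_β ∏ θ_i^{β_i}`. -/
lemma IsFrame.isMono_sum (h : IsFrame ε pull f e μ)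
    (hθ : ∀ i < k, IsMono b (pull (θ i)) (V i) (Λ i)) (hI : IndepMonomials ε e μ k V Λ N)
    (T : Finset (Fin k → ℕ)) (hT : ∀ β ∈ T, ∀ i, β i < N i) (a : (Fin k → ℕ) → K⟦X⟧)
    (hne : ∃ β ∈ T, a β ≠ 0) :
    ∃ w, (∀ B : ℕ × (Fin k → ℕ), B.2 ∈ T → PowerSeries.coeff B.1 (a B.2) ≠ 0 → w ≤ weight e V B) ∧
      (∃ B : ℕ × (Fin k → ℕ), B.2 ∈ T ∧ PowerSeries.coeff B.1 (a B.2) ≠ 0 ∧ weight e V B = w) ∧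
      (∑ B ∈ level e V T w, ε (PowerSeries.coeff B.1 (a B.2)) *
        (μ ^ B.1 * ∏ i : Fin k, Λ i ^ B.2 i)) ≠ 0 ∧
      IsMono b (pull (∑ β ∈ T, Polynomial.C (a β) * ∏ i : Fin k, θ i ^ β i)) w
        (∑ B ∈ level e V T w, ε (PowerSeries.coeff B.1 (a B.2)) *
          (μ ^ B.1 * ∏ i : Fin k, Λ i ^ B.2 i)) := by
  classical
  let Q : ℕ → Prop := fun w => ∃ B : ℕ × (Fin k → ℕ), B.2 ∈ T ∧
    PowerSeries.coeff B.1 (a B.2) ≠ 0 ∧ weight e V B = w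
  have hQ : ∃ w, Q w := by
    obtain ⟨β, hβ, h0⟩ := hne
    exact ⟨_, ((a β).order.toNat, β), hβ, PowerSeries.coeff_order h0, rfl⟩
  set w := Nat.find hQ
  have hmin : ∀ B : ℕ × (Fin k → ℕ), B.2 ∈ T → PowerSeries.coeff B.1 (a B.2) ≠ 0 →
      w ≤ weight e V B := fun B h1 h2 => Nat.find_min' hQ ⟨B, h1, h2, rfl⟩
  obtain ⟨B₀, hB₀, hB₀', hw₀⟩ : Q w := Nat.find_spec hQ
  refine ⟨w, hmin, ⟨B₀, hB₀, hB₀', hw₀⟩, fun h0 => ?_, ?_⟩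
  -- By independence the coefficient in minimal weight vanishes only if all its terms do, whereas
  -- `B₀` contributes a nonzero one.
  · refine hB₀' (hI w (level e V T w) (fun B => PowerSeries.coeff B.1 (a B.2)) ?_ h0 B₀
      ((mem_level h.e_pos).2 ⟨hB₀, hw₀⟩))
    intro B hB
    obtain ⟨h1, h2⟩ := (mem_level h.e_pos).1 hB
    exact ⟨hT _ h1, h2⟩
  · have h1 : ∀ β ∈ T, IsMono b (pull (Polynomial.C (a β) * ∏ i : Fin k, θ i ^ β i)) w _ :=
      fun β hβ => h.isMono_term hθ (a β) β fun n hn => hmin (n, β) hβ hn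
    have h2 := IsMono.sum_ite (w := w) T h1 fun _ _ => le_rfl
    rw [← map_sum] at h2
    convert h2 using 1
    rw [level, Finset.sum_filter, Finset.sum_product_right]
    simp

/-- A nonzero polynomial of degree less than `d_k` has a leading monomial. -/
lemma IsFrame.exists_isMono {F : K⟦X⟧[X]} (h : IsFrame ε pull f e μ)
    (hθ : ∀ i < k, IsMono b (pull (θ i)) (V i) (Λ i))
    (hI : IndepMonomials ε e μ k V Λ fun i => ql F (i + 1))
    (hm : ∀ i < k, (θ i).Monic ∧ (θ i).natDegree = dk F i)
    (hpos : ∀ i < k, 0 < dk F i) (hdk : ∀ i < k, dk F (i + 1) = ql F (i + 1) * dk F i)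
    {G : K⟦X⟧[X]} (hG : G ≠ 0) (hGd : G.degree < (dk F k : WithBot ℕ)) :
    ∃ w c, c ≠ 0 ∧ IsMono b (pull G) w c := by
  obtain ⟨T, a, hT, rfl⟩ : ∃ (T : Finset (Fin k → ℕ)) (a : (Fin k → ℕ) → K⟦X⟧),
      (∀ β ∈ T, ∀ i : Fin k, β i < ql F (i + 1)) ∧
      G = ∑ β ∈ T, Polynomial.C (a β) * ∏ i : Fin k, θ i ^ β i := by
    -- With no `θ` available the polynomial is constant in `y`. Otherwise the degree bound `d_{k+1}
    -- = q_{k+1} ℓ_{k+1} d_k` also bounds the exponent of the last `θ`.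
    rcases k with _ | k
    · have hdk0 : dk F 0 = 1 := by simp [dk]
      refine ⟨Finset.univ, fun _ => G.coeff 0, fun _ _ i => i.elim0, ?_⟩
      rw [hdk0] at hGd
      have : G = Polynomial.C (G.coeff 0) := by
        refine Polynomial.eq_C_of_degree_le_zero (Nat.WithBot.lt_one_iff_le_zero.1 ?_)
        simpa using hGd
      conv_lhs => rw [this]
      simp
    · obtain ⟨a, ha, he⟩ := exists_hasExpansion (k := k) (fun i hi => hm i (by omega))
        (fun i hi => hpos i (by omega)) (fun i hi => hdk i (by omega)) (ql F (k + 1)) G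
        (by rwa [← hdk k (by omega)])
      refine ⟨a.support, a, fun β hβ i => ?_, he⟩
      rcases Nat.lt_succ_iff_lt_or_eq.1 i.2 with h' | h'
      · exact (ha β hβ).1 i h'
      · have h5 := (ha β hβ).2
        have h6 : i = Fin.last k := Fin.ext h'
        rw [h6]
        simpa using h5
  obtain ⟨w, -, -, h1, h2⟩ := h.isMono_sum hθ hI T hT a (by
    by_contra! h0
    exact hG (Finset.sum_eq_zero fun β hβ => by rw [h0 β hβ]; simp))
  exact ⟨w, _, h1, h2⟩

end Frame

/-! ### Comparison of leading forms. -/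

section Compare

variable {L : Type u} [Field L]

lemma coeff_wt_top {H : L⟦X⟧[X]} (hH : H.Monic) {N : ℕ} (hN : H.natDegree = N) {α β : ℕ}
    (hα : 0 < α) (u : L) : (PowerSeries.coeff (β * N) (wt u α β hα H)).coeff N = 1 := by
  have := coeff_wt_add u (β := β) hα N 0 H
  rw [mul_zero, zero_add] at this
  rw [this, ← hN, Polynomial.coeff_natDegree, hH.leadingCoeff]
  simp

/-- Comparison of the leading terms of the two sides of `x^{v_F} H U = ∑ g_i D^i`. -/
lemma leading_terms_eq {b α β : ℕ} (hα : 0 < α) (hb : b ≤ β) {H U D : L⟦X⟧[X]} {vF N v : ℕ}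
    {cU c : L} (hH : H.Monic) (hHN : H.natDegree = N)
    (hHl : ∀ i j, α * j + β * i < β * N → PowerSeries.coeff j (H.coeff i) = 0)
    (hU : IsMono b U 0 cU) (hcU : cU ≠ 0) (hD : YLike b α β D v c) (hc : c ≠ 0)
    {g : ℕ → L⟦X⟧[X]} {vi : ℕ → ℕ} {ci : ℕ → L}
    (hg : ∀ i ≤ N, IsMono b (g i) (vi i) (ci i)) (hg0 : ∀ i ≤ N, ci i = 0 → g i = 0)
    (hvN : vi N = 0) (hcN : ci N = 1)
    (hsum : Polynomial.C PowerSeries.X ^ vF * H * U = ∑ i ∈ Finset.range (N + 1), g i * D ^ i) :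
    vF = N * v ∧ cU = c ^ N ∧
    (∀ i ≤ N, ci i ≠ 0 → α * vF + β * N ≤ α * (vi i + i * v) + β * i) ∧
    ∀ i ≤ N, (ci i ≠ 0 ∧ α * (vi i + i * v) + β * i = α * vF + β * N →
        (PowerSeries.coeff (β * N) (wt 1 α β hα H)).coeff i * c ^ N = ci i * c ^ i) ∧
      (¬ (ci i ≠ 0 ∧ α * (vi i + i * v) + β * i = α * vF + β * N) →
        (PowerSeries.coeff (β * N) (wt 1 α β hα H)).coeff i = 0) := by
  classical
  set h := PowerSeries.coeff (β * N) (wt 1 α β hα H) with hh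
  have hhN : h.coeff N = 1 := coeff_wt_top hH hHN hα 1
  have hleft : LeadS (wt 1 α β hα (Polynomial.C PowerSeries.X ^ vF * H * U)) (α * vF + β * N)
      (h * Polynomial.C cU) := by
    have h1 : LeadS (wt (1 : L) α β hα (Polynomial.C PowerSeries.X ^ vF)) (α * vF) 1 := by
      refine ⟨1, ?_, map_one _⟩
      rw [map_pow, wt_CX]
      simp [pow_mul]
    have h2 := (h1.mul (leadS_wt_of_coeff (u := 1) hα hHl)).mul (hU.wt hα hb 1)
    rw [← map_mul, ← map_mul] at h2
    simpa using h2
  set W : ℕ → ℕ := fun i => α * (vi i + i * v) + β * i with hW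
  have hterm : ∀ i ≤ N, LeadS (wt 1 α β hα (g i * D ^ i)) (W i)
      (Polynomial.monomial i (ci i * c ^ i)) := by
    intro i hi
    have h1 := ((hg i hi).wt hα hb 1).mul ((hD.wt hα hb 1).pow i)
    rw [← map_pow, ← map_mul] at h1
    have e1 : α * vi i + i * (α * v + β) = W i := by simp only [hW]; ring
    rw [e1] at h1
    convert h1 using 1
    rw [one_pow, one_pow, mul_one, mul_one, mul_pow, ← Polynomial.C_pow, ← mul_assoc,
      ← Polynomial.C_mul, Polynomial.C_mul_X_pow_eq_monomial]
  set J := (Finset.range (N + 1)).filter fun i => ci i ≠ 0 with hJ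
  have hmemJ : ∀ i, i ∈ J ↔ i ≤ N ∧ ci i ≠ 0 := by
    intro i
    rw [hJ, Finset.mem_filter, Finset.mem_range, Nat.lt_succ_iff]
  have hNJ : N ∈ J := (hmemJ N).2 ⟨le_rfl, by rw [hcN]; exact one_ne_zero⟩
  obtain ⟨i₀, hi₀, hmin⟩ := Finset.exists_min_image J W ⟨N, hNJ⟩
  have hright : LeadS (wt 1 α β hα (∑ i ∈ Finset.range (N + 1), g i * D ^ i)) (W i₀)
      (∑ i ∈ J, if W i = W i₀ then Polynomial.monomial i (ci i * c ^ i) else 0) := by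
    -- A vanishing `c_i` means that `g_i = 0`, so the minimum over `J` is the true minimal weight.
    have h1 : ∑ i ∈ Finset.range (N + 1), g i * D ^ i = ∑ i ∈ J, g i * D ^ i := by
      rw [hJ, Finset.sum_filter_of_ne]
      intro i hi hne h0
      exact hne (by rw [hg0 i (Nat.lt_succ_iff.1 (Finset.mem_range.1 hi)) h0, zero_mul])
    rw [h1, map_sum]
    exact Lead.sum_ite (by simp) J (fun i hi => hterm i ((hmemJ i).1 hi).1) hmin
  have hcoeff : ∀ j, (∑ i ∈ J, if W i = W i₀ then Polynomial.monomial i (ci i * c ^ i)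
      else 0).coeff j = if j ∈ J ∧ W j = W i₀ then ci j * c ^ j else 0 := by
    intro j
    rw [Polynomial.finsetSum_coeff]
    have : ∀ i ∈ J, (if W i = W i₀ then Polynomial.monomial i (ci i * c ^ i) else 0).coeff j =
        if i = j then (if W j = W i₀ then ci j * c ^ j else 0) else 0 := by
      intro i _
      by_cases hij : i = j
      · subst hij
        rw [if_pos rfl]
        split_ifs <;> simp
      · split_ifs <;> simp [Polynomial.coeff_monomial, hij]
    rw [Finset.sum_congr rfl this, Finset.sum_ite_eq', ite_and]
  have hne1 : h * Polynomial.C cU ≠ 0 := by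
    refine mul_ne_zero (fun h0 => ?_) (Polynomial.C_ne_zero.2 hcU)
    rw [h0] at hhN
    simp at hhN
  have hne2 : (∑ i ∈ J, if W i = W i₀ then Polynomial.monomial i (ci i * c ^ i) else 0) ≠ 0 := by
    intro h0
    have h1 := hcoeff i₀
    rw [h0, Polynomial.coeff_zero, if_pos ⟨hi₀, rfl⟩] at h1
    exact mul_ne_zero ((hmemJ i₀).1 hi₀).2 (pow_ne_zero _ hc) h1.symm
  rw [← hsum] at hright
  obtain ⟨e1, e2⟩ := hleft.unique hright hne1 hne2
  have hco : ∀ j, h.coeff j * cU = if j ∈ J ∧ W j = W i₀ then ci j * c ^ j else 0 := by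
    intro j
    rw [← hcoeff j, ← e2, Polynomial.coeff_mul_C]
  -- On the left `y^N` has the nonzero coefficient `cU`, so the summand `i = N` attains the minimal
  -- weight. As `g_N` has leading term 1, this yields both `vF = N v` and `cU = c^N`.
  have hN' := hco N
  rw [hhN, one_mul, hcN, one_mul] at hN'
  have hNW : W N = W i₀ := by
    by_contra hne
    rw [if_neg (fun h => hne h.2)] at hN'
    exact hcU hN'
  rw [if_pos ⟨hNJ, hNW⟩] at hN'
  refine ⟨?_, hN', fun i hi hci => ?_, fun i hi => ⟨fun hi' => ?_, fun hi' => ?_⟩⟩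
  · rw [← hNW] at e1
    simp only [hW, hvN, zero_add] at e1
    exact Nat.eq_of_mul_eq_mul_left hα (by omega)
  · rw [e1]
    exact hmin i ((hmemJ i).2 ⟨hi, hci⟩)
  · rw [← hN', hco i, if_pos ⟨(hmemJ i).2 ⟨hi, hi'.1⟩, by rw [← e1]; exact hi'.2⟩]
  · have := hco i
    rw [if_neg, mul_eq_zero] at this
    · exact this.resolve_right hcU
    · rintro ⟨h1, h2⟩
      exact hi' ⟨((hmemJ i).1 h1).2, by rw [e1]; exact h2⟩

end Compare

/-! ### Approximate roots by Tschirnhausen transformations. -/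

section Tschirnhausen

variable {R : Type*} [CommRing R]

lemma degree_mul_lt_of_lt_of_le {p q : R[X]} {a b : ℕ} (hp : p.degree < (a : WithBot ℕ))
    (hq : q.degree ≤ (b : WithBot ℕ)) : (p * q).degree < ((a + b : ℕ) : WithBot ℕ) := by
  by_cases h0 : p = 0
  · rw [h0, zero_mul, Polynomial.degree_zero]; exact WithBot.bot_lt_coe _
  by_cases h1 : q = 0
  · rw [h1, mul_zero, Polynomial.degree_zero]; exact WithBot.bot_lt_coe _
  refine (Polynomial.degree_mul_le _ _).trans_lt ?_
  rw [Polynomial.degree_eq_natDegree h0] at hp ⊢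
  rw [Polynomial.degree_eq_natDegree h1] at hq ⊢
  norm_cast at *
  omega

/-- What remains is at least quadratic in `δ`, and replacing a `θ` by a `δ` lowers the degree bound
by `d - e > 0`. -/
lemma degree_binomial_lt {θ δ : R[X]} {d e : ℕ} (hθ : θ.degree ≤ (d : WithBot ℕ))
    (hδ : δ.degree ≤ (e : WithBot ℕ)) (hed : e < d) (n : ℕ) :
    ((θ + δ) ^ (n + 1) - θ ^ (n + 1) - (n + 1 : R[X]) * (θ ^ n * δ)).degree <
      ((n * d + e : ℕ) : WithBot ℕ) := by
  induction n with
  | zero =>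
    have : (θ + δ) ^ (0 + 1) - θ ^ (0 + 1) - ((0 : ℕ) + 1 : R[X]) * (θ ^ 0 * δ) = 0 := by
      push_cast; ring
    rw [this, Polynomial.degree_zero]; exact WithBot.bot_lt_coe _
  | succ n ih =>
    set E := (θ + δ) ^ (n + 1) - θ ^ (n + 1) - (n + 1 : R[X]) * (θ ^ n * δ) with hE
    have : (θ + δ) ^ (n + 1 + 1) - θ ^ (n + 1 + 1) -
        ((n + 1 : ℕ) + 1 : R[X]) * (θ ^ (n + 1) * δ) =
        E * (θ + δ) + ((n + 1 : ℕ) : R[X]) * (θ ^ n * δ ^ 2) := by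
      rw [hE]; push_cast; ring
    rw [this]
    refine (Polynomial.degree_add_le _ _).trans_lt (max_lt ?_ ?_)
    · have h1 : (θ + δ).degree ≤ (d : WithBot ℕ) :=
        (Polynomial.degree_add_le _ _).trans (max_le hθ (hδ.trans (by exact_mod_cast hed.le)))
      have := degree_mul_lt_of_lt_of_le ih h1
      convert this using 2
      ring
    · have h1 : (((n + 1 : ℕ) : R[X]) * (θ ^ n * δ ^ 2)).degree ≤
          ((0 + (n * d + 2 * e) : ℕ) : WithBot ℕ) := by
        push_cast
        refine Polynomial.degree_mul_le_of_le ?_ (Polynomial.degree_mul_le_of_le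
          (Polynomial.degree_pow_le_of_le _ hθ) (Polynomial.degree_pow_le_of_le _ hδ))
        exact_mod_cast Polynomial.degree_natCast_le (R := R) (n + 1)
      refine h1.trans_lt ?_
      norm_cast
      nlinarith

variable {K L : Type u} [Field K] [Field L]

/-- The approximate root is obtained from a polynomial `φ` with leading term `c x^v y` by
successive Tschirnhausen transformations, which do not change the leading term. -/
lemma exists_approxRoot_yLike {pull : K⟦X⟧[X] →+* L⟦X⟧[X]} {b α β n d vF v : ℕ} (hα : 0 < α)
    (hb : b ≤ β) {F φ : K⟦X⟧[X]} (hF : F.Monic) (hd : 0 < d) (hFd : F.natDegree = (n + 1) * d)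
    (hn : ((n + 1 : ℕ) : K) ≠ 0) {c cU : L} {H U : L⟦X⟧[X]}
    (hsmall : ∀ G : K⟦X⟧[X], G ≠ 0 → G.degree < (d : WithBot ℕ) →
      ∃ w c', c' ≠ 0 ∧ IsMono b (pull G) w c')
    (hpF : pull F = Polynomial.C PowerSeries.X ^ vF * H * U) (hU : IsMono b U 0 cU)
    (hcU : cU ≠ 0) (hH : H.Monic) (hHd : H.natDegree = n + 1) (hHc : H.coeff n = 0)
    (hHl : ∀ i j, α * j + β * i < β * (n + 1) → PowerSeries.coeff j (H.coeff i) = 0)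
    (hc : c ≠ 0) (hφ : φ.Monic) (hφd : φ.natDegree = d) (hφY : YLike b α β (pull φ) v c) :
    ∃ ψ : K⟦X⟧[X], ψ.Monic ∧ ψ.natDegree = d ∧ YLike b α β (pull ψ) v c ∧
      (F - ψ ^ (n + 1)).degree < ((n * d : ℕ) : WithBot ℕ) := by
  -- `r` measures the excess of the degree of `F - θ^(n+1)` over the goal. It starts at `d + 1`,
  -- since both terms have degree `(n+1)d`, and each transformation lowers it.
  suffices key : ∀ (r : ℕ) (θ : K⟦X⟧[X]), θ.Monic → θ.natDegree = d → YLike b α β (pull θ) v c →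
      (F - θ ^ (n + 1)).degree < ((n * d + r : ℕ) : WithBot ℕ) →
      ∃ ψ : K⟦X⟧[X], ψ.Monic ∧ ψ.natDegree = d ∧ YLike b α β (pull ψ) v c ∧
      (F - ψ ^ (n + 1)).degree < ((n * d : ℕ) : WithBot ℕ) by
    refine key (d + 1) φ hφ hφd hφY ?_
    refine (Polynomial.degree_sub_le _ _).trans_lt (max_lt ?_ ?_)
    · rw [Polynomial.degree_eq_natDegree hF.ne_zero, hFd]
      norm_cast
      nlinarith
    · rw [Polynomial.degree_eq_natDegree (hφ.pow _).ne_zero, hφ.natDegree_pow, hφd]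
      norm_cast
      nlinarith
  intro r
  induction r with
  | zero => exact fun θ h1 h2 h3 h4 => ⟨θ, h1, h2, h3, h4⟩
  | succ r ih =>
    intro θ hθ hθd hθY hdeg
    have hθdeg : θ.degree = (d : WithBot ℕ) := by
      rw [Polynomial.degree_eq_natDegree hθ.ne_zero, hθd]
    obtain ⟨g, hg, hsum⟩ := exists_adic_expansion hθ (n + 1 + 1) F (by
      rw [Polynomial.degree_eq_natDegree hF.ne_zero, hFd, hθd]
      norm_cast
      nlinarith)
    have hgN := (adic_leading hθ (N := n + 1) (hθd ▸ hd) hF (hθd ▸ hFd) hg hsum).2.2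
    rw [hθd] at hg
    set a := g n with ha
    set low := ∑ i ∈ Finset.range n, g i * θ ^ i with hlow
    have hsplit : F = low + a * θ ^ n + θ ^ (n + 1) := by
      rw [hsum, Finset.sum_range_succ, Finset.sum_range_succ, hgN, one_mul]
    have hlowdeg : low.degree < ((n * d : ℕ) : WithBot ℕ) := by
      refine (Polynomial.degree_sum_le _ _).trans_lt ?_
      rw [Finset.sup_lt_iff (WithBot.bot_lt_coe _)]
      intro i hi
      have h1 := degree_mul_lt_of_lt_of_le (hg i)
        (b := i * d) (q := θ ^ i) (by
          rw [Polynomial.degree_eq_natDegree (hθ.pow i).ne_zero, hθ.natDegree_pow, hθd])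
      refine h1.trans_le ?_
      have := Finset.mem_range.1 hi
      norm_cast
      nlinarith
    have hadeg : a.degree < ((r + 1 : ℕ) : WithBot ℕ) := by
      by_cases ha0 : a = 0
      · rw [ha0, Polynomial.degree_zero]; exact WithBot.bot_lt_coe _
      have h1 : (a * θ ^ n).degree < ((n * d + (r + 1) : ℕ) : WithBot ℕ) := by
        have : a * θ ^ n = (F - θ ^ (n + 1)) - low := by rw [hsplit]; ring
        rw [this]
        refine (Polynomial.degree_sub_le _ _).trans_lt (max_lt hdeg (hlowdeg.trans_le ?_))
        norm_cast
        omega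
      rw [(hθ.pow n).degree_mul, Polynomial.degree_eq_natDegree ha0,
        Polynomial.degree_eq_natDegree (hθ.pow n).ne_zero, hθ.natDegree_pow, hθd] at h1
      rw [Polynomial.degree_eq_natDegree ha0]
      norm_cast at h1 ⊢
      omega
    set κ : K⟦X⟧[X] := Polynomial.C (PowerSeries.C (((n + 1 : ℕ) : K)⁻¹)) with hκ
    have hκ1 : (n + 1 : K⟦X⟧[X]) * κ = 1 := by
      have h1 : (n + 1 : K⟦X⟧[X]) = Polynomial.C (PowerSeries.C ((n + 1 : ℕ) : K)) := by simp
      rw [h1, hκ, ← Polynomial.C_mul, ← map_mul, mul_inv_cancel₀ hn]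
      simp
    set δ := κ * a with hδ
    have hδle : ∀ m : ℕ, a.degree ≤ (m : WithBot ℕ) → δ.degree ≤ (m : WithBot ℕ) := by
      intro m hm
      refine (Polynomial.degree_mul_le _ _).trans ?_
      refine (add_le_add (Polynomial.degree_C_le) hm).trans ?_
      simp
    have haor : a = 0 ∨ a.natDegree ≤ r ∧ a.natDegree < d := by
      by_cases ha0 : a = 0
      · exact Or.inl ha0
      · right
        have h1 := hg n
        rw [← ha, Polynomial.degree_eq_natDegree ha0] at h1
        rw [Polynomial.degree_eq_natDegree ha0] at hadeg
        norm_cast at h1 hadeg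
        omega
    -- The bound `d - 1` keeps `θ + δ` monic of degree `d`; the bound `r` gives progress in the
    -- induction.
    have hale : a.degree ≤ ((min r (d - 1) : ℕ) : WithBot ℕ) := by
      rcases haor with h0 | ⟨h1, h2⟩
      · rw [h0, Polynomial.degree_zero]; exact bot_le
      · refine Polynomial.degree_le_natDegree.trans ?_
        exact_mod_cast le_min h1 (by omega)
    have hmin : min r (d - 1) < d := lt_of_le_of_lt (min_le_right _ _) (by omega)
    have hδlt : δ.degree < θ.degree := by
      rw [hθdeg]
      refine (hδle _ hale).trans_lt ?_
      exact_mod_cast hmin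
    refine ih (θ + δ) (hθ.add_of_left hδlt) ?_ ?_ ?_
    · rw [Polynomial.natDegree_add_eq_left_of_degree_lt hδlt, hθd]
    · by_cases ha0 : a = 0
      · rw [hδ, ha0, mul_zero, add_zero]; exact hθY
      have hδ0 : δ ≠ 0 := by
        intro h0
        apply ha0
        calc a = ((n + 1 : K⟦X⟧[X]) * κ) * a := by rw [hκ1, one_mul]
          _ = (n + 1 : K⟦X⟧[X]) * δ := by rw [hδ]; ring
          _ = 0 := by rw [h0, mul_zero]
      have hδd : δ.degree < (d : WithBot ℕ) := hθdeg ▸ hδlt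
      have hex : ∀ i, ∃ (w : ℕ) (c' : L), IsMono b (pull (g i)) w c' ∧ (c' = 0 → g i = 0) ∧
          (g i = 1 → w = 0 ∧ c' = 1) := by
        intro i
        by_cases h1 : g i = 1
        · exact ⟨0, 1, by rw [h1, map_one]; exact IsMono.one, fun h => absurd h one_ne_zero,
            fun _ => ⟨rfl, rfl⟩⟩
        by_cases h0 : g i = 0
        · exact ⟨0, 0, by rw [h0, map_zero]; exact IsMono.zero 0, fun _ => h0,
            fun h => absurd h h1⟩
        · obtain ⟨w, c', hc', h⟩ := hsmall _ h0 (hg i)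
          exact ⟨w, c', h, fun h' => absurd h' hc', fun h => absurd h h1⟩
      choose vi ci hmono hci hone using hex
      have hcomp := leading_terms_eq hα hb hH hHd hHl hU hcU hθY hc (g := fun i => pull (g i))
        (vi := vi) (ci := ci) (vF := vF) (fun i _ => hmono i)
        (fun i _ h => by rw [hci i h, map_zero]) (hone _ hgN).1 (hone _ hgN).2 (by
          rw [← hpF, hsum, map_sum]
          exact Finset.sum_congr rfl fun i _ => by rw [map_mul, map_pow])
      obtain ⟨hvF, hcU', hge, hco⟩ := hcomp
      have hcn : ci n ≠ 0 := fun h => ha0 (hci n h)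
      -- If the summand with `i = n` were on the line, `H` would have a nonzero coefficient at
      -- `y^n`, which the Abhyankar shift has removed.
      have hne : ¬ (ci n ≠ 0 ∧ α * (vi n + n * v) + β * n = α * vF + β * (n + 1)) := by
        intro h
        have h1 := (hco n (Nat.le_succ n)).1 h
        have h2 : (PowerSeries.coeff (β * (n + 1)) (wt 1 α β hα H)).coeff n = 0 := by
          rw [coeff_wt, hHc]
          simp
        rw [h2, zero_mul] at h1
        exact mul_ne_zero hcn (pow_ne_zero _ hc) h1.symm
      have hlt : α * v + β < α * vi n := by
        have h1 := hge n (Nat.le_succ n) hcn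
        have h2 : α * vF + β * (n + 1) < α * (vi n + n * v) + β * n :=
          lt_of_le_of_ne h1 fun h => hne ⟨hcn, h.symm⟩
        rw [hvF] at h2
        nlinarith
      -- As `a = (n+1) δ`, it suffices that the constant `n + 1` has order 0. It cannot pull back to
      -- 0, because it is invertible.
      have hmδ : ∃ w c', α * v + β < α * w ∧ IsMono b (pull δ) w c' := by
        obtain ⟨w, c', hc', hw⟩ := hsmall δ hδ0 hδd
        obtain ⟨w', c'', hc'', hw'⟩ := hsmall ((n + 1 : ℕ) : K⟦X⟧[X])
          (by
            intro h0
            rw [Nat.cast_add, Nat.cast_one] at h0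
            rw [h0, zero_mul] at hκ1
            exact zero_ne_one hκ1)
          ((Polynomial.degree_natCast_le _).trans_lt (by exact_mod_cast hd))
        refine ⟨w, c', ?_, hw⟩
        have hprod := hw'.mul hw
        rw [← map_mul] at hprod
        have h3 : ((n + 1 : ℕ) : K⟦X⟧[X]) * δ = a := by
          rw [hδ, ← mul_assoc]; push_cast; rw [hκ1, one_mul]
        rw [h3] at hprod
        have h4 := Lead.unique (redAt_CX b) (by simp) hprod (hmono n)
          (Polynomial.C_ne_zero.2 (mul_ne_zero hc'' hc')) (Polynomial.C_ne_zero.2 hcn)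
        have h5 : IsMono b (pull ((n + 1 : ℕ) : K⟦X⟧[X])) 0 ((n + 1 : ℕ) : L) := by
          have := IsMono.C_constant (b := b) ((n + 1 : ℕ) : L)
          simpa using this
        have h6 : ((n + 1 : ℕ) : L) = 0 ∨ w' = 0 := by
          by_cases h7 : ((n + 1 : ℕ) : L) = 0
          · exact Or.inl h7
          · exact Or.inr (Lead.unique (redAt_CX b) (by simp) hw' h5
              (Polynomial.C_ne_zero.2 hc'') (Polynomial.C_ne_zero.2 h7)).1
        rcases h6 with h6 | h6
        · exfalso
          have h8 : pull ((n + 1 : ℕ) : K⟦X⟧[X]) = 0 := by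
            rw [map_natCast, ← map_natCast (Polynomial.C.comp (PowerSeries.C (R := L))), h6,
              map_zero]
          have h9 := congrArg pull hκ1
          rw [map_mul, map_one, ← Nat.cast_one, ← Nat.cast_add, h8, zero_mul] at h9
          simp at h9
        · rw [h6, zero_add] at h4
          rw [h4.1]
          exact hlt
      obtain ⟨w, c', hw, hm⟩ := hmδ
      rw [map_add]
      exact hθY.add hw hm
    -- The linear term `(n+1) θ^n δ` cancels `a θ^n`; this dictates the choice of `δ`.
    · have h1 : F - (θ + δ) ^ (n + 1) =
          low - ((θ + δ) ^ (n + 1) - θ ^ (n + 1) - (n + 1 : K⟦X⟧[X]) * (θ ^ n * δ)) := by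
        have : (n + 1 : K⟦X⟧[X]) * (θ ^ n * δ) = a * θ ^ n := by
          calc _ = ((n + 1 : K⟦X⟧[X]) * κ) * (a * θ ^ n) := by rw [hδ]; ring
            _ = _ := by rw [hκ1, one_mul]
        rw [this, hsplit]
        ring
      rw [h1]
      refine (Polynomial.degree_sub_le _ _).trans_lt (max_lt (hlowdeg.trans_le ?_) ?_)
      · norm_cast; omega
      · refine (degree_binomial_lt hθdeg.le (hδle _ hale) hmin n).trans_le ?_
        norm_cast
        have := min_le_left r (d - 1)
        omega

/-- Uniqueness of approximate roots. -/
lemma approxRoot_eq {F ψ : K⟦X⟧[X]} {n d : ℕ} (hFd : F.natDegree = (n + 1) * d)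
    (hn : ((n + 1 : ℕ) : K) ≠ 0) (hψ : ψ.Monic) (hψd : ψ.natDegree = d)
    (hdeg : (F - ψ ^ (n + 1)).degree < ((n * d : ℕ) : WithBot ℕ)) :
    approxRoot (n + 1) F = ψ := by
  have hdiv : F.natDegree / (n + 1) = d := by
    rw [hFd, Nat.mul_div_cancel_left _ (Nat.succ_pos n)]
  have hsub : F.natDegree - F.natDegree / (n + 1) = n * d := by
    rw [hdiv, hFd, add_mul, one_mul, Nat.add_sub_cancel]
  have hex : ∃ p : K⟦X⟧[X], p.Monic ∧ p.natDegree = F.natDegree / (n + 1) ∧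
      (F - p ^ (n + 1)).degree < ((F.natDegree - F.natDegree / (n + 1) : ℕ) : WithBot ℕ) :=
    ⟨ψ, hψ, by rw [hψd, hdiv], by rwa [hsub]⟩
  rw [approxRoot, dif_pos hex]
  obtain ⟨h1, h2, h3⟩ := hex.choose_spec
  set p := hex.choose
  rw [hdiv] at h2
  rw [hsub] at h3
  by_contra hne
  -- Each of the `n + 1` products is monic of degree `n d`, so the coefficient of `Q` there is the
  -- invertible constant `n + 1`. A nonzero multiple of `Q` therefore has degree at least `n d`.
  set Q := ∑ i ∈ Finset.range (n + 1), p ^ i * ψ ^ (n - i) with hQ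
  have hfac : (p - ψ) * Q = p ^ (n + 1) - ψ ^ (n + 1) := by
    rw [hQ, mul_comm]
    exact (Commute.all p ψ).geom_sum₂_mul (n + 1)
  have hQc : Q.coeff (n * d) = ((n + 1 : ℕ) : K⟦X⟧) := by
    rw [hQ, Polynomial.finsetSum_coeff]
    have : ∀ i ∈ Finset.range (n + 1), (p ^ i * ψ ^ (n - i)).coeff (n * d) = 1 := by
      intro i hi
      have hm : (p ^ i * ψ ^ (n - i)).Monic := (h1.pow i).mul (hψ.pow _)
      have hnd : (p ^ i * ψ ^ (n - i)).natDegree = n * d := by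
        rw [(h1.pow i).natDegree_mul (hψ.pow _), h1.natDegree_pow, hψ.natDegree_pow, h2, hψd,
          ← add_mul]
        congr 1
        have := Finset.mem_range.1 hi
        omega
      rw [← hnd, Polynomial.coeff_natDegree, hm.leadingCoeff]
    rw [Finset.sum_congr rfl this]
    simp
  have hn' : ((n + 1 : ℕ) : K⟦X⟧) ≠ 0 := by
    intro h0
    apply hn
    have := congrArg (PowerSeries.constantCoeff (R := K)) h0
    simpa using this
  have hQdeg : ((n * d : ℕ) : WithBot ℕ) ≤ Q.degree :=
    Polynomial.le_degree_of_ne_zero (by rw [hQc]; exact hn')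
  have hlt : (p ^ (n + 1) - ψ ^ (n + 1)).degree < ((n * d : ℕ) : WithBot ℕ) := by
    have : p ^ (n + 1) - ψ ^ (n + 1) = (F - ψ ^ (n + 1)) - (F - p ^ (n + 1)) := by ring
    rw [this]
    exact (Polynomial.degree_sub_le _ _).trans_lt (max_lt hdeg h3)
  rw [← hfac, Polynomial.degree_mul] at hlt
  have h4 : (0 : WithBot ℕ) ≤ (p - ψ).degree :=
    Polynomial.zero_le_degree_iff.2 (sub_ne_zero.2 hne)
  exact absurd (hlt.trans_le hQdeg) (not_lt.2 (le_add_of_nonneg_left h4))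

end Tschirnhausen

/-! ### Weierstrass polynomials with polynomial cofactor. -/

section Weierstrass

variable {L : Type u} [Field L]

instance isAdicComplete_maximalIdeal :
    IsAdicComplete (IsLocalRing.maximalIdeal L⟦X⟧) L⟦X⟧ := by
  rw [PowerSeries.maximalIdeal_eq_span_X]
  infer_instance

lemma mem_maximalIdeal_iff {a : L⟦X⟧} :
    a ∈ IsLocalRing.maximalIdeal L⟦X⟧ ↔ PowerSeries.constantCoeff a = 0 := by
  rw [PowerSeries.maximalIdeal_eq_span_X, Ideal.mem_span_singleton, PowerSeries.X_dvd_iff]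

/-- Weierstrass preparation gives a cofactor that is a power series in `y`. Since `W` is a
polynomial, division by the monic Weierstrass polynomial is exact, and the cofactor may be taken in
`L[[x]][y]`. -/
lemma weierstrassPoly_spec {W : L⟦X⟧[X]} {N : ℕ} {r : L[X]} (hW : red W = Polynomial.X ^ N * r)
    (hr : r.coeff 0 ≠ 0) : (weierstrassPoly W).Monic ∧ (weierstrassPoly W).natDegree = N ∧
      red (weierstrassPoly W) = Polynomial.X ^ N ∧
      ∃ U, W = weierstrassPoly W * U ∧ (red U).coeff 0 ≠ 0 := by
  have hcoeff : ∀ i, PowerSeries.constantCoeff (W.coeff i) = (Polynomial.X ^ N * r).coeff i := by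
    intro i
    rw [← hW]; simp [red]
  have hres : ∀ a : L⟦X⟧, IsLocalRing.residue L⟦X⟧ a = 0 ↔ PowerSeries.constantCoeff a = 0 :=
    fun a => by rw [IsLocalRing.residue_eq_zero_iff, mem_maximalIdeal_iff]
  have hord : ((W : L⟦X⟧⟦X⟧).map (IsLocalRing.residue L⟦X⟧)).order = N := by
    rw [PowerSeries.order_eq_nat]
    constructor
    · rw [PowerSeries.coeff_map, Polynomial.coeff_coe, Ne, hres, hcoeff]
      simpa [Polynomial.coeff_X_pow_mul'] using hr
    · intro i hi
      rw [PowerSeries.coeff_map, Polynomial.coeff_coe, hres, hcoeff, Polynomial.coeff_X_pow_mul',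
        if_neg (not_le.2 hi)]
  have hne : (W : L⟦X⟧⟦X⟧).map (IsLocalRing.residue L⟦X⟧) ≠ 0 := by
    rw [← PowerSeries.order_finite_iff_ne_zero, hord]
    exact ENat.natCast_lt_top N
  have hex := PowerSeries.exists_isWeierstrassFactorization hne
  have hG : weierstrassPoly W = hex.choose := by rw [weierstrassPoly, dif_pos hex]
  obtain ⟨h, hfac⟩ := hex.choose_spec
  rw [← hG] at hfac
  set G := weierstrassPoly W
  have hdist := hfac.isDistinguishedAt
  have hmon := hdist.monic
  have hdeg : G.natDegree = N := by
    have h1 := hfac.natDegree_eq_toNat_order_map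
    rw [hord] at h1
    simpa using h1
  have hredG : red G = Polynomial.X ^ N := by
    ext i
    have h0 : (red G).coeff i = PowerSeries.constantCoeff (G.coeff i) := by simp [red]
    rw [h0, Polynomial.coeff_X_pow]
    rcases lt_trichotomy i N with hi | hi | hi
    · rw [if_neg hi.ne, ← mem_maximalIdeal_iff]
      exact hdist.mem (hdeg ▸ hi)
    · rw [if_pos hi, hi, ← hdeg, Polynomial.coeff_natDegree, hmon.leadingCoeff, map_one]
    · rw [if_neg hi.ne', Polynomial.coeff_eq_zero_of_natDegree_lt (hdeg ▸ hi), map_zero]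
  -- Euclidean division and the preparation theorem are two Weierstrass divisions of `W` by `G`. By
  -- uniqueness the Euclidean remainder is 0.
  have hdvd : W = G * (W /ₘ G) := by
    have hdiv := hdist.isWeierstrassDivisorAt'
    have horder : G.natDegree =
        ((G : L⟦X⟧⟦X⟧).map (Ideal.Quotient.mk (IsLocalRing.maximalIdeal L⟦X⟧))).order :=
      hdist.coe_natDegree_eq_order_map (G : L⟦X⟧⟦X⟧) 1
        (by rw [map_one]; exact (Ideal.ne_top_iff_one _).1 (Ideal.IsMaximal.ne_top inferInstance))
        (by rw [mul_one])
    have h1 := hdiv.eq_zero_of_mul_eq (q := h - (W /ₘ G : L⟦X⟧[X])) (r := W %ₘ G) (by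
        rw [← horder, ENat.toNat_natCast, ← Polynomial.degree_eq_natDegree hmon.ne_zero]
        exact Polynomial.degree_modByMonic_lt _ hmon) (by
        have h2 := congrArg (fun p : L⟦X⟧[X] => (p : L⟦X⟧⟦X⟧)) (Polynomial.modByMonic_add_div W G)
        simp only [Polynomial.coe_add, Polynomial.coe_mul] at h2
        rw [mul_sub, ← hfac.eq_mul, ← h2]
        ring)
    have h3 := Polynomial.modByMonic_add_div W G
    rw [h1.2, zero_add] at h3
    exact h3.symm
  refine ⟨hmon, hdeg, hredG, W /ₘ G, hdvd, ?_⟩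
  have h4 : Polynomial.X ^ N * red (W /ₘ G) = Polynomial.X ^ N * r := by
    rw [← hredG, ← map_mul, ← hdvd, hW, hredG]
  rw [mul_left_cancel₀ (pow_ne_zero N Polynomial.X_ne_zero) h4]
  exact hr

lemma divXPow_mul (M : ℕ) (W : L⟦X⟧[X]) :
    divXPow M (Polynomial.C PowerSeries.X ^ M * W) = W := by
  ext i n
  rw [divXPow, Polynomial.sum_over_range _ (by
    intro i
    have : (PowerSeries.mk fun n => PowerSeries.coeff (n + M) (0 : L⟦X⟧)) = 0 := by ext; simp
    rw [this, map_zero]), Polynomial.finsetSum_coeff]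
  simp only [Polynomial.coeff_monomial]
  rw [Finset.sum_ite_eq']
  have h1 : PowerSeries.coeff (n + M) (((Polynomial.C PowerSeries.X) ^ M * W).coeff i) =
      PowerSeries.coeff n (W.coeff i) := by
    rw [coeff_coeff_X_pow_mul, if_pos (Nat.le_add_left _ _), Nat.add_sub_cancel]
  split_ifs with hi
  · rw [PowerSeries.coeff_mk, h1]
  · rw [← h1, Polynomial.coeff_eq_zero_of_natDegree_lt (by simpa using hi)]
    simp

end Weierstrass

/-! ### The Abhyankar shift. -/

section Shift

variable {L : Type u} [Field L]

/-- By Taylor's formula the coefficient of `y^n` in `G(y + c)` is `g_n + (n+1) c`. -/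
lemma coeff_tauPull_self {G : L⟦X⟧[X]} {n : ℕ} (hG : G.Monic) (hGd : G.natDegree = n + 1)
    (hn : ((n + 1 : ℕ) : L) ≠ 0) : (tauPull G G).Monic ∧ (tauPull G G).natDegree = n + 1 ∧
      (tauPull G G).coeff n = 0 := by
  have htau : tauPull G G = G.comp (Polynomial.X + Polynomial.C (shiftSeries G)) := rfl
  have hmon : (tauPull G G).Monic := by
    rw [htau]
    exact hG.comp_X_add_C _
  have hdeg : (tauPull G G).natDegree = n + 1 := by
    rw [htau, Polynomial.natDegree_comp, Polynomial.natDegree_X_add_C, mul_one, hGd]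
  refine ⟨hmon, hdeg, ?_⟩
  have hT : tauPull G G = Polynomial.taylor (shiftSeries G) G := by
    rw [htau, Polynomial.taylor_apply]
  have hlt : (Polynomial.hasseDeriv n G).natDegree < 2 := by
    have := Polynomial.natDegree_hasseDeriv_le G n
    omega
  rw [hT, Polynomial.taylor_coeff, Polynomial.eval_eq_sum_range' hlt]
  simp only [Finset.sum_range_succ, Finset.sum_range_zero, Polynomial.hasseDeriv_coeff, zero_add,
    Nat.choose_self, Nat.cast_one, one_mul, pow_zero, mul_one, pow_one, add_comm 1 n,
    Nat.choose_succ_self_right]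
  have h1 : G.coeff (n + 1) = 1 := by rw [← hGd]; exact hG
  have h2 : (((n + 1 : ℕ) : L⟦X⟧)) * PowerSeries.C (((n + 1 : ℕ) : L)⁻¹) = 1 := by
    rw [← map_natCast (PowerSeries.C (R := L)), ← map_mul, mul_inv_cancel₀ hn, map_one]
  rw [h1, shiftSeries, hGd, Nat.add_sub_cancel]
  linear_combination (-G.coeff n) * h2

lemma constantCoeff_shiftSeries {G : L⟦X⟧[X]} {N : ℕ} (hN : 0 < N) (hG : G.natDegree = N)
    (hred : red G = Polynomial.X ^ N) : PowerSeries.constantCoeff (shiftSeries G) = 0 := by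
  have h0 : (red G).coeff (N - 1) = PowerSeries.constantCoeff (G.coeff (N - 1)) := by simp [red]
  rw [hred, Polynomial.coeff_X_pow, if_neg (by omega)] at h0
  simp [shiftSeries, hG, ← h0]

end Shift

/-! ### The edge polynomial and its simple zero. -/

section SimpleZero

variable {L : Type u} [Field L]

lemma exists_comp_eq_X_mul {p : L[X]} {a : L} (h : p.eval a = 0) :
    ∃ r, p.comp (Polynomial.X + Polynomial.C a) = Polynomial.X * r ∧
      r.coeff 0 = (Polynomial.derivative p).eval a := by
  rw [← Polynomial.taylor_apply]
  obtain ⟨r, hr⟩ : Polynomial.X ∣ Polynomial.taylor a p := by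
    rw [Polynomial.X_dvd_iff, Polynomial.taylor_coeff_zero, h]
  refine ⟨r, hr, ?_⟩
  rw [← Polynomial.taylor_coeff_one, hr]
  simp

/-- The polynomial `∑ c_j u^{m (n - j)} y^{q j}`, where `P = ∑ c_j y^j` has degree `n`. -/
noncomputable def edgePoly (q m : ℕ) (P : L[X]) {L' : Type u} [Field L'] (f : L →+* L') (u : L') :
    L'[X] :=
  ∑ j ∈ Finset.range (P.natDegree + 1),
    Polynomial.monomial (q * j) (f (P.coeff j) * u ^ (m * (P.natDegree - j)))

variable {P : L[X]} [Fact (Irreducible P)]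

/-- At `(z^t, z^s)` the `j`-th term carries `z^(tmn + j)` by the Bézout relation, so the value is a
power of `z` times `P(z) = 0`. Simplicity comes from `sum_mul_ne_zero_of_root`. -/
lemma edgePoly_root (hP : P.Monic) (hP' : Polynomial.derivative P ≠ 0)
    (hz : AdjoinRoot.root P ≠ 0) {q m s t : ℕ} (hq : 0 < q) (hq' : (q : L) ≠ 0)
    (hqm : Nat.Coprime q m) (hst : q * s = m * t + 1) :
    ∃ r, (edgePoly q m P (AdjoinRoot.of P) (AdjoinRoot.root P ^ t)).comp
      (Polynomial.X + Polynomial.C (AdjoinRoot.root P ^ s)) = Polynomial.X * r ∧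
      r.coeff 0 ≠ 0 := by
  set z := AdjoinRoot.root P with hzdef
  set n := P.natDegree with hn
  have hexp : ∀ j ≤ n, t * (m * (n - j)) + s * (q * j) = t * m * n + j := by
    intro j hj
    obtain ⟨i, hi⟩ := Nat.exists_eq_add_of_le hj
    rw [hi, Nat.add_sub_cancel_left]
    calc _ = t * m * i + (q * s) * j := by ring
      _ = _ := by rw [hst]; ring
  have hsum0 : ∑ j ∈ Finset.range (n + 1), AdjoinRoot.of P (P.coeff j) *
      z ^ (t * (m * (n - j)) + s * (q * j)) = 0 := by
    have h1 : AdjoinRoot.mk P P = ∑ j ∈ Finset.range (n + 1),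
        AdjoinRoot.of P (P.coeff j) * z ^ j := by
      refine (congrArg (AdjoinRoot.mk P) P.as_sum_range_C_mul_X_pow).trans ?_
      rw [map_sum]
      simp [hzdef, hn]
    rw [AdjoinRoot.mk_self] at h1
    rw [← mul_zero (z ^ (t * m * n)), h1, Finset.mul_sum]
    refine Finset.sum_congr rfl fun j hj => ?_
    rw [hexp j (Nat.lt_succ_iff.1 (Finset.mem_range.1 hj)), pow_add]
    ring
  have heval : (edgePoly q m P (AdjoinRoot.of P) (z ^ t)).eval (z ^ s) = 0 := by
    rw [edgePoly, Polynomial.eval_finsetSum, ← hsum0]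
    refine Finset.sum_congr rfl fun j _ => ?_
    rw [Polynomial.eval_monomial, ← pow_mul, ← pow_mul, mul_assoc, ← pow_add]
  obtain ⟨r, hr, hr0⟩ := exists_comp_eq_X_mul heval
  refine ⟨r, hr, fun h0 => ?_⟩
  rw [h0] at hr0
  have hinj : Set.InjOn (fun j => q * j) (Finset.range (n + 1) : Set ℕ) :=
    fun a _ b _ hab => Nat.eq_of_mul_eq_mul_left hq hab
  have hmain := sum_mul_ne_zero_of_root (w := q * m * n) hP hP' hz hq hq' hqm hst
    ((Finset.range (n + 1)).image fun j => q * j) (fun i => P.coeff (i / q))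
    (fun i => m * (n - i / q)) ?_ ?_ ?_ ?_
  · apply hmain
    rw [Finset.sum_image hinj]
    have h1 : (z ^ s) * (Polynomial.derivative
        (edgePoly q m P (AdjoinRoot.of P) (z ^ t))).eval (z ^ s) = 0 := by
      rw [← hr0, mul_zero]
    rw [edgePoly, map_sum, Polynomial.eval_finsetSum, Finset.mul_sum] at h1
    rw [← h1]
    refine Finset.sum_congr rfl fun j _ => ?_
    rw [Nat.mul_div_cancel_left _ hq, Polynomial.derivative_monomial, Polynomial.eval_monomial,
      pow_add, pow_mul z t, pow_mul z s]
    rcases Nat.eq_zero_or_pos (q * j) with h | h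
    · rw [h]; simp
    · obtain ⟨k, hk⟩ := Nat.exists_eq_succ_of_ne_zero h.ne'
      rw [hk, Nat.succ_eq_add_one, Nat.add_sub_cancel, pow_succ]
      ring
  · intro i hi
    obtain ⟨j, hj, rfl⟩ := Finset.mem_image.1 hi
    rw [Nat.mul_div_cancel_left _ hq]
    obtain ⟨k, hk⟩ := Nat.exists_eq_add_of_le (Nat.lt_succ_iff.1 (Finset.mem_range.1 hj))
    rw [hk, Nat.add_sub_cancel_left]
    ring
  · intro i hi
    obtain ⟨j, hj, rfl⟩ := Finset.mem_image.1 hi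
    exact Nat.mul_le_mul_left _ (Nat.lt_succ_iff.1 (Finset.mem_range.1 hj))
  · refine ⟨q * n, Finset.mem_image_of_mem _ (Finset.self_mem_range_succ n), ?_⟩
    rw [Nat.mul_div_cancel_left _ hq, hn, Polynomial.coeff_natDegree, hP.leadingCoeff]
    exact one_ne_zero
  · rw [Finset.sum_image hinj, ← hsum0]
    refine Finset.sum_congr rfl fun j _ => ?_
    rw [Nat.mul_div_cancel_left _ hq]

end SimpleZero

/-! ### Newton points and supporting lines. -/

section Points

variable {L : Type u} [Field L] {A : L⟦X⟧[X]}

/-- The points `(i, val a_i)` whose lower hull is the Newton polygon. -/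
def newtonPoints (A : L⟦X⟧[X]) : Set (ℝ × ℝ) :=
  {p | ∃ i j : ℕ, (A.coeff i).order = (j : ℕ∞) ∧ p = ((i : ℝ), (j : ℝ))}

lemma newtonPoints_finite (A : L⟦X⟧[X]) : (newtonPoints A).Finite := by
  refine ((Finset.range (A.natDegree + 1)).finite_toSet.image
    fun i : ℕ => ((i : ℝ), ((A.coeff i).order.toNat : ℝ))).subset ?_
  rintro p ⟨i, j, hij, rfl⟩
  refine ⟨i, ?_, by simp [hij]⟩
  rw [Finset.mem_coe, Finset.mem_range, Nat.lt_succ_iff]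
  refine Polynomial.le_natDegree_of_ne_zero fun h0 => ?_
  rw [h0, PowerSeries.order_zero] at hij
  exact ENat.top_ne_natCast j hij

lemma exists_newtonPoint {i j : ℕ} (h : PowerSeries.coeff j (A.coeff i) ≠ 0) :
    ∃ j' ≤ j, ((i : ℝ), (j' : ℝ)) ∈ newtonPoints A := by
  have hle := PowerSeries.order_le j h
  obtain ⟨j', hj'⟩ := ENat.ne_top_iff_exists.1 (ne_top_of_le_ne_top (ENat.natCast_ne_top j) hle)
  refine ⟨j', ?_, i, j', hj'.symm, rfl⟩
  rw [← hj'] at hle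
  exact_mod_cast hle

lemma coeff_ne_zero_of_order {a : L⟦X⟧} {j : ℕ} (h : a.order = (j : ℕ∞)) :
    PowerSeries.coeff j a ≠ 0 := ((PowerSeries.order_eq_nat).1 h).1

lemma coeff_restrictTo (E : Set (ℝ × ℝ)) (A : L⟦X⟧[X]) (i j : ℕ) [Decidable (((i : ℝ), (j : ℝ)) ∈ E)] :
    PowerSeries.coeff j ((restrictTo E A).coeff i) =
      if ((i : ℝ), (j : ℝ)) ∈ E then PowerSeries.coeff j (A.coeff i) else 0 := by
  rw [restrictTo, Polynomial.finsetSum_coeff]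
  simp only [Polynomial.coeff_monomial]
  rw [Finset.sum_ite_eq']
  split_ifs with h1 h2 h2
  · rw [PowerSeries.coeff_mk, if_pos h2]
  · rw [PowerSeries.coeff_mk, if_neg h2]
  · rw [Polynomial.coeff_eq_zero_of_natDegree_lt (by simpa using h1)]
  · simp

/-- Translation between the weighted degree and supporting lines. -/
lemma weight_le_iff {α β M i : ℕ} {x : ℝ} (hα : 0 < α) :
    (β * M : ℝ) ≤ α * x + β * i ↔ (β / α : ℝ) * M ≤ x + β / α * i := by
  have hα' : (0 : ℝ) < α := by exact_mod_cast hα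
  rw [← mul_le_mul_iff_right₀ hα' (b := (β / α : ℝ) * M)]
  have e1 : (α : ℝ) * (β / α * M) = β * M := by field_simp
  have e2 : (α : ℝ) * (x + β / α * i) = α * x + β * i := by field_simp
  rw [e1, e2]

lemma weight_eq_iff {α β M i : ℕ} {x : ℝ} (hα : 0 < α) :
    α * x + β * i = (β * M : ℝ) ↔ x + β / α * i = (β / α : ℝ) * M := by
  have hα' : (α : ℝ) ≠ 0 := by exact_mod_cast hα.ne'
  rw [← mul_right_inj' hα' (b := x + β / α * i)]
  have e1 : (α : ℝ) * (β / α * M) = β * M := by field_simp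
  have e2 : (α : ℝ) * (x + β / α * i) = α * x + β * i := by field_simp
  rw [e1, e2]

lemma newtonPoints_above {α β N : ℕ} (hα : 0 < α)
    (hl : ∀ i j, α * j + β * i < β * N → PowerSeries.coeff j (A.coeff i) = 0) :
    ∀ p ∈ newtonPoints A, (β / α : ℝ) * N ≤ p.2 + β / α * p.1 := by
  rintro p ⟨i, j, hij, rfl⟩
  rw [← weight_le_iff hα]
  by_contra h
  refine coeff_ne_zero_of_order hij (hl i j ?_)
  dsimp only at h
  exact_mod_cast not_le.1 h

lemma newtonPoints_right {N : ℕ} (hA : A.Monic) (hN : A.natDegree = N) :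
    ((N : ℝ), (0 : ℝ)) ∈ newtonPoints A ∧
      ∀ p ∈ newtonPoints A, p.1 < ((N : ℝ), (0 : ℝ)).1 ∨ p = ((N : ℝ), (0 : ℝ)) := by
  have h1 : A.coeff N = 1 := by rw [← hN]; exact hA
  refine ⟨⟨N, 0, by rw [h1]; simp, by simp⟩, ?_⟩
  rintro p ⟨i, j, hij, rfl⟩
  rcases lt_trichotomy i N with h | h | h
  · left; dsimp only; exact_mod_cast h
  · right
    subst h
    rw [h1, PowerSeries.order_one] at hij
    have : j = 0 := by exact_mod_cast hij.symm
    rw [this]; simp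
  · rw [Polynomial.coeff_eq_zero_of_natDegree_lt (hN ▸ h), PowerSeries.order_zero] at hij
    exact absurd hij (ENat.top_ne_natCast j)

end Points

/-! ### Coefficients of a degenerated polynomial. -/

section Edge

variable {L L' : Type u} [Field L] [Field L']

lemma quasiHom_monic {q m : ℕ} {P : L[X]} (hq : 0 < q) (hP : P.Monic) :
    (quasiHom q m P).Monic ∧ (quasiHom q m P).natDegree = q * P.natDegree := by
  have hco : (quasiHom q m P).coeff (q * P.natDegree) = 1 := by
    rw [quasiHom, Polynomial.finsetSum_coeff, Finset.sum_eq_single P.natDegree]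
    · rw [Polynomial.coeff_monomial, if_pos rfl, Polynomial.coeff_natDegree, hP.leadingCoeff]
      simp
    · intro j _ hj
      rw [Polynomial.coeff_monomial, if_neg]
      exact fun h => hj (Nat.eq_of_mul_eq_mul_left hq h)
    · intro h
      exact absurd (Finset.self_mem_range_succ _) h
  have hle : (quasiHom q m P).natDegree ≤ q * P.natDegree := by
    refine Polynomial.natDegree_sum_le_of_forall_le _ _ fun j hj => ?_
    refine (Polynomial.natDegree_monomial_le _).trans (Nat.mul_le_mul_left _ ?_)
    exact Nat.lt_succ_iff.1 (Finset.mem_range.1 hj)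
  have hdeg : (quasiHom q m P).natDegree = q * P.natDegree :=
    le_antisymm hle (Polynomial.le_natDegree_of_ne_zero (by rw [hco]; exact one_ne_zero))
  exact ⟨by rw [Polynomial.Monic, Polynomial.leadingCoeff, hdeg, hco], hdeg⟩

lemma wt_monomial_X_pow (u : L') {α β : ℕ} (hα : 0 < α) (c : L') (i j : ℕ) :
    wt u α β hα (Polynomial.monomial i (PowerSeries.C c * PowerSeries.X ^ j)) =
      PowerSeries.C (Polynomial.monomial i (c * u ^ j)) * PowerSeries.X ^ (α * j + β * i) := by
  have h1 : (Polynomial.monomial i (PowerSeries.C c * PowerSeries.X ^ j) : L'⟦X⟧[X]) =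
      Polynomial.C (PowerSeries.C c) * Polynomial.C PowerSeries.X ^ j * Polynomial.X ^ i := by
    rw [← Polynomial.C_mul_X_pow_eq_monomial, Polynomial.C_mul, Polynomial.C_pow]
  have h2 : wt u α β hα (Polynomial.C (PowerSeries.C c)) = PowerSeries.C (Polynomial.C c) := by
    simp [wt, rescale_C]
  rw [h1, map_mul, map_mul, map_pow, map_pow, h2, wt_CX, wt_X,
    ← Polynomial.C_mul_X_pow_eq_monomial]
  simp only [map_mul, map_pow, mul_pow, pow_add, pow_mul]
  ring

/-- All terms have the same weight `m q deg P`, so a single power of `x` factors out. -/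
lemma wt_quasiHom (f : L →+* L') (u : L') {q m : ℕ} (hq : 0 < q) (P : L[X]) :
    wt u q m hq (baseChange f (quasiHom q m P)) =
      PowerSeries.C (edgePoly q m P f u) * PowerSeries.X ^ (m * (q * P.natDegree)) := by
  rw [quasiHom, map_sum, map_sum, edgePoly, map_sum, Finset.sum_mul]
  refine Finset.sum_congr rfl fun j hj => ?_
  have h1 : baseChange f (Polynomial.monomial (q * j)
      (PowerSeries.C (P.coeff j) * PowerSeries.X ^ (m * (P.natDegree - j)))) =
      Polynomial.monomial (q * j)
        (PowerSeries.C (f (P.coeff j)) * PowerSeries.X ^ (m * (P.natDegree - j))) := by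
    simp [baseChange]
  rw [h1, wt_monomial_X_pow]
  obtain ⟨k, hk⟩ := Nat.exists_eq_add_of_le (Nat.lt_succ_iff.1 (Finset.mem_range.1 hj))
  rw [hk, Nat.add_sub_cancel_left]
  congr 2
  ring

lemma coeff_wt_congr (u : L) {α β : ℕ} (hα : 0 < α) {n : ℕ} {A A' : L⟦X⟧[X]}
    (h : ∀ i j, α * j + β * i = n →
      PowerSeries.coeff j (A.coeff i) = PowerSeries.coeff j (A'.coeff i)) :
    PowerSeries.coeff n (wt u α β hα A) = PowerSeries.coeff n (wt u α β hα A') := by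
  ext i
  rw [coeff_wt, coeff_wt]
  split_ifs with h1
  · obtain ⟨j, hj⟩ := h1.2
    rw [hj, Nat.mul_div_cancel_left _ hα, h i j (by omega)]
  · rfl

lemma coeff_baseChange (f : L →+* L') (A : L⟦X⟧[X]) (i j : ℕ) :
    PowerSeries.coeff j ((baseChange f A).coeff i) = f (PowerSeries.coeff j (A.coeff i)) := by
  simp [baseChange]

variable {H : L⟦X⟧[X]} {N : ℕ}

/-- What the edge data of a monic polynomial say about its coefficients. -/
lemma edgeData_spec (D : EdgeData H) (hH : H.Monic) (hHd : H.natDegree = N) :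
    N = D.q * D.P.natDegree * D.N ∧
    (∀ i j, D.q * j + D.m * i < D.m * N → PowerSeries.coeff j (H.coeff i) = 0) ∧
    (∀ i j, D.q * j + D.m * i = D.m * N → PowerSeries.coeff j (H.coeff i) =
      PowerSeries.coeff j ((quasiHom D.q D.m D.P ^ D.N).coeff i)) ∧ D.P.coeff 0 ≠ 0 := by
  classical
  obtain ⟨a, b, hab, hs, hseg⟩ := D.straight
  obtain ⟨c, hc, hbd⟩ := D.boundary_eq
  have hq := D.q_pos
  obtain ⟨hQm, hQd⟩ := quasiHom_monic (m := D.m) D.q_pos D.monic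
  have hQNm : (quasiHom D.q D.m D.P ^ D.N).Monic := hQm.pow _
  have hQNd : (quasiHom D.q D.m D.P ^ D.N).natDegree = D.q * D.P.natDegree * D.N := by
    rw [hQm.natDegree_pow, hQd, mul_comm]
  obtain ⟨hr, hr1⟩ := newtonPoints_right hH hHd
  obtain ⟨κ, hκ, hκ'⟩ := exists_line_of_lowerHull_eq_segment (S := newtonPoints H) hab hs hseg
    fun p hp => exists_mem_lowerHull_le (newtonPoints_finite H) hp
  have hrP := mem_lowerHull_of_rightmost hr1 hr
  have hκN : κ = (D.m / D.q : ℝ) * N := by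
    have := hκ' _ hrP
    simp only [zero_add] at this
    exact this.symm
  subst hκN
  have hlow : ∀ i j, D.q * j + D.m * i < D.m * N → PowerSeries.coeff j (H.coeff i) = 0 := by
    intro i j hlt
    by_contra hne
    obtain ⟨j', hj', hp⟩ := exists_newtonPoint hne
    have h1 := (weight_le_iff hq).2 (hκ _ hp)
    dsimp only at h1
    have h2 : D.m * N ≤ D.q * j' + D.m * i := by exact_mod_cast h1
    have := Nat.mul_le_mul_left D.q hj'
    omega
  have hbdco : ∀ i j, PowerSeries.coeff j ((boundary H).coeff i) =
      c * PowerSeries.coeff j ((quasiHom D.q D.m D.P ^ D.N).coeff i) := by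
    intro i j
    rw [hbd, Polynomial.coeff_C_mul, PowerSeries.coeff_C_mul]
  have hline : ∀ i j, D.q * j + D.m * i = D.m * N → PowerSeries.coeff j (H.coeff i) =
      c * PowerSeries.coeff j ((quasiHom D.q D.m D.P ^ D.N).coeff i) := by
    intro i j hij
    rw [← hbdco, boundary, coeff_restrictTo]
    split_ifs with hmem
    · rfl
    · by_contra hne
      obtain ⟨j', hj', hp⟩ := exists_newtonPoint hne
      have h1 := (weight_le_iff hq).2 (hκ _ hp)
      dsimp only at h1
      have h2 : D.m * N ≤ D.q * j' + D.m * i := by exact_mod_cast h1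
      have h3 : j' = j := by
        refine le_antisymm hj' (Nat.le_of_mul_le_mul_left ?_ hq)
        omega
      subst h3
      refine hmem (mem_lowerHull_of_line hκ (subset_convexHull ℝ _ hp) ?_)
      rw [← weight_eq_iff hq]
      dsimp only
      exact_mod_cast hij
  have hN0 := hline N 0 (by ring)
  have hHN : PowerSeries.coeff 0 (H.coeff N) = 1 := by
    rw [← hHd, Polynomial.coeff_natDegree, hH.leadingCoeff]; simp
  have hle1 : N ≤ D.q * D.P.natDegree * D.N := by
    rw [← hQNd]
    refine Polynomial.le_natDegree_of_ne_zero fun h0 => ?_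
    rw [h0, hHN] at hN0
    simp at hN0
  have hle2 : D.q * D.P.natDegree * D.N ≤ N := by
    rw [← hHd]
    refine Polynomial.le_natDegree_of_ne_zero fun h0 => ?_
    have h1 := hbdco (D.q * D.P.natDegree * D.N) 0
    rw [boundary, coeff_restrictTo, h0] at h1
    have h2 : (quasiHom D.q D.m D.P ^ D.N).coeff (D.q * D.P.natDegree * D.N) = 1 := by
      rw [← hQNd]; exact hQNm
    rw [h2] at h1
    apply hc
    simpa using h1.symm
  have hNeq : N = D.q * D.P.natDegree * D.N := le_antisymm hle1 hle2
  -- Both `H` and the power of the quasi-homogeneous polynomial have coefficient 1 at `y^N`.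
  have hc1 : c = 1 := by
    have h2 : (quasiHom D.q D.m D.P ^ D.N).coeff N = 1 := by
      rw [hNeq, ← hQNd]; exact hQNm
    rw [hHN, h2] at hN0
    simpa using hN0.symm
  simp only [hc1, one_mul] at hline
  refine ⟨hNeq, hlow, hline, fun hP0 => ?_⟩
  -- `P(0) = 0` would force `P = Z`. The boundary would then be `y^N` and the polygon a point,
  -- against its positive length.
  have hPX : D.P = Polynomial.X := by
    have h1 : Polynomial.X ∣ D.P := Polynomial.X_dvd_iff.2 hP0
    exact (Polynomial.eq_of_monic_of_associated Polynomial.monic_X D.monic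
      (associated_of_dvd_dvd h1 (Polynomial.irreducible_X.dvd_symm D.irreducible h1))).symm
  have hQX : quasiHom D.q D.m D.P ^ D.N = Polynomial.X ^ N := by
    have h1 : quasiHom D.q D.m D.P = Polynomial.X ^ D.q := by
      rw [quasiHom, hPX]
      simp [Finset.sum_range_succ, Polynomial.X_pow_eq_monomial]
    rw [h1, ← pow_mul, hNeq, hPX]
    simp
  have hsingle : ∀ p ∈ newtonPoints H, p.2 + (D.m / D.q : ℝ) * p.1 = (D.m / D.q : ℝ) * N →
      p = ((N : ℝ), (0 : ℝ)) := by
    rintro p ⟨i, j, hij, rfl⟩ hp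
    have h1 := (weight_eq_iff hq).2 hp
    dsimp only at h1
    have h2 : D.q * j + D.m * i = D.m * N := by exact_mod_cast h1
    have h3 := hline i j h2
    have h4 := coeff_ne_zero_of_order hij
    rw [h3, hQX, Polynomial.coeff_X_pow] at h4
    split_ifs at h4 with h5
    · rw [PowerSeries.coeff_one] at h4
      have h6 : j = 0 := by
        by_contra h6
        exact h4 (if_neg h6)
      rw [h5, h6]; simp
    · simp at h4
  have hend : ∀ p ∈ lowerHull (newtonPoints H), p = ((N : ℝ), (0 : ℝ)) := by
    intro p hp
    have h1 := mem_convexHull_line hκ hp.1 (hκ' p hp)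
    have h2 : {p ∈ newtonPoints H | p.2 + (D.m / D.q : ℝ) * p.1 = (D.m / D.q : ℝ) * N} ⊆
        {((N : ℝ), (0 : ℝ))} := fun p hp => hsingle p hp.1 hp.2
    have h3 := convexHull_mono h2 h1
    rwa [convexHull_singleton] at h3
  have hs' : lowerHull (newtonPoints H) = segment ℝ a b := hseg
  have ha : a = ((N : ℝ), (0 : ℝ)) := hend a (hs' ▸ left_mem_segment ℝ a b)
  have hb : b = ((N : ℝ), (0 : ℝ)) := hend b (hs' ▸ right_mem_segment ℝ a b)
  rw [ha, hb] at hab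
  exact lt_irrefl _ hab

/-- As `P(0) ≠ 0`, the edge reaches the axis of abscissa 0, with coefficient a power of `P(0)`. -/
lemma edgeData_coeff_zero (D : EdgeData H) (hH : H.Monic) (hHd : H.natDegree = N) :
    PowerSeries.coeff (D.m * D.P.natDegree * D.N) (H.coeff 0) ≠ 0 := by
  obtain ⟨hN, -, hline, hP0⟩ := edgeData_spec D hH hHd
  rw [hline 0 _ (by rw [hN]; ring), Polynomial.coeff_zero_eq_eval_zero, Polynomial.eval_pow,
    ← Polynomial.coeff_zero_eq_eval_zero]
  have h1 : (quasiHom D.q D.m D.P).coeff 0 =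
      PowerSeries.C (D.P.coeff 0) * PowerSeries.X ^ (D.m * D.P.natDegree) := by
    rw [quasiHom, Polynomial.finsetSum_coeff, Finset.sum_eq_single 0]
    · rw [mul_zero, Polynomial.coeff_monomial, if_pos rfl, Nat.sub_zero]
    · intro j _ hj
      rw [Polynomial.coeff_monomial, if_neg]
      exact (Nat.mul_pos D.q_pos (Nat.pos_of_ne_zero hj)).ne'
    · simp
  rw [h1, mul_pow, ← map_pow, ← pow_mul, PowerSeries.coeff_C_mul, PowerSeries.coeff_X_pow,
    if_pos rfl, mul_one]
  exact pow_ne_zero _ hP0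

lemma edgeData_leadS (D : EdgeData H) (hH : H.Monic) (hHd : H.natDegree = N) (f : L →+* L')
    (u : L') : LeadS (wt u D.q D.m D.q_pos (baseChange f H)) (D.m * N)
      (edgePoly D.q D.m D.P f u ^ D.N) := by
  obtain ⟨hN, hlow, hline, -⟩ := edgeData_spec D hH hHd
  have h1 := leadS_wt_of_coeff (u := u) D.q_pos (A := baseChange f H) (M := D.m * N)
    fun i j hij => by rw [coeff_baseChange, hlow i j hij, map_zero]
  convert h1 using 1
  rw [coeff_wt_congr u D.q_pos (A' := baseChange f (quasiHom D.q D.m D.P ^ D.N))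
    fun i j hij => by rw [coeff_baseChange, coeff_baseChange, hline i j hij], map_pow, map_pow,
    wt_quasiHom, mul_pow, ← pow_mul, ← map_pow, PowerSeries.coeff_C_mul, PowerSeries.coeff_X_pow,
    if_pos (by rw [hN]; ring), mul_one]

end Edge

/-! ### The strict transform. -/

section Step

variable {L : Type u} [Field L] {H : L⟦X⟧[X]} {N : ℕ}

lemma root_ne_zero_of_coeff_zero {P : L[X]} [Fact (Irreducible P)] (hP : P.coeff 0 ≠ 0) :
    AdjoinRoot.root P ≠ 0 := by
  intro h0
  have h1 := AdjoinRoot.eval₂_root P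
  rw [h0, Polynomial.eval₂_at_zero] at h1
  exact hP ((AdjoinRoot.of P).injective (h1.trans (map_zero _).symm))

lemma eval_zero_ne_zero_of_isMono {b v : ℕ} {A : L⟦X⟧[X]} {c : L} (h : IsMono b A v c)
    (hc : c ≠ 0) : A.eval 0 ≠ 0 := by
  obtain ⟨A', rfl, hA'⟩ := h
  intro h0
  rw [Polynomial.eval_mul, Polynomial.eval_pow, Polynomial.eval_C, mul_eq_zero] at h0
  rcases h0 with h0 | h0
  · exact pow_ne_zero _ PowerSeries.X_ne_zero h0
  · apply hc
    have h1 := coeff_zero_redAt b A'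
    rw [hA', Polynomial.coeff_C_zero] at h1
    rw [h1, red, Polynomial.coe_mapRingHom, Polynomial.coeff_map,
      Polynomial.coeff_zero_eq_eval_zero, h0, map_zero]

/-- The Weierstrass polynomial of the strict transform. -/
lemma weierstrass_step (D : EdgeData H) (hH : H.Monic) (hHd : H.natDegree = N)
    [Fact (Irreducible D.P)] (hP' : Polynomial.derivative D.P ≠ 0) (hq : (D.q : L) ≠ 0)
    {G : (AdjoinRoot D.P)⟦X⟧[X]}
    (hG : G = weierstrassPoly (divXPow (D.q * D.m * D.P.natDegree * D.N)
      (sigmaPull (AdjoinRoot.root D.P) D.q D.m D.s D.t D.q_pos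
        (baseChange (AdjoinRoot.of D.P) H)))) :
    G.Monic ∧ G.natDegree = D.N ∧ red G = Polynomial.X ^ D.N ∧ ∃ Q,
      sigmaPull (AdjoinRoot.root D.P) D.q D.m D.s D.t D.q_pos (baseChange (AdjoinRoot.of D.P) H) =
        Polynomial.C PowerSeries.X ^ (D.m * N) * (G * Q) ∧ (red Q).coeff 0 ≠ 0 := by
  obtain ⟨hN, -, -, hP0⟩ := edgeData_spec D hH hHd
  obtain ⟨r, hr, hr0⟩ := edgePoly_root D.monic hP' (root_ne_zero_of_coeff_zero hP0) D.q_pos hq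
    D.coprime D.bezout
  obtain ⟨W, hW, hWr⟩ := (edgeData_leadS D hH hHd (AdjoinRoot.of D.P)
    (AdjoinRoot.root D.P ^ D.t)).sigmaPull (s := D.s)
  -- The prescribed power of `x` is exactly the order of the transform, as the line has weight `m
  -- N`.
  have hM : D.q * D.m * D.P.natDegree * D.N = D.m * N := by rw [hN]; ring
  rw [hW, hM, divXPow_mul] at hG
  subst hG
  rw [Polynomial.pow_comp, hr, mul_pow] at hWr
  obtain ⟨h1, h2, h3, Q, hQ, hQ0⟩ := weierstrassPoly_spec hWr (by
    rw [Polynomial.coeff_zero_eq_eval_zero, Polynomial.eval_pow,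
      ← Polynomial.coeff_zero_eq_eval_zero]
    exact pow_ne_zero _ hr0)
  exact ⟨h1, h2, h3, Q, by rw [hW, ← hQ], hQ0⟩

end Step

/-! ### The minimal polynomials `φ_k`. -/

section MinimalPolynomial

variable {K L : Type u} [Field K] [Field L]

/-- Existence of the minimal polynomial of the centre. -/
lemma exists_irreducible {ε : K →+* L} {pull : K⟦X⟧[X] →+* L⟦X⟧[X]} {f : K⟦X⟧ →+* L⟦X⟧} {e : ℕ}
    {μ : L} {b n : ℕ} (h : IsFrame ε pull f e μ) (hf : Spans f n) (hn : 0 < n)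
    (hsmall : ∀ G : K⟦X⟧[X], G ≠ 0 → G.degree < (n : WithBot ℕ) →
      ∃ w c, c ≠ 0 ∧ IsMono b (pull G) w c) :
    ∃ p : K⟦X⟧[X], p.Monic ∧ Irreducible p ∧ p.natDegree = n ∧ (pull p).eval 0 = 0 := by
  obtain ⟨p, hp, hpd, hp0⟩ := hf.exists_monic ((pull Polynomial.X).eval 0)
  have hev : ∀ G : K⟦X⟧[X], (pull G).eval 0 = G.eval₂ f ((pull Polynomial.X).eval 0) := by
    intro G
    have : (Polynomial.evalRingHom 0).comp pull =
        Polynomial.eval₂RingHom f ((pull Polynomial.X).eval 0) := by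
      refine Polynomial.ringHom_ext (fun a => ?_) ?_
      · simp [h.pull_C]
      · simp
    exact congrArg (fun φ => φ G) this
  -- Polynomials of degree less than `n` do not vanish at the centre, so no proper factor of `p`
  -- can.
  have hsm : ∀ G : K⟦X⟧[X], G ≠ 0 → G.natDegree < n → (pull G).eval 0 ≠ 0 := by
    intro G hG hGd
    obtain ⟨w, c, hc, hm⟩ := hsmall G hG ((Polynomial.natDegree_lt_iff_degree_lt hG).1 hGd)
    exact eval_zero_ne_zero_of_isMono hm hc
  refine ⟨p, hp, ?_, hpd, by rw [hev, hp0]⟩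
  rw [hp.irreducible_iff_natDegree']
  refine ⟨fun h1 => ?_, fun g₁ g₂ hg₁ hg₂ hg hmem => ?_⟩
  · rw [h1, Polynomial.natDegree_one] at hpd
    omega
  · rw [Finset.mem_Ioc, hpd] at hmem
    have hd := hg₁.natDegree_mul hg₂
    rw [hg, hpd] at hd
    have h2 : (pull p).eval 0 = 0 := by rw [hev, hp0]
    rw [← hg, map_mul, Polynomial.eval_mul, mul_eq_zero] at h2
    rcases h2 with h2 | h2
    · exact hsm g₁ hg₁.ne_zero (by omega) h2
    · exact hsm g₂ hg₂.ne_zero (by omega) h2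

/-- Expand `Φ` in powers of `φ`. Its leading form is quasi-homogeneous of `y`-degree at most `q deg
P`, and vanishing at the centre makes `(z^t, z^s)` a zero of it. That zero is simple, so after
division by `y` the value at the origin is nonzero. -/
lemma exists_X_mul_isMono {P : L[X]} [Fact (Irreducible P)] (hP : P.Monic)
    (hP' : Polynomial.derivative P ≠ 0) (hz : AdjoinRoot.root P ≠ 0) {q m s t : ℕ} (hq : 0 < q)
    (hq' : (q : L) ≠ 0) (hqm : Nat.Coprime q m) (hst : q * s = m * t + 1)
    {G : (AdjoinRoot P)⟦X⟧[X]} (hG : PowerSeries.constantCoeff (shiftSeries G) = 0)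
    {pull : K⟦X⟧[X] →+* L⟦X⟧[X]} {b d v : ℕ} (hb : b ≤ m) {c : L} (hc : c ≠ 0)
    (hsmall : ∀ G : K⟦X⟧[X], G ≠ 0 → G.degree < (d : WithBot ℕ) →
      ∃ w c, c ≠ 0 ∧ IsMono b (pull G) w c)
    {φ : K⟦X⟧[X]} (hφ : φ.Monic) (hφd : φ.natDegree = d) (hφY : YLike b q m (pull φ) v c)
    {Φ : K⟦X⟧[X]} (hΦ : Φ ≠ 0)
    (hΦd : Φ.degree < (((q * P.natDegree + 1) * d : ℕ) : WithBot ℕ))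
    (h0 : (stepPull (AdjoinRoot.of P) (AdjoinRoot.root P) q m s t hq G (pull Φ)).eval 0 = 0) :
    ∃ A w c', c' ≠ 0 ∧ IsMono 1 A w c' ∧
      stepPull (AdjoinRoot.of P) (AdjoinRoot.root P) q m s t hq G (pull Φ) =
        Polynomial.X * A := by
  classical
  obtain ⟨g, hg, hgs⟩ := exists_adic_expansion hφ (q * P.natDegree + 1) Φ (by rwa [hφd])
  rw [hφd] at hg
  set I := (Finset.range (q * P.natDegree + 1)).filter fun i => g i ≠ 0 with hI
  have hsum : Φ = ∑ i ∈ I, g i * φ ^ i := by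
    rw [hgs, hI, Finset.sum_filter_of_ne]
    intro i _ h1 h2
    rw [h2, zero_mul] at h1
    exact h1 rfl
  have hIne : I.Nonempty := by
    rw [Finset.nonempty_iff_ne_empty]
    intro h1
    rw [h1, Finset.sum_empty] at hsum
    exact hΦ hsum
  have hex : ∀ i, ∃ w c', g i ≠ 0 → c' ≠ 0 ∧ IsMono b (pull (g i)) w c' := by
    intro i
    by_cases h1 : g i = 0
    · exact ⟨0, 0, fun h2 => absurd h1 h2⟩
    · obtain ⟨w, c', h2, h3⟩ := hsmall (g i) h1 (hg i)
      exact ⟨w, c', fun _ => ⟨h2, h3⟩⟩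
  choose w γ hwγ using hex
  set u := AdjoinRoot.root P ^ t with hu
  set J : ℕ → ℕ := fun i => w i + i * v with hJ
  set κ : ℕ → L := fun i => γ i * c ^ i with hκ
  have hgi : ∀ i ∈ I, g i ≠ 0 := fun i hi => (Finset.mem_filter.1 hi).2
  have hterm : ∀ i ∈ I, LeadS (wt u q m hq (baseChange (AdjoinRoot.of P) (pull (g i * φ ^ i))))
      (q * J i + m * i)
      (Polynomial.C (AdjoinRoot.of P (κ i) * u ^ J i) * Polynomial.X ^ i) := by
    intro i hi
    have h1 := ((hwγ i (hgi i hi)).2.baseChange (AdjoinRoot.of P)).wt hq hb u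
    have h2 := (hφY.baseChange (AdjoinRoot.of P)).wt hq hb u
    have h3 := Lead.mul h1 (Lead.pow h2 i)
    rw [map_mul, map_mul, map_mul, map_pow, map_pow, map_pow]
    convert h3 using 1
    · rw [hJ]; ring
    · simp only [hJ, hκ, map_mul, map_pow, mul_pow, pow_add]
      ring
  obtain ⟨i₀, hi₀, hmin⟩ := Finset.exists_min_image I (fun i => q * J i + m * i) hIne
  set M := q * J i₀ + m * i₀ with hM
  have hlead := Lead.sum_ite (n := M) (t := (PowerSeries.X : (AdjoinRoot P)[X]⟦X⟧)) (by simp) I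
    hterm hmin
  rw [← map_sum, ← map_sum, ← map_sum, ← hsum, ← Finset.sum_filter] at hlead
  set I' := I.filter fun i => q * J i + m * i = M with hI'
  set p : (AdjoinRoot P)[X] :=
    ∑ i ∈ I', Polynomial.C (AdjoinRoot.of P (κ i) * u ^ J i) * Polynomial.X ^ i with hp
  obtain ⟨B, hB, hBp⟩ := leadX_stepPull (s := s) hG hlead
  -- Vanishing at `y = 0` makes the cofactor of `x^M` divisible by `y`.
  rw [hB, Polynomial.eval_mul, Polynomial.eval_pow, Polynomial.eval_C, mul_eq_zero,
    or_iff_right (pow_ne_zero _ PowerSeries.X_ne_zero),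
    ← Polynomial.coeff_zero_eq_eval_zero, ← Polynomial.X_dvd_iff] at h0
  obtain ⟨B', rfl⟩ := h0
  have hX : red (Polynomial.X : (AdjoinRoot P)⟦X⟧[X]) = Polynomial.X := by simp [red]
  rw [map_mul, hX] at hBp
  have hpev : ∀ i, AdjoinRoot.of P (κ i) * u ^ J i * (AdjoinRoot.root P ^ s) ^ i =
      AdjoinRoot.of P (κ i) * AdjoinRoot.root P ^ (t * J i + s * i) := by
    intro i
    rw [hu, mul_assoc, ← pow_mul, ← pow_mul, ← pow_add]
  have hroot : p.eval (AdjoinRoot.root P ^ s) = 0 := by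
    have h1 := congrArg (Polynomial.eval 0) hBp
    rw [Polynomial.eval_mul, Polynomial.eval_X, zero_mul, Polynomial.eval_comp] at h1
    simpa using h1.symm
  obtain ⟨r, hr, hr0⟩ := exists_comp_eq_X_mul hroot
  rw [hr] at hBp
  have hrB : red B' = r := mul_left_cancel₀ Polynomial.X_ne_zero hBp
  refine ⟨Polynomial.C PowerSeries.X ^ M * B', M, r.coeff 0, ?_,
    isMono_one_of_leadX ⟨B', rfl, hrB⟩, by rw [hB]; ring⟩
  have hmem : ∀ i ∈ I', i ∈ I ∧ q * J i + m * i = M := fun i hi => Finset.mem_filter.1 hi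
  have hfin := sum_mul_ne_zero_of_root hP hP' hz hq hq' hqm hst I' κ J
    (fun i hi => (hmem i hi).2)
    (fun i hi => Nat.lt_succ_iff.1 (Finset.mem_range.1 (Finset.mem_filter.1 (hmem i hi).1).1))
    ⟨i₀, Finset.mem_filter.2 ⟨hi₀, rfl⟩,
      mul_ne_zero (hwγ i₀ (hgi i₀ hi₀)).1 (pow_ne_zero _ hc)⟩
    (by
      rw [hp, Polynomial.eval_finsetSum] at hroot
      rw [← hroot]
      refine Finset.sum_congr rfl fun i _ => ?_
      rw [← hpev]
      simp)
  rw [hr0]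
  intro h1
  apply hfin
  -- The operator `y ∂/∂y` multiplies the term in `y^i` by `i`, giving the sum of
  -- `sum_mul_ne_zero_of_root`.
  have h2 : (Polynomial.X * Polynomial.derivative p).eval (AdjoinRoot.root P ^ s) = 0 := by
    rw [Polynomial.eval_mul, h1, mul_zero]
  rw [hp, Polynomial.derivative_sum, Finset.mul_sum, Polynomial.eval_finsetSum] at h2
  rw [← h2]
  refine Finset.sum_congr rfl fun i _ => ?_
  rw [← hpev]
  rcases i with _ | i
  · rw [Polynomial.derivative_C_mul]
    simp
  · rw [Polynomial.derivative_C_mul, Polynomial.derivative_X_pow]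
    simp only [Polynomial.eval_mul, Polynomial.eval_X, Polynomial.eval_C, Polynomial.eval_pow,
      Nat.add_sub_cancel]
    ring

end MinimalPolynomial

/-! ### The invariant of a stage, and stage 0. -/

section Stages

variable {K : Type u} [Field K] {F : K⟦X⟧[X]} {k : ℕ} {S : Stage K}

lemma stage_succ (h : (stage F k).Continues) : stage F (k + 1) = (stage F k).next h.2.some := by
  rw [stage]
  exact dif_pos h

lemma stage_q_l_pos (F : K⟦X⟧[X]) (k : ℕ) : 0 < (stage F k).q ∧ 0 < (stage F k).l := by
  induction k with
  | zero => exact ⟨one_pos, one_pos⟩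
  | succ k ih =>
    by_cases h : (stage F k).Continues
    · rw [stage_succ h]
      exact ⟨h.2.some.q_pos, h.2.some.irreducible.natDegree_pos⟩
    · rw [stage, dif_neg h]
      exact ih

lemma dk_pos (F : K⟦X⟧[X]) (k : ℕ) : 0 < dk F k :=
  Nat.mul_pos (Finset.prod_pos fun i _ => (stage_q_l_pos F i).1)
    (Finset.prod_pos fun i _ => (stage_q_l_pos F i).2)

lemma dk_succ (F : K⟦X⟧[X]) (k : ℕ) : dk F (k + 1) = ql F (k + 1) * dk F k := by
  rw [dk, dk, ql, Finset.prod_Icc_succ_top (by omega), Finset.prod_Icc_succ_top (by omega)]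
  ring

lemma dk_zero (F : K⟦X⟧[X]) : dk F 0 = 1 := by simp [dk]

/-- Uniqueness of the minimal polynomial plays no role: any polynomial with the defining properties
will do. -/
lemma phi_spec (hS : stage F k = S)
    (h : ∃ p : K⟦X⟧[X], p.Monic ∧ Irreducible p ∧ p.natDegree = dk F k ∧ (S.pull p).eval 0 = 0) :
    (phi F k).Monic ∧ (phi F k).natDegree = dk F k ∧ (S.pull (phi F k)).eval 0 = 0 := by
  subst hS
  rw [phi, dif_pos h]
  exact ⟨h.choose_spec.1, h.choose_spec.2.2⟩

/-- The data that describe the stage `S = stage F k`: the valuations `V` and the initial coefficients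
`Λ` of `φ_0, …, φ_k`, the parametrization `x ↦ μ x^e`, and the relation of `H_k` with `F`. -/
structure Invariant (F : K⟦X⟧[X]) (k : ℕ) (S : Stage K) where
  b : ℕ
  e : ℕ
  μ : S.L
  f : K⟦X⟧ →+* S.L⟦X⟧
  V : ℕ → ℕ
  Λ : ℕ → S.L
  vF : ℕ
  U : S.L⟦X⟧[X]
  cU : S.L
  b_le : b ≤ 1
  red_H : b = 0 ∨ red S.H = Polynomial.X ^ S.N
  frame : IsFrame S.emb S.pull f e μ
  spans : Spans f (dk F k)
  N_pos : 0 < S.N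
  monic : S.H.Monic
  natDegree_H : S.H.natDegree = S.N
  coeff_pred : S.H.coeff (S.N - 1) = 0
  natDegree_F : F.natDegree = S.N * dk F k
  pull_F : S.pull F = Polynomial.C PowerSeries.X ^ vF * S.H * U
  isMono_U : IsMono b U 0 cU
  cU_ne : cU ≠ 0
  isMono_phi : ∀ i < k, IsMono b (S.pull (phi F i)) (V i) (Λ i)
  isMono_psi : ∀ i < k, IsMono b (S.pull (psi F i)) (V i) (Λ i)
  Λ_ne : ∀ i ≤ k, Λ i ≠ 0
  phi_monic : ∀ i ≤ k, (phi F i).Monic ∧ (phi F i).natDegree = dk F i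
  psi_monic : ∀ i < k, (psi F i).Monic ∧ (psi F i).natDegree = dk F i
  indep : IndepMonomials S.emb e μ k V Λ fun i => ql F (i + 1)
  phi_last : ∃ A, S.pull (phi F k) = Polynomial.X * A ∧ IsMono b A (V k) (Λ k)

namespace Invariant

lemma isMono_of_degree_lt (I : Invariant F k S) (G : K⟦X⟧[X]) (hG : G ≠ 0)
    (hd : G.degree < (dk F k : WithBot ℕ)) : ∃ w c, c ≠ 0 ∧ IsMono I.b (S.pull G) w c :=
  I.frame.exists_isMono I.isMono_phi I.indep (fun i hi => I.phi_monic i hi.le)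
    (fun i _ => dk_pos F i) (fun i _ => dk_succ F i) hG hd

lemma phi_yLike (I : Invariant F k S) {α β : ℕ} (hα : 0 < α) :
    YLike I.b α β (S.pull (phi F k)) (I.V k) (I.Λ k) := by
  obtain ⟨A, hA, hm⟩ := I.phi_last
  rw [hA]
  exact YLike.of_X_mul hα hm

lemma N_le (I : Invariant F k S) : S.N ≤ F.natDegree := by
  rw [I.natDegree_F]
  exact Nat.le_mul_of_pos_right _ (dk_pos F k)

lemma psi_spec (I : Invariant F k S) (hS : stage F k = S) (hF : F.Monic)
    (hn : ∀ n, 0 < n → n ≤ F.natDegree → (n : K) ≠ 0) {α β : ℕ} (hα : 0 < α) (hb : I.b ≤ β)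
    (hHl : ∀ i j, α * j + β * i < β * S.N → PowerSeries.coeff j (S.H.coeff i) = 0) :
    (psi F k).Monic ∧ (psi F k).natDegree = dk F k ∧
      YLike I.b α β (S.pull (psi F k)) (I.V k) (I.Λ k) := by
  obtain ⟨n, hN⟩ : ∃ n, S.N = n + 1 := ⟨S.N - 1, by have := I.N_pos; omega⟩
  have hFd := I.natDegree_F
  rw [hN] at hFd hHl
  have hn' : ((n + 1 : ℕ) : K) ≠ 0 := hn _ n.succ_pos (hN ▸ I.N_le)
  have hc := I.coeff_pred
  rw [hN, Nat.add_sub_cancel] at hc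
  obtain ⟨ψ, h1, h2, h3, h4⟩ := exists_approxRoot_yLike hα hb hF (dk_pos F k) hFd hn'
    I.isMono_of_degree_lt I.pull_F I.isMono_U I.cU_ne I.monic (by rw [I.natDegree_H, hN]) hc hHl
    (I.Λ_ne k le_rfl) (I.phi_monic k le_rfl).1 (I.phi_monic k le_rfl).2 (I.phi_yLike hα)
  have h5 : psi F k = ψ := by
    rw [psi, hS, hN]
    exact approxRoot_eq hFd hn' h1 h2 h4
  rw [h5]
  exact ⟨h1, h2, h3⟩

end Invariant

/-- Here `φ_0 = y - c(x)` pulls back to `y`, so all units are 1 and all orders are 0. -/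
lemma invariant_zero (hF : F.Monic) (hd : 0 < F.natDegree)
    (hn : ∀ n, 0 < n → n ≤ F.natDegree → (n : K) ≠ 0) :
    Nonempty (Invariant F 0 (stage F 0)) := by
  obtain ⟨n, hN⟩ : ∃ n, F.natDegree = n + 1 := ⟨F.natDegree - 1, by omega⟩
  obtain ⟨h1, h2, h3⟩ := coeff_tauPull_self hF hN (hn _ n.succ_pos hN.ge)
  have hframe : IsFrame (RingHom.id K) (tauPull F) (RingHom.id K⟦X⟧) 1 1 :=
    { pull_C := fun a => by simp [tauPull]
      f_C := fun c => rfl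
      f_X := by simp
      e_pos := one_pos
      μ_ne := one_ne_zero }
  have hindep : IndepMonomials (RingHom.id K) 1 1 0 (fun _ => 0) (fun _ => (1 : K))
      fun i => ql F (i + 1) := indepMonomials_zero _ one_pos one_ne_zero _ _ _
  have hex : ∃ p : K⟦X⟧[X], p.Monic ∧ Irreducible p ∧ p.natDegree = dk F 0 ∧
      (tauPull F p).eval 0 = 0 := by
    rw [dk_zero]
    refine ⟨Polynomial.X - Polynomial.C (shiftSeries F), Polynomial.monic_X_sub_C _,
      Polynomial.irreducible_X_sub_C _, Polynomial.natDegree_X_sub_C _, ?_⟩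
    simp [tauPull]
  obtain ⟨hm, hmd, h0⟩ := phi_spec (F := F) (k := 0) (S := Stage.init F) rfl hex
  have hpull : tauPull F F = Polynomial.C PowerSeries.X ^ 0 * tauPull F F * 1 := by
    rw [pow_zero, one_mul, mul_one]
  have hlast : tauPull F (phi F 0) = Polynomial.X * 1 := by
    rw [mul_one]
    rw [dk_zero] at hmd
    have h4 : phi F 0 = Polynomial.X + Polynomial.C ((phi F 0).coeff 0) :=
      hm.eq_X_add_C hmd
    replace h0 : (tauPull F (phi F 0)).eval 0 = 0 := h0
    rw [h4] at h0 ⊢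
    simp only [tauPull, Polynomial.coe_compRingHom_apply, Polynomial.add_comp, Polynomial.X_comp,
      Polynomial.C_comp, Polynomial.eval_add, Polynomial.eval_X, Polynomial.eval_C, zero_add] at h0 ⊢
    rw [add_assoc, ← Polynomial.C_add, h0, Polynomial.C_0, add_zero]
  exact ⟨{
    b := 0
    e := 1
    μ := (1 : K)
    f := RingHom.id K⟦X⟧
    V := fun _ => 0
    Λ := fun _ => (1 : K)
    vF := 0
    U := (1 : K⟦X⟧[X])
    cU := (1 : K)
    b_le := zero_le_one
    red_H := Or.inl rfl
    frame := hframe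
    spans := by rw [dk_zero]; exact Spans.id
    N_pos := hd
    monic := h1
    natDegree_H := h2.trans hN.symm
    coeff_pred := by
      change (tauPull F F).coeff (F.natDegree - 1) = 0
      rw [hN]; exact h3
    natDegree_F := by rw [dk_zero, mul_one]; rfl
    pull_F := hpull
    isMono_U := IsMono.one (L := K)
    cU_ne := one_ne_zero (α := K)
    isMono_phi := fun i hi => absurd hi i.not_lt_zero
    isMono_psi := fun i hi => absurd hi i.not_lt_zero
    Λ_ne := fun _ _ => one_ne_zero (α := K)
    phi_monic := fun i hi => by
      obtain rfl := Nat.le_zero.1 hi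
      exact ⟨hm, hmd⟩
    psi_monic := fun i hi => absurd hi i.not_lt_zero
    indep := hindep
    phi_last := ⟨(1 : K⟦X⟧[X]), hlast, IsMono.one (L := K)⟩ }⟩

end Stages

/-! ### The induction from one stage to the next. -/

section Next

variable {K : Type u} [Field K] {F : K⟦X⟧[X]} {k : ℕ} {S : Stage K}

/-- After stage 0 the polynomial reduces to `y^N` at `x = 0`. An edge of slope 0 would give it a
nonzero value at the origin. -/
lemma Invariant.b_le_m (I : Invariant F k S) (D : EdgeData S.H) : I.b ≤ D.m := by
  rcases I.red_H with h | h
  · omega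
  · rcases Nat.eq_zero_or_pos D.m with h0 | h0
    · exfalso
      have h1 := edgeData_coeff_zero D I.monic I.natDegree_H
      rw [h0, zero_mul, zero_mul] at h1
      apply h1
      have h2 := congrArg (fun p => p.coeff 0) h
      simp only [Polynomial.coeff_X_pow, if_neg I.N_pos.ne] at h2
      rw [← h2, red, Polynomial.coe_mapRingHom, Polynomial.coeff_map,
        PowerSeries.coeff_zero_eq_constantCoeff]
    · exact I.b_le.trans h0

lemma IsFrame.step {L : Type u} [Field L] {P : L[X]} [Fact (Irreducible P)]
    (hz : AdjoinRoot.root P ≠ 0) {q m s t : ℕ} (hq : 0 < q) (G : (AdjoinRoot P)⟦X⟧[X])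
    {ε : K →+* L} {pull : K⟦X⟧[X] →+* L⟦X⟧[X]} {f : K⟦X⟧ →+* L⟦X⟧} {e : ℕ} {μ : L}
    (h : IsFrame ε pull f e μ) :
    IsFrame ((AdjoinRoot.of P).comp ε)
      ((stepPull (AdjoinRoot.of P) (AdjoinRoot.root P) q m s t hq G).comp pull)
      (((scaleX (AdjoinRoot.root P) t q hq).comp (PowerSeries.map (AdjoinRoot.of P))).comp f)
      (q * e) (AdjoinRoot.of P μ * AdjoinRoot.root P ^ (t * e)) where
  pull_C a := by
    rw [RingHom.comp_apply, h.pull_C, stepPull_C]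
    rfl
  f_C c := by
    rw [RingHom.comp_apply, RingHom.comp_apply, h.f_C, PowerSeries.map_C, scaleX_C]
    rfl
  f_X := by
    rw [RingHom.comp_apply, RingHom.comp_apply, h.f_X, map_mul, map_pow, PowerSeries.map_C,
      PowerSeries.map_X, map_mul, map_pow, scaleX_C, scaleX_X, mul_pow, ← pow_mul, ← map_pow,
      ← pow_mul, ← mul_assoc, ← map_mul]
  e_pos := Nat.mul_pos hq h.e_pos
  μ_ne := mul_ne_zero ((map_ne_zero _).2 h.μ_ne) (pow_ne_zero _ hz)

/-- Leading terms are evaluated at `(z^t, z^s)`: those known before are multiplied by powers of `z`,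
those of `φ_k` and `ψ_k` become monomials with the same data, and `φ_{k+1}` provides the new
coordinate. -/
lemma Invariant.next (I : Invariant F k S) (hS : stage F k = S) (hF : F.Monic)
    (hn : ∀ n, 0 < n → n ≤ F.natDegree → (n : K) ≠ 0) (D : EdgeData S.H)
    (hS' : stage F (k + 1) = S.next D) : Nonempty (Invariant F (k + 1) (S.next D)) := by
  have : Fact (Irreducible D.P) := ⟨D.irreducible⟩
  obtain ⟨hN, hlow, -, hP0⟩ := edgeData_spec D I.monic I.natDegree_H
  have hz : AdjoinRoot.root D.P ≠ 0 := root_ne_zero_of_coeff_zero hP0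
  have hNpos := I.N_pos
  have hlpos : 0 < D.P.natDegree := D.irreducible.natDegree_pos
  have hDN : 0 < D.N := by
    rcases Nat.eq_zero_or_pos D.N with h | h
    · rw [h, mul_zero] at hN; omega
    · exact h
  have hle1 : D.q ≤ S.N := by
    rw [hN, mul_assoc]
    exact Nat.le_mul_of_pos_right _ (Nat.mul_pos hlpos hDN)
  have hle2 : D.P.natDegree ≤ S.N := by
    rw [hN, mul_comm D.q, mul_assoc]
    exact Nat.le_mul_of_pos_right _ (Nat.mul_pos D.q_pos hDN)
  have hle3 : D.N ≤ S.N := by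
    rw [hN]
    exact Nat.le_mul_of_pos_left _ (Nat.mul_pos D.q_pos hlpos)
  have hcast : ∀ n, 0 < n → n ≤ S.N → (n : S.L) ≠ 0 := by
    intro n h1 h2
    rw [← map_natCast S.emb]
    exact (map_ne_zero _).2 (hn n h1 (h2.trans I.N_le))
  -- The degree of `P` is at most that of `F`, hence invertible, so the leading coefficient of the
  -- derivative is nonzero.
  have hP' : Polynomial.derivative D.P ≠ 0 := by
    intro h0
    have h1 := Polynomial.coeff_derivative D.P (D.P.natDegree - 1)
    rw [h0, Polynomial.coeff_zero, Nat.sub_add_cancel hlpos, Polynomial.coeff_natDegree,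
      D.monic.leadingCoeff, one_mul, ← Nat.cast_succ, Nat.succ_eq_add_one,
      Nat.sub_add_cancel hlpos] at h1
    exact hcast _ hlpos hle2 h1.symm
  have hq' : (D.q : S.L) ≠ 0 := hcast _ D.q_pos hle1
  have hb := I.b_le_m D
  obtain ⟨G, hG⟩ : ∃ G, G = weierstrassPoly (divXPow (D.q * D.m * D.P.natDegree * D.N)
      (sigmaPull (AdjoinRoot.root D.P) D.q D.m D.s D.t D.q_pos
        (baseChange (AdjoinRoot.of D.P) S.H))) := ⟨_, rfl⟩
  obtain ⟨hGm, hGd, hGr, Q, hQ, hQ0⟩ := weierstrass_step D I.monic I.natDegree_H hP' hq' hG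
  have hGs := constantCoeff_shiftSeries hDN hGd hGr
  obtain ⟨n, hn1⟩ : ∃ n, D.N = n + 1 := ⟨D.N - 1, by omega⟩
  have hcastN : ((n + 1 : ℕ) : AdjoinRoot D.P) ≠ 0 := by
    rw [← hn1, ← map_natCast (AdjoinRoot.of D.P)]
    exact (map_ne_zero _).2 (hcast _ hDN hle3)
  obtain ⟨hHm, hHd, hHc⟩ := coeff_tauPull_self hGm (hGd.trans hn1) hcastN
  obtain ⟨T, hT⟩ : ∃ T, T = stepPull (AdjoinRoot.of D.P) (AdjoinRoot.root D.P) D.q D.m D.s D.t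
      D.q_pos G := ⟨_, rfl⟩
  have hnext : S.next D =
      { L := AdjoinRoot D.P
        emb := (AdjoinRoot.of D.P).comp S.emb
        N := D.N
        H := tauPull G G
        pull := T.comp S.pull
        q := D.q
        l := D.P.natDegree } := by
    rw [hT, hG]
    rfl
  have hql : ql F (k + 1) = D.q * D.P.natDegree := by rw [ql, hS']; rfl
  rw [hnext] at hS' ⊢
  have hframe := I.frame.step hz D.q_pos G (m := D.m) (s := D.s) (t := D.t)
  rw [← hT] at hframe
  have hspans := I.spans.comp (spans_step D.monic hz (t := D.t) D.q_pos)
  rw [mul_comm (dk F k), ← hql, ← dk_succ] at hspans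
  set z := AdjoinRoot.root D.P with hzdef
  -- Only indices up to `k` matter here; the entry for `k + 1` is inserted once `φ_{k+1}` is known.
  set V₀ : ℕ → ℕ := fun i => if i < k then D.q * I.V i else D.q * I.V k + D.m with hV₀
  set Λ₀ : ℕ → AdjoinRoot D.P := fun i =>
    if i < k then AdjoinRoot.of D.P (I.Λ i) * z ^ (D.t * I.V i)
    else AdjoinRoot.of D.P (I.Λ k) * z ^ (D.t * I.V k + D.s) with hΛ₀
  have hΛ₀ne : ∀ i ≤ k, Λ₀ i ≠ 0 := by
    intro i hi
    simp only [hΛ₀]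
    split_ifs with h
    · exact mul_ne_zero ((map_ne_zero _).2 (I.Λ_ne i hi)) (pow_ne_zero _ hz)
    · exact mul_ne_zero ((map_ne_zero _).2 (I.Λ_ne k le_rfl)) (pow_ne_zero _ hz)
  have hindep : IndepMonomials ((AdjoinRoot.of D.P).comp S.emb) (D.q * I.e)
      (AdjoinRoot.of D.P I.μ * z ^ (D.t * I.e)) (k + 1) V₀ Λ₀ fun i => ql F (i + 1) :=
    indepMonomials_succ D.monic hz D.q_pos D.coprime D.bezout (I.Λ_ne k le_rfl) I.indep
      (fun i hi => if_pos hi) (if_neg (lt_irrefl k)) (fun i hi => if_pos hi)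
      (if_neg (lt_irrefl k)) rfl hql
  have hlift : ∀ θ : ℕ → K⟦X⟧[X], (∀ i < k, IsMono I.b (S.pull (θ i)) (I.V i) (I.Λ i)) →
      YLike I.b D.q D.m (S.pull (θ k)) (I.V k) (I.Λ k) →
      ∀ i < k + 1, IsMono 1 ((T.comp S.pull) (θ i)) (V₀ i) (Λ₀ i) := by
    intro θ h1 h2 i hi
    rw [RingHom.comp_apply, hT]
    simp only [hV₀, hΛ₀]
    split_ifs with h
    · exact (h1 i h).stepPull hGs hb
    · obtain rfl : i = k := by omega
      exact h2.stepPull hGs hb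
  -- For the weights of the edge, `ψ_k` and `φ_k` have the same leading term, so they acquire the
  -- same data at the new stage.
  obtain ⟨hψ1, hψ2, hψ3⟩ := I.psi_spec hS hF hn D.q_pos hb hlow
  have hphi := hlift (phi F) I.isMono_phi (I.phi_yLike D.q_pos)
  have hpsi := hlift (psi F) I.isMono_psi hψ3
  have hsmall : ∀ G : K⟦X⟧[X], G ≠ 0 → G.degree < (dk F (k + 1) : WithBot ℕ) →
      ∃ w c, c ≠ 0 ∧ IsMono 1 ((T.comp S.pull) G) w c := fun G h1 h2 =>
    hframe.exists_isMono hphi hindep (fun i hi => I.phi_monic i (Nat.lt_succ_iff.1 hi))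
      (fun i _ => dk_pos F i) (fun i _ => dk_succ F i) h1 h2
  obtain ⟨hφ1, hφ2, hφ3⟩ := phi_spec hS'
    (exists_irreducible hframe hspans (dk_pos F (k + 1)) hsmall)
  have hφdeg : (phi F (k + 1)).degree <
      (((D.q * D.P.natDegree + 1) * dk F k : ℕ) : WithBot ℕ) := by
    rw [Polynomial.degree_eq_natDegree hφ1.ne_zero, hφ2, dk_succ, hql, Nat.cast_lt]
    exact Nat.mul_lt_mul_of_pos_right (Nat.lt_succ_self _) (dk_pos F k)
  have hφ3' : (stepPull (AdjoinRoot.of D.P) (AdjoinRoot.root D.P) D.q D.m D.s D.t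
      D.q_pos G (S.pull (phi F (k + 1)))).eval 0 = 0 := by
    rw [← hT]; exact hφ3
  obtain ⟨A, w, c, hc, hA, hAe⟩ := exists_X_mul_isMono D.monic hP' hz D.q_pos hq' D.coprime
    D.bezout hGs hb (I.Λ_ne k le_rfl) I.isMono_of_degree_lt (I.phi_monic k le_rfl).1
    (I.phi_monic k le_rfl).2 (I.phi_yLike D.q_pos) hφ1.ne_zero hφdeg hφ3'
  rw [← hT] at hAe
  have hUQ := isMono_one_of_leadX (v := 0) (A := tauPull G Q)
    ⟨tauPull G Q, by rw [pow_zero, one_mul], red_tauPull hGs Q⟩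
  have hUU := I.isMono_U.stepPull (f := AdjoinRoot.of D.P) (z := z) (s := D.s) (t := D.t)
    (hq := D.q_pos) hGs hb
  rw [mul_zero, mul_zero, pow_zero, mul_one, ← hT] at hUU
  have hTX : T (Polynomial.C PowerSeries.X) = Polynomial.C PowerSeries.X ^ D.q *
      Polynomial.C (PowerSeries.C (z ^ D.t)) := by
    rw [hT, stepPull_C, PowerSeries.map_X, scaleX_X, Polynomial.C_mul, Polynomial.C_pow, mul_comm]
  have hTH : T S.H = Polynomial.C PowerSeries.X ^ (D.m * S.N) * (tauPull G G * tauPull G Q) := by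
    rw [hT, stepPull, RingHom.comp_apply, RingHom.comp_apply, hQ, map_mul, map_mul, map_pow]
    congr 2
    simp [tauPull]
  have hpull : (T.comp S.pull) F = Polynomial.C PowerSeries.X ^ (D.q * I.vF + D.m * S.N) *
      tauPull G G * (Polynomial.C (PowerSeries.C (z ^ D.t)) ^ I.vF * tauPull G Q * T I.U) := by
    rw [RingHom.comp_apply, I.pull_F, map_mul, map_mul, map_pow, hTX, hTH]
    ring
  have hU' := (((IsMono.C_constant (b := 1) (z ^ D.t)).pow I.vF).mul hUQ).mul hUU
  have hredH : red (tauPull G G) = Polynomial.X ^ D.N := by rw [red_tauPull hGs, hGr]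
  have hne : ∀ i < k + 1, i ≠ k + 1 := fun i hi => hi.ne
  have hFd : F.natDegree = D.N * dk F (k + 1) := by
    rw [I.natDegree_F, dk_succ, hql, hN]
    ring
  refine ⟨{
    b := 1
    e := D.q * I.e
    μ := AdjoinRoot.of D.P I.μ * z ^ (D.t * I.e)
    f := _
    V := Function.update V₀ (k + 1) w
    Λ := Function.update Λ₀ (k + 1) c
    vF := D.q * I.vF + D.m * S.N
    U := Polynomial.C (PowerSeries.C (z ^ D.t)) ^ I.vF * tauPull G Q * T I.U
    cU := _
    b_le := le_rfl
    red_H := Or.inr hredH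
    frame := hframe
    spans := hspans
    N_pos := hDN
    monic := hHm
    natDegree_H := hHd.trans hn1.symm
    coeff_pred := ?_
    natDegree_F := hFd
    pull_F := hpull
    isMono_U := hU'
    cU_ne := ?_
    isMono_phi := fun i hi => ?_
    isMono_psi := fun i hi => ?_
    Λ_ne := fun i hi => ?_
    phi_monic := fun i hi => ?_
    psi_monic := fun i hi => ?_
    indep := ?_
    phi_last := ⟨A, hAe, ?_⟩ }⟩
  · change (tauPull G G).coeff (D.N - 1) = 0
    rw [hn1]
    exact hHc
  · exact mul_ne_zero (mul_ne_zero (pow_ne_zero _ (pow_ne_zero _ hz)) hQ0)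
      ((map_ne_zero _).2 I.cU_ne)
  · rw [Function.update_of_ne (hne i hi), Function.update_of_ne (hne i hi)]
    exact hphi i hi
  · rw [Function.update_of_ne (hne i hi), Function.update_of_ne (hne i hi)]
    exact hpsi i hi
  · rcases hi.lt_or_eq with hi | rfl
    · rw [Function.update_of_ne (hne i hi)]
      exact hΛ₀ne i (Nat.lt_succ_iff.1 hi)
    · rw [Function.update_self]
      exact hc
  · rcases hi.lt_or_eq with hi | rfl
    · exact I.phi_monic i (Nat.lt_succ_iff.1 hi)
    · exact ⟨hφ1, hφ2⟩
  · rcases (Nat.lt_succ_iff.1 hi).lt_or_eq with hi | rfl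
    · exact I.psi_monic i hi
    · exact ⟨hψ1, hψ2⟩
  · exact indepMonomials_congr (fun i hi => (Function.update_of_ne (hne i hi) _ _).symm)
      (fun i hi => (Function.update_of_ne (hne i hi) _ _).symm) (fun _ _ => rfl) hindep
  · rw [Function.update_self, Function.update_self]
    exact hA

lemma continues_of_lt_length (h : k < length F) : (stage F k).Continues := by
  by_contra h1
  exact Nat.notMem_of_lt_sInf h h1

theorem invariant_stage (hF : F.Monic) (hd : 0 < F.natDegree)
    (hn : ∀ n, 0 < n → n ≤ F.natDegree → (n : K) ≠ 0) (k : ℕ) (hk : k ≤ length F) :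
    Nonempty (Invariant F k (stage F k)) := by
  induction k with
  | zero => exact invariant_zero hF hd hn
  | succ k ih =>
    obtain ⟨I⟩ := ih (by omega)
    have h1 := stage_succ (continues_of_lt_length (F := F) (k := k) (by omega))
    rw [h1]
    exact I.next rfl hF hn _ h1

end Next

/-! ### Valuations and trailing coefficients of monomials. -/

section Valuations

variable {L : Type u} [Field L] {A : L⟦X⟧[X]} {b v : ℕ} {c : L}

lemma IsMono.xVal_trailingCoeff (h : IsMono b A v c) (hc : c ≠ 0) :
    xVal A = v ∧ (initialPart A).trailingCoeff = c := by
  obtain ⟨g, hg, hgc⟩ := h.leadX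
  subst hgc
  have hg0 : g ≠ 0 := fun h0 => hc (by rw [h0, Polynomial.coeff_zero])
  exact ⟨xVal_eq hg hg0, by rw [initialPart_eq hg hg0, trailingCoeff_of_coeff_zero_ne hc]⟩

lemma IsMono.xVal_trailingCoeff_X_mul (h : IsMono b A v c) (hc : c ≠ 0) :
    xVal (Polynomial.X * A) = v ∧ (initialPart (Polynomial.X * A)).trailingCoeff = c := by
  obtain ⟨g, hg, hgc⟩ := h.leadX
  subst hgc
  have hg0 : Polynomial.X * g ≠ 0 :=
    mul_ne_zero Polynomial.X_ne_zero fun h0 => hc (by rw [h0, Polynomial.coeff_zero])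
  have hX : LeadX (Polynomial.X * A) v (Polynomial.X * g) := by
    obtain ⟨B, rfl, rfl⟩ := hg
    exact ⟨Polynomial.X * B, by ring, by rw [map_mul]; simp [red]⟩
  exact ⟨xVal_eq hX hg0, by rw [initialPart_eq hX hg0, trailingCoeff_X_mul hc]⟩

lemma IsMono.unique {v₁ v₂ : ℕ} {c₁ c₂ : L} (h₁ : IsMono b A v₁ c₁) (h₂ : IsMono b A v₂ c₂)
    (hc₁ : c₁ ≠ 0) (hc₂ : c₂ ≠ 0) : v₁ = v₂ ∧ c₁ = c₂ := by
  obtain ⟨h3, h4⟩ := Lead.unique (redAt_CX b) (Polynomial.C_ne_zero.2 PowerSeries.X_ne_zero) h₁ h₂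
    (Polynomial.C_ne_zero.2 hc₁) (Polynomial.C_ne_zero.2 hc₂)
  exact ⟨h3, Polynomial.C_injective h4⟩

end Valuations

/-! ### The expansion of `F` along the approximate roots. -/

section Expansions

variable {K : Type u} [Field K] {F : K⟦X⟧[X]} {k : ℕ}

namespace Invariant

lemma vk_lam_X (I : Invariant F k (stage F k)) :
    vk F k (Polynomial.C PowerSeries.X) = I.e ∧ lam F k (Polynomial.C PowerSeries.X) = I.μ :=
  (I.frame.isMono_X I.b).xVal_trailingCoeff I.frame.μ_ne

lemma vk_lam_phi (I : Invariant F k (stage F k)) {i : ℕ} (hi : i ≤ k) :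
    vk F k (phi F i) = I.V i ∧ lam F k (phi F i) = I.Λ i := by
  rcases hi.lt_or_eq with h | rfl
  · exact (I.isMono_phi i h).xVal_trailingCoeff (I.Λ_ne i hi)
  · obtain ⟨A, hA, hm⟩ := I.phi_last
    rw [vk, lam, hA]
    exact hm.xVal_trailingCoeff_X_mul (I.Λ_ne i le_rfl)

lemma vk_F (I : Invariant F k (stage F k)) : vk F k F = I.vF := by
  obtain ⟨g, hg, hgc⟩ := I.isMono_U.leadX
  have hg0 : g ≠ 0 := fun h0 => I.cU_ne (by rw [← hgc, h0, Polynomial.coeff_zero])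
  have h1 : red (stage F k).H ≠ 0 := (I.monic.map _).ne_zero
  have h2 : LeadX ((stage F k).pull F) I.vF (red (stage F k).H * g) := by
    obtain ⟨B, hB, rfl⟩ := hg
    rw [pow_zero, one_mul] at hB
    exact ⟨(stage F k).H * I.U, by rw [I.pull_F, mul_assoc], by rw [map_mul, hB]⟩
  exact xVal_eq h2 (mul_ne_zero h1 hg0)

lemma pairV_eq (I : Invariant F k (stage F k)) (B : ℕ × (Fin (k + 1) → ℕ)) :
    pairV F k B = (weight I.e I.V B : ℕ) := by
  rw [pairV, I.vk_lam_X.1, weight, Nat.cast_add, Nat.cast_mul, Nat.cast_sum, mul_comm]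
  congr 1
  refine Finset.sum_congr rfl fun i _ => ?_
  rw [(I.vk_lam_phi (Nat.lt_succ_iff.1 i.2)).1, Nat.cast_mul]

lemma lamPow_eq (I : Invariant F k (stage F k)) (B : ℕ × (Fin (k + 1) → ℕ)) :
    lamPow F k B = I.μ ^ B.1 * (∏ i : Fin (k + 1), I.Λ i ^ B.2 i) /
      I.Λ k ^ (stage F k).N := by
  rw [lamPow, I.vk_lam_X.2, (I.vk_lam_phi le_rfl).2]
  congr 2
  refine Finset.prod_congr rfl fun i _ => ?_
  rw [(I.vk_lam_phi (Nat.lt_succ_iff.1 i.2)).2]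

end Invariant

lemma weight_snoc (e : ℕ) (V : ℕ → ℕ) (n : ℕ) (β : Fin k → ℕ) (i : ℕ) :
    weight e V (n, (Fin.snoc β i : Fin (k + 1) → ℕ)) = weight e V (n, β) + i * V k := by
  simp only [weight, Fin.sum_univ_castSucc, Fin.snoc_castSucc, Fin.snoc_last, Fin.val_castSucc,
    Fin.val_last]
  ring

/-- This is mixed-radix notation: digits bounded by `q_i ℓ_i` represent integers less than their
product. -/
lemma sum_mul_dk_lt (F : K⟦X⟧[X]) (k : ℕ) (β : Fin k → ℕ) (hβ : ∀ i, β i < ql F (i + 1)) :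
    ∑ i : Fin k, β i * dk F i < dk F k := by
  induction k with
  | zero => simpa using dk_pos F 0
  | succ k ih =>
    rw [Fin.sum_univ_castSucc, dk_succ]
    have h1 := ih (fun i => β i.castSucc) fun i => hβ i.castSucc
    have h2 : (β (Fin.last k) + 1) * dk F k ≤ ql F (k + 1) * dk F k :=
      Nat.mul_le_mul_right _ (hβ (Fin.last k))
    simp only [Fin.val_castSucc, Fin.val_last] at h1 ⊢
    rw [add_one_mul] at h2
    omega

lemma degree_sum_lt {θ : ℕ → K⟦X⟧[X]} (hθ : ∀ i < k, (θ i).Monic ∧ (θ i).natDegree = dk F i)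
    (T : Finset (Fin k → ℕ)) (hT : ∀ β ∈ T, ∀ i, β i < ql F (i + 1))
    (a : (Fin k → ℕ) → K⟦X⟧) :
    (∑ β ∈ T, Polynomial.C (a β) * ∏ i : Fin k, θ i ^ β i).degree < (dk F k : WithBot ℕ) := by
  refine (Polynomial.degree_sum_le _ _).trans_lt ?_
  rw [Finset.sup_lt_iff (WithBot.bot_lt_coe _)]
  intro β hβ
  refine (Polynomial.degree_le_natDegree.trans_lt ?_)
  rw [Nat.cast_lt]
  refine (Polynomial.natDegree_C_mul_le _ _).trans_lt ((Polynomial.natDegree_prod_le _ _).trans_lt ?_)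
  refine lt_of_le_of_lt (Finset.sum_le_sum fun i _ => ?_) (sum_mul_dk_lt F k β (hT β hβ))
  rw [(hθ i i.2).1.natDegree_pow, (hθ i i.2).2]

lemma isExpansion_expansion {θ : ℕ → K⟦X⟧[X]}
    (hθ : ∀ i ≤ k, (θ i).Monic ∧ (θ i).natDegree = dk F i) :
    IsExpansion F k θ (expansion F k θ) := by
  have h : ∃ a, IsExpansion F k θ a := by
    obtain ⟨a, ha, haF⟩ := exists_hasExpansion hθ (fun i _ => dk_pos F i) (fun i _ => dk_succ F i)
      (F.natDegree + 1) F (by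
        refine Polynomial.degree_le_natDegree.trans_lt ?_
        rw [Nat.cast_lt]
        exact (Nat.lt_succ_self _).trans_le (Nat.le_mul_of_pos_right _ (dk_pos F k)))
    exact ⟨a, fun b hb => (ha b hb).1, haF⟩
  rw [expansion, dif_pos h]
  exact h.choose_spec

/-- The coefficient of `y^i` in the boundary polynomial of the expansion of `F`. -/
noncomputable def boundaryCoeff (F : K⟦X⟧[X]) (k : ℕ) (θ : ℕ → K⟦X⟧[X]) (i : ℕ) : (stage F k).L :=
  ∑ᶠ B ∈ {B : ℕ × (Fin (k + 1) → ℕ) | Admissible F k B.2 ∧ B.2 (Fin.last k) = i ∧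
    pairV F k B = minPair F k θ i}, (stage F k).emb (coeffB F k θ B) * lamPow F k B

/-- Grouping the expansion by the exponent of `ψ_k` gives the `ψ_k`-adic expansion. The leading
exponent and coefficient of `g_i` are, up to the contribution of `ψ_k^i`, the minimum and the sum
that define the `i`-th point and coefficient. -/
lemma Invariant.exists_expansion_data (I : Invariant F k (stage F k)) (hF : F.Monic)
    (hψ : (psi F k).Monic ∧ (psi F k).natDegree = dk F k) :
    ∃ (g : ℕ → K⟦X⟧[X]) (w : ℕ → ℕ) (c : ℕ → (stage F k).L),
      F = ∑ i ∈ Finset.range ((stage F k).N + 1), g i * psi F k ^ i ∧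
      (∀ i, IsMono I.b ((stage F k).pull (g i)) (w i) (c i)) ∧ (∀ i, c i = 0 → g i = 0) ∧
      w (stage F k).N = 0 ∧ c (stage F k).N = 1 ∧
      ∀ i, (c i = 0 → minPair F k (psi F) i = ⊤) ∧
        (c i ≠ 0 → minPair F k (psi F) i = (w i + i * I.V k : ℕ) ∧
          boundaryCoeff F k (psi F) i = c i * I.Λ k ^ i / I.Λ k ^ (stage F k).N) := by
  classical
  have hθ : ∀ i ≤ k, (psi F i).Monic ∧ (psi F i).natDegree = dk F i := by
    intro i hi
    rcases hi.lt_or_eq with h | rfl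
    · exact I.psi_monic i h
    · exact hψ
  obtain ⟨hadm, hexp⟩ := isExpansion_expansion hθ
  set a := expansion F k (psi F) with ha
  set T : Finset (Fin k → ℕ) := a.support.image Fin.init with hT
  have hTmem : ∀ b, a b ≠ 0 → Fin.init b ∈ T := fun b hb =>
    Finset.mem_image_of_mem _ (Finsupp.mem_support_iff.2 hb)
  have hTadm : ∀ β ∈ T, ∀ i : Fin k, β i < ql F (i + 1) := by
    intro β hβ i
    obtain ⟨b, hb, rfl⟩ := Finset.mem_image.1 hβ
    exact hadm b hb i.castSucc i.2
  have hsnocadm : ∀ β ∈ T, ∀ i : ℕ, Admissible F k (Fin.snoc β i : Fin (k + 1) → ℕ) := by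
    intro β hβ i j hj
    obtain ⟨j', rfl⟩ : ∃ j' : Fin k, j = j'.castSucc := ⟨⟨j, hj⟩, rfl⟩
    rw [Fin.snoc_castSucc]
    exact hTadm β hβ j'
  set G : ℕ → K⟦X⟧[X] := fun i =>
    ∑ β ∈ T, Polynomial.C (a (Fin.snoc β i)) * ∏ j : Fin k, psi F j ^ β j with hG
  have hGd : ∀ i, (G i).degree < ((psi F k).natDegree : WithBot ℕ) := by
    intro i
    rw [hψ.2]
    exact degree_sum_lt (fun j hj => hθ j hj.le) T hTadm _
  -- A provisional bound on the exponents of `ψ_k`; `adic_leading` then shows that nothing beyond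
  -- `N_k` occurs.
  obtain ⟨M, hM, hMN⟩ : ∃ M, (∀ b ∈ a.support, b (Fin.last k) < M) ∧ (stage F k).N < M := by
    refine ⟨(a.support.sup fun b => b (Fin.last k)) + (stage F k).N + 1, fun b hb => ?_, by omega⟩
    have := Finset.le_sup (f := fun b : Fin (k + 1) → ℕ => b (Fin.last k)) hb
    omega
  have hFG : F = ∑ i ∈ Finset.range M, G i * psi F k ^ i := by
    conv_lhs => rw [hexp]
    simp only [hG, Finset.sum_mul]
    rw [← Finset.sum_product', Finsupp.sum]
    refine Finset.sum_bij_ne_zero (fun b _ _ => (b (Fin.last k), Fin.init b)) ?_ ?_ ?_ ?_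
    · intro b hb _
      exact Finset.mem_product.2 ⟨Finset.mem_range.2 (hM b hb), Finset.mem_image_of_mem _ hb⟩
    · intro b _ _ b' _ _ h
      rw [Prod.mk.injEq] at h
      rw [← Fin.snoc_init_self b, ← Fin.snoc_init_self b', h.1, h.2]
    · rintro ⟨i, β⟩ hi hne
      refine ⟨Fin.snoc β i, ?_, ?_, ?_⟩
      · rw [Finsupp.mem_support_iff]
        intro h0
        apply hne
        simp only [h0, map_zero, zero_mul]
      · rw [Fin.prod_univ_castSucc]
        simpa [mul_assoc] using hne
      · simp
    · intro b _ _
      simp only [Fin.snoc_init_self]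
      rw [Fin.prod_univ_castSucc, mul_assoc]
      rfl
  obtain ⟨-, hGz, hGN⟩ := adic_leading hψ.1 (hψ.2 ▸ dk_pos F k) hF
    (by rw [I.natDegree_F, hψ.2]) hGd hFG
  have hFG' : F = ∑ i ∈ Finset.range ((stage F k).N + 1), G i * psi F k ^ i := by
    conv_lhs => rw [hFG]
    refine (Finset.sum_subset (Finset.range_mono hMN) fun i hi hi' => ?_).symm
    rw [hGz i (by simpa using hi') (Finset.mem_range.1 hi), zero_mul]
  have hdata : ∀ i, ∃ (w : ℕ) (c : (stage F k).L),
      IsMono I.b ((stage F k).pull (G i)) w c ∧ (c = 0 → G i = 0) ∧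
      (c = 0 → minPair F k (psi F) i = ⊤) ∧
      (c ≠ 0 → minPair F k (psi F) i = (w + i * I.V k : ℕ) ∧
        boundaryCoeff F k (psi F) i = c * I.Λ k ^ i / I.Λ k ^ (stage F k).N) := by
    intro i
    by_cases hne : ∃ β ∈ T, a (Fin.snoc β i) ≠ 0
    · obtain ⟨w, hw1, ⟨B₀, hB₀T, hB₀a, hB₀w⟩, hne0, hmono⟩ := I.frame.isMono_sum I.isMono_psi
        I.indep T hTadm (fun β => a (Fin.snoc β i)) hne
      refine ⟨w, _, hmono, fun h => absurd h hne0, fun h => absurd h hne0, fun _ => ?_⟩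
      have hmin : minPair F k (psi F) i = (w + i * I.V k : ℕ) := by
        refine le_antisymm (sInf_le ⟨(B₀.1, Fin.snoc B₀.2 i), hsnocadm _ hB₀T i,
          Fin.snoc_last (α := fun _ => ℕ) _ _, hB₀a, ?_⟩) (le_sInf ?_)
        · rw [I.pairV_eq, weight_snoc, ← hB₀w]
        · rintro _ ⟨⟨n, b⟩, hb1, hb2, hb3, rfl⟩
          rw [I.pairV_eq, Nat.cast_le]
          have hb : b = Fin.snoc (Fin.init b) i := by rw [← hb2, Fin.snoc_init_self]
          have hab : a b ≠ 0 := fun h0 => hb3 (by rw [coeffB, ← ha]; simp only [h0, map_zero])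
          have h1 := hw1 (n, Fin.init b) (hTmem b hab) (by
            simp only [← hb]; exact hb3)
          rw [hb, weight_snoc]
          omega
      refine ⟨hmin, ?_⟩
      -- The set of all admissible exponents at the minimum may exceed the level over `T`, but the
      -- additional ones have coefficient 0.
      rw [boundaryCoeff, finsum_mem_eq_sum_of_inter_support_eq (t := (level I.e I.V T w).image
        fun B => ((B.1, Fin.snoc B.2 i) : ℕ × (Fin (k + 1) → ℕ)))]
      · rw [Finset.sum_image, Finset.sum_mul, Finset.sum_div]
        · refine Finset.sum_congr rfl fun B _ => ?_
          rw [I.lamPow_eq, coeffB, ← ha, Fin.prod_univ_castSucc]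
          simp only [Fin.snoc_castSucc, Fin.snoc_last, Fin.val_castSucc, Fin.val_last]
          ring
        · rintro ⟨n, β⟩ _ ⟨n', β'⟩ _ h
          rw [Prod.mk.injEq] at h ⊢
          have h2 := congrArg Fin.init h.2
          simp only [Fin.init_snoc] at h2
          exact ⟨h.1, h2⟩
      · ext ⟨n, b⟩
        simp only [Set.mem_inter_iff, Set.mem_ofPred_eq, Finset.coe_image, Set.mem_image,
          Finset.mem_coe, Function.mem_support, and_congr_left_iff]
        intro hsupp
        have hab : a b ≠ 0 := fun h0 => hsupp (by
          rw [coeffB, ← ha]; simp only [h0, map_zero, zero_mul])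
        constructor
        · rintro ⟨-, hb2, hb3⟩
          have hb : b = Fin.snoc (Fin.init b) i := by rw [← hb2, Fin.snoc_init_self]
          refine ⟨(n, Fin.init b), (mem_level I.frame.e_pos).2 ⟨hTmem b hab, ?_⟩, by rw [← hb]⟩
          rw [hmin, I.pairV_eq, hb, weight_snoc, Nat.cast_inj] at hb3
          exact Nat.add_right_cancel hb3
        · rintro ⟨⟨n', β⟩, hB, h⟩
          rw [Prod.mk.injEq] at h
          obtain ⟨rfl, rfl⟩ := h
          obtain ⟨h1, h2⟩ := (mem_level I.frame.e_pos).1 hB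
          refine ⟨hsnocadm β h1 i, Fin.snoc_last (α := fun _ => ℕ) _ _, ?_⟩
          rw [hmin, I.pairV_eq, weight_snoc, h2]
    · have hzero : ∀ β ∈ T, a (Fin.snoc β i) = 0 := by
        intro β hβ
        by_contra h
        exact hne ⟨β, hβ, h⟩
      have hG0 : G i = 0 := Finset.sum_eq_zero fun β hβ => by rw [hzero β hβ, map_zero, zero_mul]
      refine ⟨0, 0, by rw [hG0, map_zero]; exact IsMono.zero 0, fun _ => hG0, fun _ => ?_,
        fun h => absurd rfl h⟩
      rw [minPair, sInf_eq_top]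
      rintro _ ⟨⟨n, b⟩, -, hb2, hb3, -⟩
      exfalso
      have hab : a b ≠ 0 := fun h0 => hb3 (by rw [coeffB, ← ha]; simp only [h0, map_zero])
      have h1 := hzero _ (hTmem b hab)
      rw [← hb2, Fin.snoc_init_self] at h1
      exact hab h1
  choose w c h1 h2 h3 h4 using hdata
  have hcN : c (stage F k).N ≠ 0 := fun h0 => one_ne_zero (hGN.symm.trans (h2 _ h0))
  have hmN := h1 (stage F k).N
  rw [hGN, map_one] at hmN
  obtain ⟨h5, h6⟩ := hmN.unique IsMono.one hcN one_ne_zero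
  exact ⟨G, w, c, hFG', h1, h2, h5, h6, fun i => ⟨h3 i, h4 i⟩⟩

end Expansions

/-! ### Agreement of polygons and boundary polynomials. -/

section Comparison

variable {K : Type u} [Field K] {F : K⟦X⟧[X]} {k : ℕ}

/-- The coefficients of `H_k` on a supporting line through `(N_k, 0)`, read off the expansion. -/
lemma Invariant.line_spec (I : Invariant F k (stage F k)) (hF : F.Monic)
    (hn : ∀ n, 0 < n → n ≤ F.natDegree → (n : K) ≠ 0) {α β : ℕ} (hα : 0 < α) (hb : I.b ≤ β)
    (hHl : ∀ i j, α * j + β * i < β * (stage F k).N →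
      PowerSeries.coeff j ((stage F k).H.coeff i) = 0) :
    minPair F k (psi F) (stage F k).N = I.vF ∧
    (∀ i ≤ (stage F k).N, minPair F k (psi F) i ≠ ⊤ →
      α * I.vF + β * (stage F k).N ≤ α * (minPair F k (psi F) i).toNat + β * i) ∧
    ∀ i ≤ (stage F k).N, ∀ j, α * j + β * i = β * (stage F k).N →
      (minPair F k (psi F) i = (I.vF + j : ℕ) → PowerSeries.coeff j ((stage F k).H.coeff i) ≠ 0 ∧
        boundaryCoeff F k (psi F) i = PowerSeries.coeff j ((stage F k).H.coeff i)) ∧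
      (minPair F k (psi F) i ≠ (I.vF + j : ℕ) →
        PowerSeries.coeff j ((stage F k).H.coeff i) = 0) := by
  obtain ⟨hψ1, hψ2, hψY⟩ := I.psi_spec rfl hF hn hα hb hHl
  obtain ⟨g, w, c, hsum, hmono, hg0, hwN, hcN, hmin⟩ :=
    I.exists_expansion_data hF ⟨hψ1, hψ2⟩
  have hc := I.Λ_ne k le_rfl
  have hsum' : Polynomial.C PowerSeries.X ^ I.vF * (stage F k).H * I.U =
      ∑ i ∈ Finset.range ((stage F k).N + 1),
        (stage F k).pull (g i) * (stage F k).pull (psi F k) ^ i := by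
    rw [← I.pull_F]
    refine (congrArg (stage F k).pull hsum).trans ?_
    simp only [map_sum, map_mul, map_pow]
  obtain ⟨h1, -, h3, h4⟩ := leading_terms_eq hα hb I.monic I.natDegree_H hHl I.isMono_U I.cU_ne
    hψY hc (fun i _ => hmono i) (fun i _ h => by rw [hg0 i h, map_zero]) hwN hcN hsum'
  have hcne : ∀ i, minPair F k (psi F) i ≠ ⊤ → c i ≠ 0 := fun i h h0 => h ((hmin i).1 h0)
  refine ⟨?_, fun i hi h => ?_, fun i hi j hij => ?_⟩
  · rw [((hmin _).2 (by rw [hcN]; exact one_ne_zero)).1, hwN, zero_add, h1]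
  · rw [((hmin i).2 (hcne i h)).1, ENat.toNat_natCast]
    exact h3 i hi (hcne i h)
  · have h5 := coeff_wt_add (1 : (stage F k).L) (β := β) hα i j (stage F k).H
    rw [hij, one_pow, one_mul] at h5
    obtain ⟨h6, h7⟩ := h4 i hi
    rw [h5] at h6 h7
    constructor
    · intro h
      have hci := hcne i (by rw [h]; exact ENat.natCast_ne_top _)
      obtain ⟨h8, h9⟩ := (hmin i).2 hci
      rw [h, Nat.cast_inj] at h8
      -- The identity `h_i Λ_k^N = c_i Λ_k^i` is, after division by `Λ_k^N`, the normalization by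
      -- `Λ^{-B₀}`.
      have h10 := h6 ⟨hci, by rw [← h8, ← hij]; ring⟩
      have h11 : boundaryCoeff F k (psi F) i =
          PowerSeries.coeff j ((stage F k).H.coeff i) := by
        rw [h9, ← h10, mul_div_cancel_right₀ _ (pow_ne_zero _ hc)]
      refine ⟨?_, h11⟩
      rw [← h11, h9]
      exact div_ne_zero (mul_ne_zero hci (pow_ne_zero _ hc)) (pow_ne_zero _ hc)
    · intro h
      refine h7 ?_
      rintro ⟨hci, h8⟩
      apply h
      rw [((hmin i).2 hci).1, Nat.cast_inj]
      rw [← hij] at h8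
      refine Nat.eq_of_mul_eq_mul_left hα ?_
      rw [mul_add α I.vF]
      omega

/-- The points `(i, w_i)` whose lower hull is the polygon of the expansion. -/
def expansionPoints (F : K⟦X⟧[X]) (k : ℕ) : Set (ℝ × ℝ) :=
  {p | ∃ i : ℕ, i ≤ (stage F k).N ∧ minPair F k (psi F) i ≠ ⊤ ∧ p = wPoint F k (psi F) i}

open Classical in
lemma coeff_expansionBoundary (F : K⟦X⟧[X]) (k : ℕ) (θ : ℕ → K⟦X⟧[X]) (i : ℕ) :
    (expansionBoundary F k θ).coeff i =
      if i ≤ (stage F k).N ∧ minPair F k θ i ≠ ⊤ ∧ wPoint F k θ i ∈ expansionPolygon F k θ then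
        PowerSeries.C (boundaryCoeff F k θ i) *
          PowerSeries.X ^ ((minPair F k θ i).toNat - (vk F k F).toNat) else 0 := by
  rw [expansionBoundary, Polynomial.finsetSum_coeff]
  by_cases hi : i ≤ (stage F k).N
  · rw [Finset.sum_eq_single i]
    · by_cases h : minPair F k θ i ≠ ⊤ ∧ wPoint F k θ i ∈ expansionPolygon F k θ
      · rw [if_pos h, if_pos ⟨hi, h⟩, Polynomial.coeff_monomial, if_pos rfl]
        rfl
      · rw [if_neg h, if_neg fun h' => h h'.2, Polynomial.coeff_zero]
    · intro j _ hj
      split_ifs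
      · rw [Polynomial.coeff_monomial, if_neg hj]
      · exact Polynomial.coeff_zero _
    · intro h
      exact absurd (Finset.mem_range.2 (Nat.lt_succ_iff.2 hi)) h
  · rw [if_neg fun h => hi h.1]
    refine Finset.sum_eq_zero fun j hj => ?_
    have hj' := Nat.lt_succ_iff.1 (Finset.mem_range.1 hj)
    split_ifs
    · rw [Polynomial.coeff_monomial, if_neg (by omega)]
    · exact Polynomial.coeff_zero _

/-- The part of the set `S` on the line of slope `-θ` through `(N, 0)`. -/
def linePart (θ : ℝ) (N : ℕ) (S : Set (ℝ × ℝ)) : Set (ℝ × ℝ) := {p ∈ S | p.2 + θ * p.1 = θ * N}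

/-- On a supporting line of both, the polygon of `H_k` and that of the expansion agree. -/
structure Agree (F : K⟦X⟧[X]) (k : ℕ) (θ : ℝ) : Prop where
  above_H : ∀ p ∈ newtonPoints (stage F k).H, θ * (stage F k).N ≤ p.2 + θ * p.1
  above : ∀ p ∈ expansionPoints F k, θ * (stage F k).N ≤ p.2 + θ * p.1
  mem : (((stage F k).N : ℝ), (0 : ℝ)) ∈ expansionPoints F k
  right : ∀ p ∈ expansionPoints F k, p.1 < (((stage F k).N : ℝ), (0 : ℝ)).1 ∨
    p = (((stage F k).N : ℝ), (0 : ℝ))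
  linePart_eq : linePart θ (stage F k).N (expansionPoints F k) =
    linePart θ (stage F k).N (newtonPoints (stage F k).H)
  le_toNat : ∀ i ≤ (stage F k).N, minPair F k (psi F) i ≠ ⊤ →
    (vk F k F).toNat ≤ (minPair F k (psi F) i).toNat
  coeff_eq : ∀ i j : ℕ, (((i : ℝ), (j : ℝ)) : ℝ × ℝ) ∈
      convexHull ℝ (linePart θ (stage F k).N (newtonPoints (stage F k).H)) →
    PowerSeries.coeff j ((expansionBoundary F k (psi F)).coeff i) =
      PowerSeries.coeff j ((stage F k).H.coeff i)

/-- On the line the expansion has a point at `i` exactly when `H_k` has a nonzero coefficient there,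
and the coefficients agree. Off the line nothing is claimed beyond being above it. -/
lemma Invariant.agree (I : Invariant F k (stage F k)) (hF : F.Monic)
    (hn : ∀ n, 0 < n → n ≤ F.natDegree → (n : K) ≠ 0) {α β : ℕ} (hα : 0 < α) (hb : I.b ≤ β)
    (hHl : ∀ i j, α * j + β * i < β * (stage F k).N →
      PowerSeries.coeff j ((stage F k).H.coeff i) = 0) : Agree F k (β / α) := by
  classical
  obtain ⟨hN, hab, hline⟩ := I.line_spec hF hn hα hb hHl
  have hvk : (vk F k F).toNat = I.vF := by rw [I.vk_F, ENat.toNat_natCast]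
  have hα' : (0 : ℝ) < α := by exact_mod_cast hα
  have hle : ∀ i ≤ (stage F k).N, minPair F k (psi F) i ≠ ⊤ →
      ∃ j, minPair F k (psi F) i = (I.vF + j : ℕ) ∧
        wPoint F k (psi F) i = ((i : ℝ), (j : ℝ)) ∧
        β * (stage F k).N ≤ α * j + β * i := by
    intro i hi h
    have h1 := hab i hi h
    have h2 : I.vF ≤ (minPair F k (psi F) i).toNat := by
      refine Nat.le_of_mul_le_mul_left ?_ hα
      have := Nat.mul_le_mul_left β hi
      omega
    obtain ⟨j, hj⟩ := Nat.exists_eq_add_of_le h2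
    refine ⟨j, by rw [← hj, ENat.natCast_toNat h], ?_, ?_⟩
    · rw [wPoint, hvk, hj]
      simp
    · rw [hj, mul_add] at h1
      omega
  have hwN : wPoint F k (psi F) (stage F k).N = (((stage F k).N : ℝ), (0 : ℝ)) := by
    rw [wPoint, hvk, hN, ENat.toNat_natCast, sub_self]
  have hNe : minPair F k (psi F) (stage F k).N ≠ ⊤ := by
    rw [hN]; exact ENat.natCast_ne_top _
  have habove_H := newtonPoints_above hα hHl
  have habove : ∀ p ∈ expansionPoints F k, (β / α : ℝ) * (stage F k).N ≤ p.2 + β / α * p.1 := by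
    rintro p ⟨i, hi, h, rfl⟩
    obtain ⟨j, -, hj, hj'⟩ := hle i hi h
    rw [hj, ← weight_le_iff hα]
    dsimp only
    exact_mod_cast hj'
  have hmem : (((stage F k).N : ℝ), (0 : ℝ)) ∈ expansionPoints F k :=
    ⟨_, le_rfl, hNe, hwN.symm⟩
  have heq : linePart (β / α) (stage F k).N (expansionPoints F k) =
      linePart (β / α) (stage F k).N (newtonPoints (stage F k).H) := by
    ext p
    constructor
    · rintro ⟨⟨i, hi, h, rfl⟩, hp⟩
      obtain ⟨j, hj1, hj2, -⟩ := hle i hi h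
      refine ⟨?_, hp⟩
      rw [hj2] at hp ⊢
      have h1 := (weight_eq_iff hα).2 hp
      dsimp only at h1
      have h2 : α * j + β * i = β * (stage F k).N := by exact_mod_cast h1
      obtain ⟨j', hj', hp'⟩ := exists_newtonPoint ((hline i hi j h2).1 hj1).1
      have h3 := (weight_le_iff hα).2 (habove_H _ hp')
      dsimp only at h3
      have h4 : β * (stage F k).N ≤ α * j' + β * i := by exact_mod_cast h3
      have h5 : j' = j := le_antisymm hj' (Nat.le_of_mul_le_mul_left (by omega) hα)
      rwa [h5] at hp'
    · rintro ⟨⟨i, j, hij, rfl⟩, hp⟩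
      refine ⟨?_, hp⟩
      have h1 := (weight_eq_iff hα).2 hp
      dsimp only at h1
      have h2 : α * j + β * i = β * (stage F k).N := by exact_mod_cast h1
      have h3 := coeff_ne_zero_of_order hij
      have hi : i ≤ (stage F k).N := by
        rw [← I.natDegree_H]
        refine Polynomial.le_natDegree_of_ne_zero fun h0 => h3 ?_
        rw [h0, map_zero]
      have h4 : minPair F k (psi F) i = (I.vF + j : ℕ) := by
        by_contra h
        exact h3 ((hline i hi j h2).2 h)
      have h5 : minPair F k (psi F) i ≠ ⊤ := by rw [h4]; exact ENat.natCast_ne_top _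
      refine ⟨i, hi, h5, ?_⟩
      rw [wPoint, hvk, h4, ENat.toNat_natCast]
      simp
  refine ⟨habove_H, habove, hmem, ?_, heq, ?_, ?_⟩
  · rintro p ⟨i, hi, h, rfl⟩
    rcases hi.lt_or_eq with hi | rfl
    · left
      simp only [wPoint]
      exact_mod_cast hi
    · exact Or.inr hwN
  · intro i hi h
    obtain ⟨j, hj, -⟩ := hle i hi h
    rw [hvk, hj, ENat.toNat_natCast]
    omega
  · intro i j hp
    have h1 := (weight_eq_iff hα).2
      (eq_of_mem_convexHull (S := linePart (β / α) (stage F k).N (newtonPoints (stage F k).H))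
        (fun p hp => hp.2) hp)
    dsimp only at h1
    have h2 : α * j + β * i = β * (stage F k).N := by exact_mod_cast h1
    rw [coeff_expansionBoundary]
    split_ifs with h
    · obtain ⟨j', hj1, hj2, -⟩ := hle i h.1 h.2.1
      rw [hj1, ENat.toNat_natCast, hvk, Nat.add_sub_cancel_left, PowerSeries.coeff_C_mul,
        PowerSeries.coeff_X_pow]
      split_ifs with h3
      · subst h3
        rw [mul_one, ((hline i h.1 j h2).1 hj1).2]
      · rw [mul_zero, (hline i h.1 j h2).2]
        rw [hj1]
        intro h4
        have h5 : I.vF + j' = I.vF + j := by exact_mod_cast h4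
        omega
    · rw [map_zero]
      by_cases hi : i ≤ (stage F k).N
      · rw [(hline i hi j h2).2]
        intro h3
        have h4 : minPair F k (psi F) i ≠ ⊤ := by rw [h3]; exact ENat.natCast_ne_top _
        refine h ⟨hi, h4, ?_⟩
        have h5 : wPoint F k (psi F) i = ((i : ℝ), (j : ℝ)) := by
          rw [wPoint, hvk, h3, ENat.toNat_natCast]
          simp
        rw [h5]
        rw [← heq] at hp
        exact convexHull_line_subset_lowerHull habove hp
      · rw [Polynomial.coeff_eq_zero_of_natDegree_lt (by rw [I.natDegree_H]; omega), map_zero]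

/-- Both ends of the edge of `H_k`, on the axis and at `(N_k, 0)`, belong to both sets of points. So
each lower hull is the face cut out by the same line. -/
lemma polygon_and_boundary_eq (hF : F.Monic) (hd : 0 < F.natDegree)
    (hn : ∀ n, 0 < n → n ≤ F.natDegree → (n : K) ≠ 0) (hk : k < length F) :
    newtonPolygon (stage F k).H = expansionPolygon F k (psi F) ∧
      boundary (stage F k).H = expansionBoundary F k (psi F) := by
  classical
  obtain ⟨I⟩ := invariant_stage hF hd hn k hk.le
  obtain ⟨D⟩ := (continues_of_lt_length hk).2
  obtain ⟨hN, hlow, -, -⟩ := edgeData_spec D I.monic I.natDegree_H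
  have hA := I.agree hF hn D.q_pos (I.b_le_m D) hlow
  obtain ⟨hr, hr1⟩ := newtonPoints_right I.monic I.natDegree_H
  set θ : ℝ := (D.m / D.q : ℝ) with hθ
  have hmem : ∀ S : Set (ℝ × ℝ), (∀ p ∈ S, p.1 < (((stage F k).N : ℝ), (0 : ℝ)).1 ∨
      p = (((stage F k).N : ℝ), (0 : ℝ))) → ∀ p ∈ S, p.1 ≤ (((stage F k).N : ℝ), (0 : ℝ)).1 := by
    intro S hS p hp
    rcases hS p hp with h | h
    · exact h.le
    · rw [h]
  have hl : (((0 : ℕ) : ℝ), ((D.m * D.P.natDegree * D.N : ℕ) : ℝ)) ∈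
      linePart θ (stage F k).N (newtonPoints (stage F k).H) := by
    obtain ⟨j', hj', hp⟩ := exists_newtonPoint (edgeData_coeff_zero D I.monic I.natDegree_H)
    have h1 : D.q * (D.m * D.P.natDegree * D.N) + D.m * 0 = D.m * (stage F k).N := by
      rw [hN]; ring
    have h3 := (weight_le_iff D.q_pos).2 (hA.above_H _ hp)
    dsimp only at h3
    have h4 : D.m * (stage F k).N ≤ D.q * j' + D.m * 0 := by exact_mod_cast h3
    have h5 : j' = D.m * D.P.natDegree * D.N :=
      le_antisymm hj' (Nat.le_of_mul_le_mul_left (by omega) D.q_pos)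
    rw [h5] at hp
    refine ⟨hp, (weight_eq_iff D.q_pos).1 ?_⟩
    dsimp only
    exact_mod_cast h1
  have hl2 := hl
  rw [← hA.linePart_eq] at hl2
  have hline : (0 : ℝ) + θ * (stage F k).N = θ * (stage F k).N := zero_add _
  have e1 : newtonPolygon (stage F k).H =
      convexHull ℝ (linePart θ (stage F k).N (newtonPoints (stage F k).H)) :=
    lowerHull_eq_convexHull_line hA.above_H hl.1 hl.2
      (by rintro p ⟨i, j, -, rfl⟩; simp) hr hline (hmem _ hr1)
  have e2 : expansionPolygon F k (psi F) =
      convexHull ℝ (linePart θ (stage F k).N (expansionPoints F k)) :=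
    lowerHull_eq_convexHull_line hA.above hl2.1 hl2.2
      (by rintro p ⟨i, -, -, rfl⟩; simp [wPoint]) hA.mem hline (hmem _ hA.right)
  rw [hA.linePart_eq] at e2
  refine ⟨e1.trans e2.symm, ?_⟩
  ext i j
  rw [boundary, coeff_restrictTo]
  split_ifs with h
  · rw [e1] at h
    exact (hA.coeff_eq i j h).symm
  · rw [coeff_expansionBoundary]
    -- A term of the expansion boundary sits at a point of the common polygon. The subtraction in
    -- its exponent is a true one because the minimum is at least `v_k(F)`.
    split_ifs with h1
    · rw [PowerSeries.coeff_C_mul, PowerSeries.coeff_X_pow, if_neg, mul_zero]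
      intro h2
      apply h
      rw [e1, ← e2, h2, Nat.cast_sub (hA.le_toNat i h1.1 h1.2.1)]
      exact h1.2.2
    · rw [map_zero]

/-- The lower edge of a polygon lies on a supporting line through its right end. -/
lemma exists_supporting_line {L : Type u} [Field L] {H : L⟦X⟧[X]} {N b : ℕ} (hH : H.Monic)
    (hHd : H.natDegree = N) (hb : b ≤ 1) (hred : b = 0 ∨ red H = Polynomial.X ^ N)
    (hne : ∃ p ∈ newtonPoints H, p ≠ ((N : ℝ), (0 : ℝ))) :
    ∃ α β : ℕ, 0 < α ∧ b ≤ β ∧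
      (∀ i j, α * j + β * i < β * N → PowerSeries.coeff j (H.coeff i) = 0) ∧
      ∃ p ∈ newtonPoints H, p ≠ ((N : ℝ), (0 : ℝ)) ∧
        p.2 + (β / α : ℝ) * p.1 = (β / α : ℝ) * N := by
  obtain ⟨hr, hr1⟩ := newtonPoints_right hH hHd
  have hlt : ∀ i j : ℕ, ((i : ℝ), (j : ℝ)) ∈ newtonPoints H →
      ((i : ℝ), (j : ℝ)) ≠ ((N : ℝ), (0 : ℝ)) → i < N := by
    intro i j h h'
    have := (hr1 _ h).resolve_right h'
    dsimp only at this
    exact_mod_cast this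
  have hfin : ({p ∈ newtonPoints H | p ≠ ((N : ℝ), (0 : ℝ))} : Set (ℝ × ℝ)).Finite :=
    (newtonPoints_finite H).subset fun p hp => hp.1
  -- The lower edge leaves `(N, 0)` towards the point that minimizes the steepness `j / (N - i)`.
  -- The weights `N - i` and `j` need not be coprime.
  obtain ⟨p, ⟨⟨i, j, hij, rfl⟩, hpr⟩, hmin⟩ := Set.exists_min_image _
    (fun p : ℝ × ℝ => p.2 / (N - p.1)) hfin (by obtain ⟨p, hp⟩ := hne; exact ⟨p, hp⟩)
  have hpm : ((i : ℝ), (j : ℝ)) ∈ newtonPoints H := ⟨i, j, hij, rfl⟩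
  have hiN := hlt i j hpm hpr
  have hα : 0 < N - i := Nat.sub_pos_of_lt hiN
  have hlow : ∀ i' j', (N - i) * j' + j * i' < j * N →
      PowerSeries.coeff j' (H.coeff i') = 0 := by
    intro i' j' h
    by_contra h0
    obtain ⟨j'', hj'', hp'⟩ := exists_newtonPoint h0
    by_cases hr' : ((i' : ℝ), (j'' : ℝ)) = ((N : ℝ), (0 : ℝ))
    · rw [Prod.mk.injEq] at hr'
      have h1 : i' = N := by exact_mod_cast hr'.1
      rw [h1] at h
      omega
    · have hi' := hlt i' j'' hp' hr'
      have h1 := hmin _ ⟨hp', hr'⟩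
      dsimp only at h1
      have e1 : (N : ℝ) - i = ((N - i : ℕ) : ℝ) := by rw [Nat.cast_sub hiN.le]
      have e2 : (N : ℝ) - i' = ((N - i' : ℕ) : ℝ) := by rw [Nat.cast_sub hi'.le]
      rw [e1, e2, div_le_div_iff₀ (by exact_mod_cast hα)
        (by exact_mod_cast Nat.sub_pos_of_lt hi')] at h1
      have h2 : j * (N - i') ≤ j'' * (N - i) := by exact_mod_cast h1
      have h3 : (N - i) * j'' ≤ (N - i) * j' := Nat.mul_le_mul_left _ hj''
      have h4 : j * (N - i') + j * i' = j * N := by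
        rw [← mul_add, Nat.sub_add_cancel hi'.le]
      rw [mul_comm j''] at h2
      omega
  refine ⟨N - i, j, hα, ?_, hlow, _, hpm, hpr, (weight_eq_iff hα).1 ?_⟩
  · rcases hred with h | h
    · omega
    -- If `H(0, y) = y^N`, no point with `i < N` has ordinate 0, so the weight of `y` is positive.
    · refine hb.trans (Nat.one_le_iff_ne_zero.2 fun hj => ?_)
      have h1 := coeff_ne_zero_of_order hij
      have h2 := congrArg (fun p => p.coeff i) h
      simp only [Polynomial.coeff_X_pow, if_neg hiN.ne] at h2
      rw [red, Polynomial.coe_mapRingHom, Polynomial.coeff_map] at h2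
      rw [hj, PowerSeries.coeff_zero_eq_constantCoeff] at h1
      exact h1 h2
  · dsimp only
    rw [Nat.cast_sub hiN.le]
    ring

lemma lowerEdge_and_restrictTo_eq_of_agree (I : Invariant F k (stage F k))
    {θ : ℝ} (hA : Agree F k θ)
    (hex : (newtonPoints (stage F k).H = {(((stage F k).N : ℝ), (0 : ℝ))} ∧
        expansionPoints F k = {(((stage F k).N : ℝ), (0 : ℝ))}) ∨
      ∃ l ∈ newtonPoints (stage F k).H, l ≠ (((stage F k).N : ℝ), (0 : ℝ)) ∧
        l.2 + θ * l.1 = θ * (stage F k).N) :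
    lowerEdge (newtonPolygon (stage F k).H) = lowerEdge (expansionPolygon F k (psi F)) ∧
      restrictTo (lowerEdge (newtonPolygon (stage F k).H)) (boundary (stage F k).H) =
        restrictTo (lowerEdge (expansionPolygon F k (psi F)))
          (expansionBoundary F k (psi F)) := by
  classical
  obtain ⟨hr, hr1⟩ := newtonPoints_right I.monic I.natDegree_H
  have hline : (0 : ℝ) + θ * (stage F k).N = θ * (stage F k).N := zero_add _
  have e1 : lowerEdge (newtonPolygon (stage F k).H) =
      convexHull ℝ (linePart θ (stage F k).N (newtonPoints (stage F k).H)) :=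
    lowerEdge_lowerHull hA.above_H hr hline hr1 (hex.imp_left And.left)
  have e2 : lowerEdge (expansionPolygon F k (psi F)) =
      convexHull ℝ (linePart θ (stage F k).N (expansionPoints F k)) := by
    refine lowerEdge_lowerHull hA.above hA.mem hline hA.right (hex.imp And.right ?_)
    rintro ⟨l, hl, hl', hl''⟩
    have h1 : l ∈ linePart θ (stage F k).N (newtonPoints (stage F k).H) := ⟨hl, hl''⟩
    rw [← hA.linePart_eq] at h1
    exact ⟨l, h1.1, hl', h1.2⟩
  rw [hA.linePart_eq] at e2
  refine ⟨e1.trans e2.symm, ?_⟩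
  rw [e1, e2]
  ext i j
  rw [coeff_restrictTo, coeff_restrictTo]
  split_ifs with h
  · have hmem : (((i : ℝ), (j : ℝ)) : ℝ × ℝ) ∈ newtonPolygon (stage F k).H :=
      convexHull_line_subset_lowerHull hA.above_H h
    rw [boundary, coeff_restrictTo, if_pos hmem, hA.coeff_eq i j h]
  · rfl

/-- The end of the algorithm plays no role: the invariant alone gives agreement on the supporting
line of the lower edge. -/
lemma lowerEdge_and_restrictTo_eq (hF : F.Monic)
    (hn : ∀ n, 0 < n → n ≤ F.natDegree → (n : K) ≠ 0) (I : Invariant F k (stage F k)) :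
    lowerEdge (newtonPolygon (stage F k).H) = lowerEdge (expansionPolygon F k (psi F)) ∧
      restrictTo (lowerEdge (newtonPolygon (stage F k).H)) (boundary (stage F k).H) =
        restrictTo (lowerEdge (expansionPolygon F k (psi F)))
          (expansionBoundary F k (psi F)) := by
  obtain ⟨hr, hr1⟩ := newtonPoints_right I.monic I.natDegree_H
  by_cases hne : ∃ p ∈ newtonPoints (stage F k).H, p ≠ (((stage F k).N : ℝ), (0 : ℝ))
  · obtain ⟨α, β, hα, hb, hlow, hex⟩ :=
      exists_supporting_line I.monic I.natDegree_H I.b_le I.red_H hne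
    exact lowerEdge_and_restrictTo_eq_of_agree I (I.agree hF hn hα hb hlow) (Or.inr hex)
  · push Not at hne
    -- With `(N, 0)` as its only Newton point, `H_k` lies above every line through that point.
    have hlow : ∀ β i j : ℕ, 1 * j + β * i < β * (stage F k).N →
        PowerSeries.coeff j ((stage F k).H.coeff i) = 0 := by
      intro β i j h
      by_contra h0
      obtain ⟨j', -, hp⟩ := exists_newtonPoint h0
      have h1 := hne _ hp
      rw [Prod.mk.injEq] at h1
      have h2 : i = (stage F k).N := by exact_mod_cast h1.1
      rw [h2] at h
      omega
    have hA := I.agree hF hn one_pos I.b_le (hlow 1)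
    refine lowerEdge_and_restrictTo_eq_of_agree I hA (Or.inl ⟨?_, ?_⟩)
    · exact Set.eq_singleton_iff_unique_mem.2 ⟨hr, hne⟩
    · refine Set.eq_singleton_iff_unique_mem.2 ⟨hA.mem, ?_⟩
      rintro p ⟨i, hi, h, rfl⟩
      refine (hA.right _ ⟨i, hi, h, rfl⟩).resolve_left fun hlt => ?_
      have hiN : i < (stage F k).N := by
        simp only [wPoint] at hlt
        exact_mod_cast hlt
      -- A second point of the expansion would violate the line whose slope exceeds its own
      -- ordinate; `β = min + 1` is steep enough.
      obtain ⟨-, h1, -⟩ := I.line_spec hF hn (α := 1)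
        (β := (minPair F k (psi F) i).toNat + 1) one_pos (I.b_le.trans (Nat.le_add_left _ _))
        (hlow _)
      have h2 := h1 i hi h
      nlinarith

end Comparison

lemma natCast_ne_zero_of_ringChar {K : Type u} [Field K] {d : ℕ}
    (hchar : ringChar K = 0 ∨ d < ringChar K) {n : ℕ} (hn : 0 < n) (hnd : n ≤ d) :
    (n : K) ≠ 0 := by
  intro h
  have h1 := ringChar.dvd h
  rcases hchar with h2 | h2
  · rw [h2, zero_dvd_iff] at h1
    omega
  · have := Nat.le_of_dvd hn h1
    omega

end ApproxRoots

theorem mainTheorem8 {K : Type u} [Field K] [PerfectField K] (F : K⟦X⟧[X]) (hF : F.Monic)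
    (hd : 0 < F.natDegree) (hchar : ringChar K = 0 ∨ F.natDegree < ringChar K) :
    (∀ k < ApproxRoots.length F,
      ApproxRoots.newtonPolygon (ApproxRoots.stage F k).H =
          ApproxRoots.expansionPolygon F k (ApproxRoots.psi F) ∧
        ApproxRoots.boundary (ApproxRoots.stage F k).H =
          ApproxRoots.expansionBoundary F k (ApproxRoots.psi F)) ∧
    (ApproxRoots.lowerEdge
        (ApproxRoots.newtonPolygon (ApproxRoots.stage F (ApproxRoots.length F)).H) =
      ApproxRoots.lowerEdge
        (ApproxRoots.expansionPolygon F (ApproxRoots.length F) (ApproxRoots.psi F)) ∧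
    ApproxRoots.restrictTo
        (ApproxRoots.lowerEdge
          (ApproxRoots.newtonPolygon (ApproxRoots.stage F (ApproxRoots.length F)).H))
        (ApproxRoots.boundary (ApproxRoots.stage F (ApproxRoots.length F)).H) =
      ApproxRoots.restrictTo
        (ApproxRoots.lowerEdge
          (ApproxRoots.expansionPolygon F (ApproxRoots.length F) (ApproxRoots.psi F)))
        (ApproxRoots.expansionBoundary F (ApproxRoots.length F) (ApproxRoots.psi F))) := by
  have hn : ∀ n, 0 < n → n ≤ F.natDegree → (n : K) ≠ 0 := fun n h h' =>
    ApproxRoots.natCast_ne_zero_of_ringChar hchar h h'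
  obtain ⟨I⟩ := ApproxRoots.invariant_stage hF hd hn (ApproxRoots.length F) le_rfl
  exact ⟨fun k hk => ApproxRoots.polygon_and_boundary_eq hF hd hn hk,
    ApproxRoots.lowerEdge_and_restrictTo_eq hF hn I⟩
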